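/- Let $\mathscr V$ be a braided monoidal category (written as if strict), with braiding $c$, and let $\mathcal Q\mathscr V$ be its Cauchy completion (idempotent, or Karoubi, completion): objects are pairs $(X,e)$ with $e:X\to X$ idempotent, morphisms $(X,e)\to(X',e')$ are $f:X\to X'$ with $e'fe=f$, and $\mathcal Q\mathscr V$ is braided monoidal by restricting the structure of $\mathscr V$ along the idempotents. Composites below are written right to left. **Weak bimonoids.** A *weak bimonoid* is an object $A$ with a monoid structure $(\mu,\eta)$ and a comonoid structure $(\delta,\epsilon)$ such that - $\delta\mu=(\mu\otimes\mu)(1\otimes c\otimes1)(\delta\otimes\delta)$; - $\epsilon\mu(\mu\otimes1)=(\epsilon\mu\otimes\epsilon\mu)(1\otimes\delta\otimes1)=(\epsilon\mu\otimes\epsilon\mu)(1\otimes c^{-1}\delta\otimes1)$; - $(\delta\otimes1)\delta\eta=(1\otimes\mu\otimes1)(\delta\eta\otimes\delta\eta)=(1\otimes\mu c^{-1}\otimes1)(\delta\eta\otimes\delta\eta)$. Put $s=(1\otimes\epsilon\mu)(\delta\eta\otimes1)$, $t=(1\otimes\epsilon\mu)(c\otimes1)(1\otimes\delta\eta)$ and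 $r=(\epsilon\mu\otimes1)(1\otimes c)(\delta\eta\otimes1)$, all $A\to A$. With $f*g=\mu(f\otimes g)\delta$, an *antipode* is a morphism $\nu:A\to A$ with $\nu*1=t$, $1*\nu=r$ and $\nu*1*\nu=\nu$; a *weak Hopf monoid* is a weak bimonoid with an antipode. A *separable Frobenius monoid* is a monoid and comonoid $R$ with $(1\otimes\mu)(\delta\otimes1)=(\mu\otimes1)(1\otimes\delta)$ and $\mu\delta=1$. **Quantum categories.** For a comonoid $C$ let $C^\circ$ be $C$ with comultiplication $c\delta$ and the same counit. A *quantum category* consists of comonoids $A$ (object-of-arrows) and $C$ (object-of-objects), comonoid morphisms $s:A\to C^\circ$ and $t:A\to C$ with $c(s\otimes t)\delta=(t\otimes s)\delta$, and morphisms $\mu:P\to A$, $\eta:C\to A$ as follows. $A$ is a $C$-bicomodule with coactions $\gamma_l=c^{-1}(1\otimes s)\delta$ and $\gamma_r=(1\otimes t)\delta$. The morphism $\iota:P=A\otimes_CA\to A\otimes A$ is the equalizer of $\gamma_r\otimes1$ and $1\otimes\gamma_l$; the equalizers defining tensor products over $C$ are required to be preserved by all functors $Z\otimes-$. $P$ is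 a bicomodule by restriction of the outer coactions. Let $\delta_l:P\to A\otimes A\otimes P$ be determined by $(1\otimes1\otimes\iota)\delta_l=(1\otimes c\otimes1)(\delta\otimes\delta)\iota$ and $\delta_r:P\to P\otimes A$ by $(\iota\otimes1)\delta_r=(1\otimes1\otimes\mu)\delta_l$. The axioms are: - (B1) $(A,\mu,\eta)$ is a monoid in the monoidal category of $C$-bicomodules; - (B2) $(1\otimes\mu)(t\otimes\epsilon\otimes1)\delta_l=(1\otimes\mu)(\epsilon\otimes s\otimes1)\delta_l:P\to C\otimes A$; - (B3) $\delta\mu=(\mu\otimes1)\delta_r$; - (B4) $\epsilon\mu=(\epsilon\otimes\epsilon)\iota$; - (B5) $\epsilon\eta=\epsilon$; - (B6) $(\eta s\otimes1)\delta\eta=\delta\eta=(\eta t\otimes1)\delta\eta$. **Quantum groupoids.** A *quantum groupoid* is a quantum category with comonoid isomorphisms $\upsilon:C^{\circ\circ}\to C$ and $\nu:A^\circ\to A$ and an isomorphism $\theta:P_l\to P_r$ of left $A^{\otimes3}$-comodules, where $P_l$, $P_r$ denote $P$ with the coactions obtained from $(\delta_l\otimes1)\delta_r:P\to A\otimes A\otimes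 P\otimes A$ by applying, for $P_l$, first $\nu$ to the last factor and then $1\otimes1\otimes c_{P,A}$, and, for $P_r$, first $\nu^{-1}$ to the last factor and then $(c_{A,A\otimes A\otimes P})^{-1}$; such that - (G1) $s\nu=t$; - (G2) $t\nu=\upsilon s$; - (G3) $(1\otimes1\otimes\upsilon)\,c_{C,C\otimes C}\,\varsigma=\varsigma\,\theta$, where $\varsigma=(s\otimes1\otimes t)(\gamma_r\otimes1)\iota:P\to C^{\otimes3}$. **Theorem.** Let $A$ be a weak bimonoid in $\mathcal Q\mathscr V$, with $s,t$ as above. Then $t$ is idempotent; let $C=(A,t)$ be the object of $\mathcal Q\mathscr V$ obtained by splitting $t$. 1. $C$ is a separable Frobenius monoid with multiplication $\mu(t\otimes t)$, unit $\eta$, comultiplication $(t\otimes t)\delta$ and counit $\epsilon$. 2. $A$ is the object-of-arrows, and $C$ the object-of-objects, of a quantum category in $\mathcal Q\mathscr V$ with source $s:A\to C$, target $t:A\to C$, unit $t:C\to A$, and composition the restriction $\mu\iota:P\to A$ of the multiplication of $A$. Moreover $\iota:P\to A\otimes A$ splits the idempotent $(1\otimes\epsilon\mu\otimes1)(1\otimes1\otimes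 c^{-1})(\delta\otimes\delta)$ of $A\otimes A$. 3. If $\nu$ is an invertible antipode for $A$, then this quantum category is a quantum groupoid with $\upsilon=t\nu\nu t:C\to C$, the given $\nu$, and the isomorphism $\theta:P\to P$ that is the restriction along $\iota$ of $$(1\otimes\nu\mu)(c\otimes1)(1\otimes\delta):A\otimes A\to A\otimes A .$$ -/

import Mathlib

open CategoryTheory MonoidalCategory Limits Idempotents
open scoped MonObj ComonObj

universe v u

/-! ### The braided monoidal structure on the Cauchy completion -/

namespace KaroubiMonoidal

variable {V : Type u} [Category.{v} V] [MonoidalCategory V]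

/-- Unit, tensor products and constraints of the Cauchy completion: `(X, e) ⊗ (X', e')` is
`(X ⊗ X', e ⊗ e')`, the unit is `(𝟙_, 1)`, and every constraint of `V` is restricted along the
idempotents. -/
instance instMonoidalCategoryStruct : MonoidalCategoryStruct (Karoubi V) where
  tensorObj P Q := ⟨P.X ⊗ Q.X, P.p ⊗ₘ Q.p, by rw [tensorHom_comp_tensorHom, P.idem, Q.idem]⟩
  tensorUnit := ⟨𝟙_ V, 𝟙 _, Category.id_comp _⟩
  tensorHom f g := ⟨f.f ⊗ₘ g.f, by simp only [tensorHom_comp_tensorHom, f.comm, g.comm]⟩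
  whiskerLeft P _ _ f := ⟨P.p ⊗ₘ f.f, by simp [tensorHom_comp_tensorHom]⟩
  whiskerRight f P := ⟨f.f ⊗ₘ P.p, by simp [tensorHom_comp_tensorHom]⟩
  associator P Q R :=
    { hom := ⟨((P.p ⊗ₘ Q.p) ⊗ₘ R.p) ≫ (α_ P.X Q.X R.X).hom, by
        simp only [Category.assoc, ← associator_naturality, tensorHom_comp_tensorHom_assoc,
          tensorHom_comp_tensorHom, Karoubi.idem]⟩
      inv := ⟨(P.p ⊗ₘ (Q.p ⊗ₘ R.p)) ≫ (α_ P.X Q.X R.X).inv, by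
        simp only [Category.assoc, ← associator_inv_naturality, tensorHom_comp_tensorHom_assoc,
          tensorHom_comp_tensorHom, Karoubi.idem]⟩
      hom_inv_id := by
        ext
        simp only [Karoubi.comp_f, Karoubi.id_f, Category.assoc, associator_inv_naturality,
          Iso.hom_inv_id_assoc, tensorHom_comp_tensorHom, Karoubi.idem]
      inv_hom_id := by
        ext
        simp only [Karoubi.comp_f, Karoubi.id_f, Category.assoc, associator_naturality,
          Iso.inv_hom_id_assoc, tensorHom_comp_tensorHom, Karoubi.idem] }
  leftUnitor P :=
    { hom := ⟨(λ_ P.X).hom ≫ P.p, by simp⟩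
      inv := ⟨P.p ≫ (λ_ P.X).inv, by simp⟩
      hom_inv_id := by ext; simp
      inv_hom_id := by ext; simp }
  rightUnitor P :=
    { hom := ⟨(ρ_ P.X).hom ≫ P.p, by simp⟩
      inv := ⟨P.p ≫ (ρ_ P.X).inv, by simp⟩
      hom_inv_id := by ext; simp
      inv_hom_id := by ext; simp }

section aux

variable {P Q R S : Karoubi V}

theorem tensorObj_X (P Q : Karoubi V) : (P ⊗ Q).X = P.X ⊗ Q.X := rfl

theorem tensorObj_p (P Q : Karoubi V) : (P ⊗ Q).p = P.p ⊗ₘ Q.p := rfl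

theorem tensorUnit_X : (𝟙_ (Karoubi V)).X = 𝟙_ V := rfl

theorem tensorUnit_p : (𝟙_ (Karoubi V)).p = 𝟙 (𝟙_ V) := rfl

theorem tensorHom_f (f : P ⟶ Q) (g : R ⟶ S) : (f ⊗ₘ g).f = f.f ⊗ₘ g.f := rfl

theorem whiskerLeft_f (P : Karoubi V) (f : Q ⟶ R) : (P ◁ f).f = P.p ⊗ₘ f.f := rfl

theorem whiskerRight_f (f : Q ⟶ R) (P : Karoubi V) : (f ▷ P).f = f.f ⊗ₘ P.p := rfl

theorem associator_hom_f (P Q R : Karoubi V) :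
    (α_ P Q R).hom.f = ((P.p ⊗ₘ Q.p) ⊗ₘ R.p) ≫ (α_ P.X Q.X R.X).hom := rfl

theorem associator_inv_f (P Q R : Karoubi V) :
    (α_ P Q R).inv.f = (P.p ⊗ₘ (Q.p ⊗ₘ R.p)) ≫ (α_ P.X Q.X R.X).inv := rfl

theorem leftUnitor_hom_f (P : Karoubi V) : (λ_ P).hom.f = (λ_ P.X).hom ≫ P.p := rfl

theorem leftUnitor_inv_f (P : Karoubi V) : (λ_ P).inv.f = P.p ≫ (λ_ P.X).inv := rfl

theorem rightUnitor_hom_f (P : Karoubi V) : (ρ_ P).hom.f = (ρ_ P.X).hom ≫ P.p := rfl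

theorem rightUnitor_inv_f (P : Karoubi V) : (ρ_ P).inv.f = P.p ≫ (ρ_ P.X).inv := rfl

variable {X X' Y Y' Z Z' W W' T : V}

theorem comp_tensor_right (f : X ⟶ Y) (g : Y ⟶ Z) (h : W ⟶ W') :
    (f ≫ g) ⊗ₘ h = (f ⊗ₘ h) ≫ g ▷ W' := by
  rw [← tensorHom_id, tensorHom_comp_tensorHom, Category.comp_id]

theorem comp_tensor_left (f : X ⟶ Y) (g : Y ⟶ Z) (h : W ⟶ W') :
    h ⊗ₘ (f ≫ g) = (h ⊗ₘ f) ≫ W' ◁ g := by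
  rw [← id_tensorHom, tensorHom_comp_tensorHom, Category.comp_id]

/-- Naturality of an isomorphism, whiskered on the right. -/
theorem tensor_whiskerRight_assoc {f : X ⟶ X'} {f' : Y ⟶ Y'} {a : X ⟶ Y} {a' : X' ⟶ Y'}
    (w : f ≫ a' = a ≫ f') (k : W ⟶ W') (z : Y' ⊗ W' ⟶ T) :
    (f ⊗ₘ k) ≫ a' ▷ W' ≫ z = a ▷ W ≫ (f' ⊗ₘ k) ≫ z := by
  rw [← tensorHom_id, ← tensorHom_id, tensorHom_comp_tensorHom_assoc,
    tensorHom_comp_tensorHom_assoc, w, Category.comp_id, Category.id_comp]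

/-- Naturality of an isomorphism, whiskered on the left. -/
theorem tensor_whiskerLeft_assoc {f : X ⟶ X'} {f' : Y ⟶ Y'} {a : X ⟶ Y} {a' : X' ⟶ Y'}
    (w : f ≫ a' = a ≫ f') (k : W ⟶ W') (z : W' ⊗ Y' ⟶ T) :
    (k ⊗ₘ f) ≫ W' ◁ a' ≫ z = W ◁ a ≫ (k ⊗ₘ f') ≫ z := by
  rw [← id_tensorHom, ← id_tensorHom, tensorHom_comp_tensorHom_assoc,
    tensorHom_comp_tensorHom_assoc, w, Category.comp_id, Category.id_comp]

theorem tensor_whiskerRight {f : X ⟶ X'} {f' : Y ⟶ Y'} {a : X ⟶ Y} {a' : X' ⟶ Y'}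
    (w : f ≫ a' = a ≫ f') (k : W ⟶ W') :
    (f ⊗ₘ k) ≫ a' ▷ W' = a ▷ W ≫ (f' ⊗ₘ k) := by
  rw [← comp_tensor_right, w, ← tensorHom_id, tensorHom_comp_tensorHom, Category.id_comp]

theorem tensor_whiskerLeft {f : X ⟶ X'} {f' : Y ⟶ Y'} {a : X ⟶ Y} {a' : X' ⟶ Y'}
    (w : f ≫ a' = a ≫ f') (k : W ⟶ W') :
    (k ⊗ₘ f) ≫ W' ◁ a' = W ◁ a ≫ (k ⊗ₘ f') := by
  rw [← comp_tensor_left, w, ← id_tensorHom, tensorHom_comp_tensorHom, Category.id_comp]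

end aux

instance instMonoidalCategory : MonoidalCategory (Karoubi V) where
  tensorHom_def f g := by
    ext
    simp [tensorHom_f, whiskerRight_f, whiskerLeft_f, tensorHom_comp_tensorHom]
  id_tensorHom_id P Q := rfl
  tensorHom_comp_tensorHom f g h k := by
    ext
    simp [tensorHom_f, tensorHom_comp_tensorHom]
  whiskerLeft_id P Q := rfl
  id_whiskerRight P Q := rfl
  associator_naturality f g h := by
    ext
    simp only [Karoubi.comp_f, tensorHom_f, associator_hom_f, Category.assoc,
      associator_naturality, tensorHom_comp_tensorHom, tensorHom_comp_tensorHom_assoc,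
      Karoubi.comp_p, Karoubi.p_comp]
    simp only [← associator_naturality, tensorHom_comp_tensorHom_assoc, tensorHom_comp_tensorHom,
      Karoubi.comp_p]
  leftUnitor_naturality f := by
    ext
    change (𝟙 (𝟙_ V) ⊗ₘ f.f) ≫ (λ_ _).hom ≫ _ = ((λ_ _).hom ≫ _) ≫ f.f
    simp
  rightUnitor_naturality f := by
    ext
    change (f.f ⊗ₘ 𝟙 (𝟙_ V)) ≫ (ρ_ _).hom ≫ _ = ((ρ_ _).hom ≫ _) ≫ f.f
    simp
  pentagon P Q R S := by
    ext
    simp only [Karoubi.comp_f, whiskerLeft_f, whiskerRight_f, associator_hom_f, tensorObj_X,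
      tensorObj_p, comp_tensor_left, comp_tensor_right, Category.assoc]
    simp only [tensor_whiskerRight_assoc (associator_naturality P.p Q.p R.p),
      tensorHom_comp_tensorHom_assoc, tensorHom_comp_tensorHom, associator_naturality_assoc,
      Karoubi.idem]
    rw [tensor_whiskerLeft (associator_naturality Q.p R.p S.p)]
    simp only [tensorHom_comp_tensorHom_assoc, associator_naturality, associator_naturality_assoc,
      Karoubi.idem, pentagon_assoc, Category.comp_id, tensorHom_comp_tensorHom]
  triangle P Q := by
    ext
    change (((P.p ⊗ₘ 𝟙 (𝟙_ V)) ⊗ₘ Q.p) ≫ (α_ _ _ _).hom) ≫ (P.p ⊗ₘ ((λ_ Q.X).hom ≫ Q.p)) =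
      ((ρ_ P.X).hom ≫ P.p) ⊗ₘ Q.p
    rw [Category.assoc, associator_naturality_assoc, tensorHom_comp_tensorHom, id_tensorHom,
      leftUnitor_naturality_assoc, Karoubi.idem, Karoubi.idem, MonoidalCategory.tensorHom_def,
      MonoidalCategory.tensorHom_def, ← associator_naturality_left_assoc,
      MonoidalCategory.whiskerLeft_comp, triangle_assoc, ← comp_whiskerRight_assoc,
      rightUnitor_naturality]

variable [BraidedCategory V]

instance instBraidedCategory : BraidedCategory (Karoubi V) where
  braiding P Q :=
    { hom := ⟨(P.p ⊗ₘ Q.p) ≫ (β_ P.X Q.X).hom, by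
        simp only [tensorObj_p, Category.assoc, ← BraidedCategory.braiding_naturality,
          tensorHom_comp_tensorHom_assoc, tensorHom_comp_tensorHom, Karoubi.idem]⟩
      inv := ⟨(Q.p ⊗ₘ P.p) ≫ (β_ P.X Q.X).inv, by
        simp only [tensorObj_p, Category.assoc, ← BraidedCategory.braiding_inv_naturality,
          tensorHom_comp_tensorHom_assoc, tensorHom_comp_tensorHom, Karoubi.idem]⟩
      hom_inv_id := by
        ext
        simp only [Karoubi.comp_f, Karoubi.id_f, tensorObj_p, Category.assoc,
          BraidedCategory.braiding_inv_naturality, Iso.hom_inv_id_assoc,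
          tensorHom_comp_tensorHom, Karoubi.idem]
      inv_hom_id := by
        ext
        simp only [Karoubi.comp_f, Karoubi.id_f, tensorObj_p, Category.assoc,
          BraidedCategory.braiding_naturality, Iso.inv_hom_id_assoc,
          tensorHom_comp_tensorHom, Karoubi.idem] }
  braiding_naturality_right P Q R f := by
    ext
    simp only [Karoubi.comp_f, whiskerLeft_f, whiskerRight_f, Category.assoc,
      ← BraidedCategory.braiding_naturality]
    simp only [tensorHom_comp_tensorHom_assoc, Karoubi.p_comp, Karoubi.comp_p, Karoubi.idem]
  braiding_naturality_left f P := by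
    ext
    simp only [Karoubi.comp_f, whiskerLeft_f, whiskerRight_f, Category.assoc,
      ← BraidedCategory.braiding_naturality]
    simp only [tensorHom_comp_tensorHom_assoc, Karoubi.p_comp, Karoubi.comp_p, Karoubi.idem]
  hexagon_forward P Q R := by
    ext
    simp only [Karoubi.comp_f, whiskerLeft_f, whiskerRight_f, associator_hom_f, tensorObj_X,
      tensorObj_p, comp_tensor_left, comp_tensor_right, Category.assoc]
    simp only [tensor_whiskerRight_assoc (BraidedCategory.braiding_naturality P.p Q.p),
      tensor_whiskerLeft (BraidedCategory.braiding_naturality P.p R.p),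
      tensorHom_comp_tensorHom_assoc, tensorHom_comp_tensorHom, associator_naturality_assoc,
      BraidedCategory.braiding_naturality_assoc, associator_naturality, Karoubi.idem,
      BraidedCategory.hexagon_forward_assoc]
  hexagon_reverse P Q R := by
    ext
    simp only [Karoubi.comp_f, whiskerLeft_f, whiskerRight_f, associator_inv_f, tensorObj_X,
      tensorObj_p, comp_tensor_left, comp_tensor_right, Category.assoc]
    simp only [tensor_whiskerLeft_assoc (BraidedCategory.braiding_naturality Q.p R.p),
      tensor_whiskerRight (BraidedCategory.braiding_naturality P.p R.p),
      tensorHom_comp_tensorHom_assoc, tensorHom_comp_tensorHom, associator_inv_naturality_assoc,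
      BraidedCategory.braiding_naturality_assoc, associator_inv_naturality, Karoubi.idem,
      BraidedCategory.hexagon_reverse_assoc]

end KaroubiMonoidal

/-- The object `(X, e)` of the Cauchy completion carved out of `P = (X, p)` by an idempotent
`e : P ⟶ P`. -/
def splitting {V : Type u} [Category.{v} V] (P : Karoubi V) (e : P ⟶ P) (he : e ≫ e = e) :
    Karoubi V :=
  ⟨P.X, e.f, congrArg Karoubi.Hom.f he⟩

section WeakHopf

variable {𝒱 : Type u} [Category.{v} 𝒱] [MonoidalCategory 𝒱]

/-- A Frobenius monoid `R` (monoid and comonoid structures satisfying the Frobenius law) which is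
separable, i.e. comultiplication followed by multiplication is the identity. -/
structure IsSeparableFrobenius (R : 𝒱) [MonObj R] [ComonObj R] : Prop where
  frobenius : Δ[R] ▷ R ≫ (α_ R R R).hom ≫ R ◁ μ[R] = R ◁ Δ[R] ≫ (α_ R R R).inv ≫ μ[R] ▷ R
  separable : Δ[R] ≫ μ[R] = 𝟙 R

variable [BraidedCategory 𝒱]

/-- A weak bimonoid: a monoid and comonoid `A` such that the multiplication is compatible with the
comultiplication, and the multiplicativity of the counit and comultiplicativity of the unit are
replaced by the weak axioms `counit_mul_*` and `comul_unit_*`. -/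
class WeakBimonoid (A : 𝒱) [MonObj A] [ComonObj A] : Prop where
  mul_comul : μ[A] ≫ Δ[A] = (Δ[A] ⊗ₘ Δ[A]) ≫ tensorμ A A A A ≫ (μ[A] ⊗ₘ μ[A])
  counit_mul_left : μ[A] ▷ A ≫ μ[A] ≫ ε[A] =
    (A ◁ Δ[A]) ▷ A ≫ (α_ A A A).inv ▷ A ≫ (α_ (A ⊗ A) A A).hom ≫
      ((μ[A] ≫ ε[A]) ⊗ₘ (μ[A] ≫ ε[A])) ≫ (λ_ (𝟙_ 𝒱)).hom
  counit_mul_right : μ[A] ▷ A ≫ μ[A] ≫ ε[A] =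
    (A ◁ (Δ[A] ≫ (β_ A A).inv)) ▷ A ≫ (α_ A A A).inv ▷ A ≫ (α_ (A ⊗ A) A A).hom ≫
      ((μ[A] ≫ ε[A]) ⊗ₘ (μ[A] ≫ ε[A])) ≫ (λ_ (𝟙_ 𝒱)).hom
  comul_unit_left : η[A] ≫ Δ[A] ≫ Δ[A] ▷ A =
    (λ_ (𝟙_ 𝒱)).inv ≫ ((η[A] ≫ Δ[A]) ⊗ₘ (η[A] ≫ Δ[A])) ≫ (α_ (A ⊗ A) A A).inv ≫
      (α_ A A A).hom ▷ A ≫ (A ◁ μ[A]) ▷ A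
  comul_unit_right : η[A] ≫ Δ[A] ≫ Δ[A] ▷ A =
    (λ_ (𝟙_ 𝒱)).inv ≫ ((η[A] ≫ Δ[A]) ⊗ₘ (η[A] ≫ Δ[A])) ≫ (α_ (A ⊗ A) A A).inv ≫
      (α_ A A A).hom ▷ A ≫ (A ◁ ((β_ A A).inv ≫ μ[A])) ▷ A

section

variable (A : 𝒱) [MonObj A] [ComonObj A]

/-- The source morphism `s = (1 ⊗ ε μ)(δ η ⊗ 1)`. -/
def source : A ⟶ A :=
  (λ_ A).inv ≫ (η[A] ≫ Δ[A]) ▷ A ≫ (α_ A A A).hom ≫ A ◁ (μ[A] ≫ ε[A]) ≫ (ρ_ A).hom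

/-- The target morphism `t = (1 ⊗ ε μ)(c ⊗ 1)(1 ⊗ δ η)`. -/
def target : A ⟶ A :=
  (ρ_ A).inv ≫ A ◁ (η[A] ≫ Δ[A]) ≫ (α_ A A A).inv ≫ (β_ A A).hom ▷ A ≫ (α_ A A A).hom ≫
    A ◁ (μ[A] ≫ ε[A]) ≫ (ρ_ A).hom

/-- The morphism `r = (ε μ ⊗ 1)(1 ⊗ c)(δ η ⊗ 1)`. -/
def rMap : A ⟶ A :=
  (λ_ A).inv ≫ (η[A] ≫ Δ[A]) ▷ A ≫ (α_ A A A).hom ≫ A ◁ (β_ A A).hom ≫ (α_ A A A).inv ≫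
    (μ[A] ≫ ε[A]) ▷ A ≫ (λ_ A).hom

/-- The morphism `m = (1 ⊗ ε μ ⊗ 1)(δ ⊗ c⁻¹ δ)` on `A ⊗ A`. -/
def middle : A ⊗ A ⟶ A ⊗ A :=
  (Δ[A] ⊗ₘ (Δ[A] ≫ (β_ A A).inv)) ≫ (α_ A A (A ⊗ A)).hom ≫
    A ◁ ((α_ A A A).inv ≫ (μ[A] ≫ ε[A]) ▷ A ≫ (λ_ A).hom)

end

variable {A : 𝒱} [MonObj A] [ComonObj A]

/-- The convolution product `f ⋆ g = μ (f ⊗ g) δ`. -/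
def convolution (f g : A ⟶ A) : A ⟶ A := Δ[A] ≫ (f ⊗ₘ g) ≫ μ[A]

/-- `ν` is an antipode: `ν ⋆ 1 = t`, `1 ⋆ ν = r` and `ν ⋆ 1 ⋆ ν = ν`. -/
structure IsAntipode (ν : A ⟶ A) : Prop where
  antipode_id : convolution ν (𝟙 A) = target A
  id_antipode : convolution (𝟙 A) ν = rMap A
  antipode_id_antipode : convolution (convolution ν (𝟙 A)) ν = ν

/-- The endomorphism of `A ⊗ A` given by comultiplying the second factor, crossing its first leg
over to the left of the first factor, multiplying the rest and applying `ν`;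
on elements `a ⊗ b ↦ b₁ ⊗ ν (a b₂)`. -/
def twist (ν : A ⟶ A) : A ⊗ A ⟶ A ⊗ A :=
  A ◁ Δ[A] ≫ (α_ A A A).inv ≫ (β_ A A).hom ▷ A ≫ (α_ A A A).hom ≫ A ◁ (μ[A] ≫ ν)

end WeakHopf

section Comodules

variable {𝒱 : Type u} [Category.{v} 𝒱] [MonoidalCategory 𝒱]

/-- A bicomodule from `C` to `C`: an object `M` with commuting left and right coactions of the
comonoid `C`. -/
structure Bicomodule (C M : 𝒱) [ComonObj C] where
  left : M ⟶ C ⊗ M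
  right : M ⟶ M ⊗ C
  left_coassoc : left ≫ C ◁ left = left ≫ Δ[C] ▷ M ≫ (α_ C C M).hom
  left_counit : left ≫ ε[C] ▷ M = (λ_ M).inv
  right_coassoc : right ≫ right ▷ C = right ≫ M ◁ Δ[C] ≫ (α_ M C C).inv
  right_counit : right ≫ M ◁ ε[C] = (ρ_ M).inv
  comm : left ≫ C ◁ right = right ≫ left ▷ C ≫ (α_ C M C).hom

/-- The comonoid `C` as a bicomodule over itself. -/
def Bicomodule.regular (C : 𝒱) [ComonObj C] : Bicomodule C C where
  left := Δ[C]
  right := Δ[C]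
  left_coassoc := ComonObj.comul_assoc C
  left_counit := ComonObj.counit_comul C
  right_coassoc := by simp
  right_counit := ComonObj.comul_counit C
  comm := ComonObj.comul_assoc C

/-- A morphism compatible with both coactions. -/
structure IsBicomoduleHom {C M N : 𝒱} [ComonObj C] (X : Bicomodule C M) (Y : Bicomodule C N)
    (f : M ⟶ N) : Prop where
  left : f ≫ Y.left = X.left ≫ C ◁ f
  right : f ≫ Y.right = X.right ≫ f ▷ C

/-- A tensor product `M ⊗_C N` of bicomodules: an equalizer
`incl : M ⊗_C N ⟶ M ⊗ N` of `γ_r ⊗ 1` and `1 ⊗ γ_l`, preserved by the functors `Z ⊗ -`, together with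
the bicomodule structure induced from the left coaction of `M` and the right coaction of `N`. -/
structure TensorOver {C M N : 𝒱} [ComonObj C] (X : Bicomodule C M) (Y : Bicomodule C N) where
  obj : 𝒱
  incl : obj ⟶ M ⊗ N
  w : incl ≫ (X.right ▷ N ≫ (α_ M C N).hom) = incl ≫ M ◁ Y.left
  isLimit : IsLimit (Fork.ofι incl w)
  preserves : ∀ Z : 𝒱,
    PreservesLimit (parallelPair (X.right ▷ N ≫ (α_ M C N).hom) (M ◁ Y.left)) (tensorLeft Z)
  bicomodule : Bicomodule C obj
  left_incl : bicomodule.left ≫ C ◁ incl = incl ≫ X.left ▷ N ≫ (α_ C M N).hom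
  right_incl : bicomodule.right ≫ incl ▷ C = incl ≫ M ◁ Y.right ≫ (α_ M N C).inv

/-- `mul : A ⊗_C A ⟶ A` and `one : C ⟶ A` make the bicomodule `A` a monoid in the monoidal category
of bicomodules from `C` to `C`: both are bicomodule morphisms, the unit laws hold along the
canonical morphisms `u : A ⟶ A ⊗_C A` induced by the coactions and `one`, and the associative law
holds along the canonical isomorphism `(A ⊗_C A) ⊗_C A ≅ A ⊗_C (A ⊗_C A)`. -/
structure IsMonoidOver {C A : 𝒱} [ComonObj C] (X : Bicomodule C A) (P : TensorOver X X)
    (mul : P.obj ⟶ A) (one : C ⟶ A) : Prop where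
  mul_hom : IsBicomoduleHom P.bicomodule X mul
  one_hom : IsBicomoduleHom (Bicomodule.regular C) X one
  one_mul : ∃ u : A ⟶ P.obj, u ≫ P.incl = X.left ≫ one ▷ A ∧ u ≫ mul = 𝟙 A
  mul_one : ∃ u : A ⟶ P.obj, u ≫ P.incl = X.right ≫ A ◁ one ∧ u ≫ mul = 𝟙 A
  assoc : ∃ (T₁ : TensorOver P.bicomodule X) (T₂ : TensorOver X P.bicomodule)
    (a : T₁.obj ≅ T₂.obj) (m₁ : T₁.obj ⟶ P.obj) (m₂ : T₂.obj ⟶ P.obj),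
    a.hom ≫ T₂.incl ≫ A ◁ P.incl = T₁.incl ≫ P.incl ▷ A ≫ (α_ A A A).hom ∧
    m₁ ≫ P.incl = T₁.incl ≫ mul ▷ A ∧
    m₂ ≫ P.incl = T₂.incl ≫ A ◁ mul ∧
    m₁ ≫ mul = a.hom ≫ m₂ ≫ mul

end Comodules

section QuantumCategories

variable {𝒱 : Type u} [Category.{v} 𝒱] [MonoidalCategory 𝒱] [BraidedCategory 𝒱]

/-- The opposite comonoid `C°`: the object `C` with comultiplication `c δ` and counit `ε`. -/
def coop (C : 𝒱) : 𝒱 := C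

instance coopComonObj (C : 𝒱) [ComonObj C] : ComonObj (coop C) where
  counit := (ε[C] : C ⟶ 𝟙_ 𝒱)
  comul := (Δ[C] ≫ (β_ C C).hom : C ⟶ C ⊗ C)
  counit_comul := by
    change (Δ[C] ≫ (β_ C C).hom) ≫ ε[C] ▷ C = (λ_ C).inv
    rw [Category.assoc, ← BraidedCategory.braiding_naturality_right, ComonObj.comul_counit_assoc]
    simp
  comul_counit := by
    change (Δ[C] ≫ (β_ C C).hom) ≫ C ◁ ε[C] = (ρ_ C).inv
    rw [Category.assoc, ← BraidedCategory.braiding_naturality_left, ComonObj.counit_comul_assoc]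
    simp
  comul_assoc := by
    change (Δ[C] ≫ (β_ C C).hom) ≫ C ◁ (Δ[C] ≫ (β_ C C).hom) =
      (Δ[C] ≫ (β_ C C).hom) ≫ (Δ[C] ≫ (β_ C C).hom) ▷ C ≫ (α_ C C C).hom
    have h : (β_ (C ⊗ C) C).hom ≫ C ◁ (β_ C C).hom =
        (α_ C C C).hom ≫ (β_ C (C ⊗ C)).hom ≫ (β_ C C).hom ▷ C ≫ (α_ C C C).hom := by
      rw [BraidedCategory.braiding_tensor_left_hom, BraidedCategory.braiding_tensor_right_hom]
      simp only [Category.assoc, Iso.hom_inv_id_assoc]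
      rw [← BraidedCategory.yang_baxter, Iso.hom_inv_id_assoc]
    simp only [MonoidalCategory.whiskerLeft_comp, comp_whiskerRight, Category.assoc]
    rw [← BraidedCategory.braiding_naturality_left_assoc, h,
      ← BraidedCategory.braiding_naturality_right_assoc C Δ[C], ComonObj.comul_assoc_assoc]

/-- A quantum category with object-of-objects `C` and object-of-arrows `A`. -/
structure QuantumCategory (A C : 𝒱) [ComonObj A] [ComonObj C] where
  s : A ⟶ C
  t : A ⟶ C
  s_hom : IsComonHom (M := A) (N := coop C) s
  t_hom : IsComonHom (M := A) (N := C) t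
  source_target : Δ[A] ≫ (s ⊗ₘ t) ≫ (β_ C C).hom = Δ[A] ≫ (t ⊗ₘ s)
  /-- `A` as a bicomodule, with `γ_l = c⁻¹ (1 ⊗ s) δ` and `γ_r = (1 ⊗ t) δ`. -/
  bicomodule : Bicomodule C A
  bicomodule_left : bicomodule.left = Δ[A] ≫ A ◁ s ≫ (β_ C A).inv
  bicomodule_right : bicomodule.right = Δ[A] ≫ A ◁ t
  /-- The object of composable pairs `P = A ⊗_C A`. -/
  P : TensorOver bicomodule bicomodule
  /-- The left coaction of `A ⊗ A` on `P`, induced by that of `A ⊗ A` on itself. -/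
  δl : P.obj ⟶ (A ⊗ A) ⊗ P.obj
  δl_incl : δl ≫ (A ⊗ A) ◁ P.incl = P.incl ≫ (Δ[A] ⊗ₘ Δ[A]) ≫ tensorμ A A A A
  /-- The composition morphism. -/
  comp : P.obj ⟶ A
  /-- The identity morphism. -/
  id : C ⟶ A
  monoid : IsMonoidOver bicomodule P comp id
  comp_source_target :
    δl ≫ ((t ⊗ₘ ε[A]) ≫ (ρ_ C).hom) ▷ P.obj ≫ C ◁ comp =
      δl ≫ ((ε[A] ⊗ₘ s) ≫ (λ_ C).hom) ▷ P.obj ≫ C ◁ comp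
  /-- The right coaction of `A` on `P`, the factorization of `(1 ⊗ comp) δl` through `incl ⊗ 1`. -/
  δr : P.obj ⟶ P.obj ⊗ A
  δr_incl : δr ≫ P.incl ▷ A = δl ≫ (A ⊗ A) ◁ comp
  comp_comul : comp ≫ Δ[A] = δr ≫ comp ▷ A
  comp_counit : comp ≫ ε[A] = P.incl ≫ (ε[A] ⊗ₘ ε[A]) ≫ (λ_ (𝟙_ 𝒱)).hom
  id_counit : id ≫ ε[A] = ε[C]
  id_comul_source : id ≫ Δ[A] ≫ (s ≫ id) ▷ A = id ≫ Δ[A]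
  id_comul_target : id ≫ Δ[A] ≫ (t ≫ id) ▷ A = id ≫ Δ[A]

namespace QuantumCategory

variable {A C : 𝒱} [ComonObj A] [ComonObj C] (Q : QuantumCategory A C)

/-- The two coactions on `P` together, `P ⟶ A ⊗ A ⊗ P ⊗ A`. -/
def δ : Q.P.obj ⟶ (A ⊗ A) ⊗ (Q.P.obj ⊗ A) :=
  Q.δr ≫ Q.δl ▷ A ≫ (α_ (A ⊗ A) Q.P.obj A).hom

/-- The left `A ⊗ A ⊗ A`-comodule `P_l`:
`P ⟶ A ⊗ A ⊗ P ⊗ A ⟶ A ⊗ A ⊗ P ⊗ A ⟶ A ⊗ A ⊗ A ⊗ P`, by `δ`, then `ν` on the last factor, then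
`c_{P, A}`. -/
def coactionL (ν : A ≅ A) : Q.P.obj ⟶ ((A ⊗ A) ⊗ A) ⊗ Q.P.obj :=
  Q.δ ≫ (A ⊗ A) ◁ (Q.P.obj ◁ ν.hom ≫ (β_ Q.P.obj A).hom) ≫ (α_ (A ⊗ A) A Q.P.obj).inv

/-- The left `A ⊗ A ⊗ A`-comodule `P_r`:
`P ⟶ A ⊗ A ⊗ P ⊗ A ⟶ A ⊗ A ⊗ P ⊗ A ⟶ A ⊗ A ⊗ A ⊗ P`, by `δ`, then `ν⁻¹` on the last factor, then
the inverse of `c_{A, A ⊗ A ⊗ P}`. -/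
def coactionR (ν : A ≅ A) : Q.P.obj ⟶ ((A ⊗ A) ⊗ A) ⊗ Q.P.obj :=
  Q.δ ≫ (α_ (A ⊗ A) Q.P.obj A).inv ≫ ((A ⊗ A) ⊗ Q.P.obj) ◁ ν.inv ≫
    (β_ A ((A ⊗ A) ⊗ Q.P.obj)).inv ≫ (α_ A (A ⊗ A) Q.P.obj).inv ≫ (α_ A A A).inv ▷ Q.P.obj

/-- The morphism `ς = (s ⊗ 1 ⊗ t)(γ_r ⊗ 1) incl : P ⟶ C ⊗ C ⊗ C`. -/
def ς : Q.P.obj ⟶ C ⊗ (C ⊗ C) :=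
  Q.P.incl ≫ Q.bicomodule.right ▷ A ≫ ((Q.s ▷ C) ⊗ₘ Q.t) ≫ (α_ C C C).hom

/-- The further data making a quantum category a quantum groupoid: comonoid isomorphisms
`υ : C°° ⟶ C` and `ν : A° ⟶ A`, and an isomorphism `θ : P_l ⟶ P_r` of left
`A ⊗ A ⊗ A`-comodules. -/
structure GroupoidStructure where
  υ : C ≅ C
  υ_hom : IsComonHom (M := coop (coop C)) (N := C) υ.hom
  ν : A ≅ A
  ν_hom : IsComonHom (M := coop A) (N := A) ν.hom
  θ : Q.P.obj ≅ Q.P.obj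
  θ_hom : Q.coactionL ν ≫ ((A ⊗ A) ⊗ A) ◁ θ.hom = θ.hom ≫ Q.coactionR ν
  source_ν : ν.hom ≫ Q.s = Q.t
  target_ν : ν.hom ≫ Q.t = Q.s ≫ υ.hom
  θ_ς : θ.hom ≫ Q.ς =
    Q.ς ≫ (β_ C (C ⊗ C)).hom ≫ (α_ C C C).hom ≫ C ◁ (C ◁ υ.hom)

end QuantumCategory

end QuantumCategories

/-! Elements are written below in Sweedler style, with braidings suppressed: `δ a = a₁ ⊗ a₂` and `δ
η = 1₁ ⊗ 1₂`.

The weak axiom on `δ η` yields the two working identities `t a₁ ⊗ a₂ = 1₁ ⊗ a 1₂` and `s a₁ ⊗ a₂ =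
1₁ ⊗ 1₂ a` (`comul_target_left`, `comul_source_left`). The same axioms show that `t` is idempotent,
that its image is closed under multiplication, and that `(t ⊗ t) δ` factors through `t`. Hence `C`
is both a monoid and a comonoid. Moreover `t s = s` and `s t = t`, so `s` and `t` have the same
image. On that image `x y = x₁ ε (x₂ y)`, which with coassociativity gives the Frobenius law, and
`a₁ t a₂ = a` gives separability.

Composable pairs are split off `A ⊗ A` by `a ⊗ b ↦ a₁ ε (a₂ b₂) ⊗ b₁`. This idempotent equalizes
`γ_r ⊗ 1` and `1 ⊗ γ_l` because `t a₁ ⊗ a₂ b = s b₁ ⊗ a b₂` (`comul_target_mul_right`). Contraction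
with `ε μ` retracts `1 ⊗ γ_l` (`source_brInv_middle`), so the equalizer is split, hence absolute,
and is preserved by every functor. The idempotent commutes with the outer coactions and is absorbed
by `μ`. Its two copies on `A ⊗ A ⊗ A` commute (`middle_comm`), so a single object of triples serves
for both bracketings.

An antipode reverses both multiplication and comultiplication (`mul_antipode`, `antipode_comul`).
The map `θ` is `a ⊗ b ↦ b₁ ⊗ ν (a b₂)`, with inverse `a ⊗ b ↦ ν⁻¹ (a₂ b) ⊗ a₁` on composable pairs.
The groupoid axioms follow from `s ν = t`, `t ν = ν r`, `ν s = r` and the two reversal laws.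

All the calculations are equations between string diagrams on powers of `A`. A diagram is encoded as
a word, an equation is proved by an explicit list of rewriting steps that the kernel checks, and the
checker is proved sound once (`Known.derive`). Morphisms between retracts of powers reduce to such
words, preceded by the splitting idempotent (`Rep.ext`). The construction is carried out in any
braided monoidal category in which the required idempotents are given split; the Cauchy completion
only supplies the splittings at the end. -/

/-! ### Words of generators and their evaluation as string diagrams -/

namespace Diagram

/-- Names for the endomorphisms which may label a single strand. -/
inductive Endo
  | antipode | antipodeInv | source | target | rMap
  deriving DecidableEq

/-- The generators of string diagrams on powers of a monoid and comonoid. -/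
inductive Gen
  | mul | one | comul | counit | br | brInv
  | endo (φ : Endo)
  deriving DecidableEq

/-- Number of input strands. -/
def Gen.dom : Gen → ℕ
  | .mul | .br | .brInv => 2
  | .comul | .counit | .endo _ => 1
  | .one => 0

/-- Number of output strands. -/
def Gen.cod : Gen → ℕ
  | .comul | .br | .brInv => 2
  | .mul | .one | .endo _ => 1
  | .counit => 0

/-- A generator together with the number of strands to its left. -/
abbrev Op := ℕ × Gen

/-- A string diagram, read from top to bottom. -/
abbrev Word := List Op

abbrev m (k : ℕ) : Op := (k, .mul)
abbrev u (k : ℕ) : Op := (k, .one)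
abbrev d (k : ℕ) : Op := (k, .comul)
abbrev e (k : ℕ) : Op := (k, .counit)
abbrev c (k : ℕ) : Op := (k, .br)
abbrev b (k : ℕ) : Op := (k, .brInv)
abbrev n (k : ℕ) : Op := (k, .endo .antipode)
abbrev i (k : ℕ) : Op := (k, .endo .antipodeInv)
abbrev s (k : ℕ) : Op := (k, .endo .source)
abbrev t (k : ℕ) : Op := (k, .endo .target)
abbrev r (k : ℕ) : Op := (k, .endo .rMap)

/-- Interchange two consecutive operations acting on disjoint strands. -/
def swap (x y : Op) : Option (Op × Op) :=
  if x.1 + x.2.cod ≤ y.1 then some ((y.1 - x.2.cod + x.2.dom, y.2), x)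
  else if y.1 + y.2.dom ≤ x.1 then some (y, (x.1 - y.2.dom + y.2.cod, x.2))
  else none

/-- Move an operation to the right past everything which lies further right in the plane. -/
def push (x : Op) : Word → Word
  | [] => [x]
  | y :: w =>
    if x.1 + x.2.cod ≤ y.1 then (y.1 - x.2.cod + x.2.dom, y.2) :: push x w else x :: y :: w

/-- Push all operations to the right, starting from the last one. -/
def pushAll : Word → Word
  | [] => []
  | x :: w => push x (pushAll w)

/-- A normal form with respect to interchange. -/
def norm (w : Word) : Word := pushAll (pushAll w)

/-- Put a diagram to the right of `k` strands. -/
def shift (k : ℕ) (w : Word) : Word := w.map fun x => (k + x.1, x.2)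

/-- Number of strands after applying a diagram to `n` strands. -/
def width : Word → ℕ → ℕ
  | [], n => n
  | x :: w, n => width w (n - x.2.dom + x.2.cod)

/-- Insertion of a labelled operation in a word sorted by labels. -/
def insertLabel (x : ℕ × Op) : List (ℕ × Op) → Option (List (ℕ × Op))
  | [] => some [x]
  | y :: w =>
    if y.1 < x.1 then
      match swap x.2 y.2 with
      | none => none
      | some p => (insertLabel (x.1, p.2) w).map ((y.1, p.1) :: ·)
    else some (x :: y :: w)

/-- Sorting of a word by the labels given by the decimal digits of `l`. -/
def sortLabel : ℕ → Word → Option (List (ℕ × Op))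
  | _, [] => some []
  -- The units digit labels the first operation, so a numeral lists the labels from the last
  -- operation to the first. Missing leading digits count as label 0.
  | l, x :: w => (sortLabel (l / 10) w).bind (insertLabel (l % 10, x))

/-- An equation between diagrams with `inp` inputs. -/
structure Rule where
  inp : ℕ
  lhs : Word
  rhs : Word

/-- An application of the rule numbered `rule` at depth `depth`, to the operations labelled `1` by
the decimal digits of `labels`; those labelled `0` come before, those labelled `2` after them. -/
structure Step where
  rule : ℕ
  rev : Bool
  depth : ℕ
  labels : ℕ

abbrev fw (rule depth labels : ℕ) : Step := ⟨rule, false, depth, labels⟩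
abbrev bw (rule depth labels : ℕ) : Step := ⟨rule, true, depth, labels⟩

/-- Replace `src` by `tgt` in `w`. -/
def rewrite (N : ℕ) (R : Rule) (src tgt : Word) (k l : ℕ) (w : Word) : Option Word :=
  match sortLabel l w with
  | none => none
  | some L =>
    let B := (L.takeWhile fun x => x.1 == 0).map Prod.snd
    let L' := L.dropWhile fun x => x.1 == 0
    let M := (L'.takeWhile fun x => x.1 == 1).map Prod.snd
    let A := (L'.dropWhile fun x => x.1 == 1).map Prod.snd
    -- The test on the width is necessary for soundness: on no strands `[d 0, e 0]` is undefined
    -- while `[]` is the identity.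
    if norm M = norm (shift k src) ∧ k + R.inp ≤ width B N then
      some (norm (B ++ (shift k tgt ++ A)))
    else none

/-- Perform a step. -/
def Step.apply (N : ℕ) (R : Rule) (S : Step) (w : Word) : Option Word :=
  if S.rev then rewrite N R R.rhs R.lhs S.depth S.labels w
  else rewrite N R R.lhs R.rhs S.depth S.labels w

/-- Perform a list of steps. -/
def run (N : ℕ) (rules : List Rule) : List Step → Word → Option Word
  | [], w => some w
  | S :: l, w =>
    match rules[S.rule]? with
    | none => none
    | some R => (S.apply N R w).bind (run N rules l)

/-- The steps transform `w` into `w'`. -/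
def check (N : ℕ) (rules : List Rule) (l : List Step) (w w' : Word) : Bool :=
  run N rules l (norm w) == some (norm w')

variable {𝒱 : Type u} [Category.{v} 𝒱] [MonoidalCategory 𝒱]

/-- The power `A ⊗ (A ⊗ ⋯ (A ⊗ 𝟙_))`. -/
@[reducible] def pw (A : 𝒱) : ℕ → 𝒱
  | 0 => 𝟙_ 𝒱
  | n + 1 => A ⊗ pw A n

/-- Morphisms from a fixed power to another power. -/
abbrev Mor (A : 𝒱) (n : ℕ) := Option (Σ k, pw A n ⟶ pw A k)

variable {A : 𝒱}

/-- Tensoring on the left with `A`. -/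
def lift {n : ℕ} (x : Mor A n) : Mor A (n + 1) := x.map fun p => ⟨p.1 + 1, A ◁ p.2⟩

/-- Composition. -/
def andThen {n : ℕ} (x : Mor A n) (F : ∀ k, Mor A k) : Mor A n :=
  x.bind fun p => (F p.1).map fun q => ⟨q.1, p.2 ≫ q.2⟩

theorem andThen_some {n k : ℕ} (f : pw A n ⟶ pw A k) (F : ∀ k, Mor A k) :
    andThen (some ⟨k, f⟩ : Mor A n) F = (F k).map fun q => ⟨q.1, f ≫ q.2⟩ := rfl

theorem id_andThen {n : ℕ} (F : ∀ k, Mor A k) : andThen (some ⟨n, 𝟙 _⟩) F = F n := by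
  rcases h : F n with _ | ⟨k, f⟩ <;> simp [andThen_some, h]

theorem andThen_assoc {n : ℕ} (x : Mor A n) (F G : ∀ k, Mor A k) :
    andThen (andThen x F) G = andThen x (fun k => andThen (F k) G) := by
  rcases x with _ | ⟨k, f⟩
  · rfl
  · rw [andThen_some]
    dsimp only [andThen_some]
    rcases F k with _ | ⟨l, g⟩
    · rfl
    · rw [Option.map_some, andThen_some, andThen_some]
      rcases G l with _ | ⟨p, h⟩ <;> simp

theorem lift_andThen {n : ℕ} (x : Mor A n) (F G : ∀ k, Mor A k)
    (h : ∀ k, G (k + 1) = lift (F k)) : lift (andThen x F) = andThen (lift x) G := by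
  rcases x with _ | ⟨k, f⟩
  · rfl
  · have e : lift (some ⟨k, f⟩ : Mor A n) = some ⟨k + 1, A ◁ f⟩ := rfl
    rw [e, andThen_some, andThen_some, h]
    rcases F k with _ | ⟨p, g⟩
    · rfl
    · simp [lift]

theorem lift_some {n k : ℕ} (f : pw A n ⟶ pw A k) :
    lift (some ⟨k, f⟩ : Mor A n) = some ⟨k + 1, A ◁ f⟩ := rfl

/-- The six `natural_*` lemmas, one for each arity of a generator, are the interchange law for `⊗`
with its coherence isomorphisms written out. They feed `swap_zero`. -/
theorem natural_two_one {f : A ⊗ A ⟶ A} {X Y : 𝒱} (h : X ⟶ Y) :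
    ((α_ A A X).inv ≫ f ▷ X) ≫ A ◁ h = A ◁ A ◁ h ≫ (α_ A A Y).inv ≫ f ▷ Y := by
  rw [Category.assoc, ← whisker_exchange]
  simp

theorem natural_zero_one {f : 𝟙_ 𝒱 ⟶ A} {X Y : 𝒱} (h : X ⟶ Y) :
    ((λ_ X).inv ≫ f ▷ X) ≫ A ◁ h = h ≫ (λ_ Y).inv ≫ f ▷ Y := by
  rw [Category.assoc, ← whisker_exchange]
  simp

theorem natural_one_two {f : A ⟶ A ⊗ A} {X Y : 𝒱} (h : X ⟶ Y) :
    (f ▷ X ≫ (α_ A A X).hom) ≫ A ◁ A ◁ h = A ◁ h ≫ f ▷ Y ≫ (α_ A A Y).hom := by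
  rw [Category.assoc, ← associator_naturality_right, ← whisker_exchange_assoc]

theorem natural_one_zero {f : A ⟶ 𝟙_ 𝒱} {X Y : 𝒱} (h : X ⟶ Y) :
    (f ▷ X ≫ (λ_ X).hom) ≫ h = A ◁ h ≫ f ▷ Y ≫ (λ_ Y).hom := by
  rw [whisker_exchange_assoc]
  simp

theorem natural_two_two {f : A ⊗ A ⟶ A ⊗ A} {X Y : 𝒱} (h : X ⟶ Y) :
    ((α_ A A X).inv ≫ f ▷ X ≫ (α_ A A X).hom) ≫ A ◁ A ◁ h =
      A ◁ A ◁ h ≫ (α_ A A Y).inv ≫ f ▷ Y ≫ (α_ A A Y).hom := by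
  rw [Category.assoc, Category.assoc, ← associator_naturality_right, ← whisker_exchange_assoc]
  simp

theorem natural_one_one {f : A ⟶ A} {X Y : 𝒱} (h : X ⟶ Y) :
    f ▷ X ≫ A ◁ h = A ◁ h ≫ f ▷ Y :=
  (whisker_exchange _ _).symm

variable [BraidedCategory 𝒱] [MonObj A] [ComonObj A]

/-- Interpretation of the named endomorphisms. -/
def Endo.map (ν ν' : A ⟶ A) : Endo → (A ⟶ A)
  | .antipode => ν
  | .antipodeInv => ν'
  | .source => _root_.source A
  | .target => _root_.target A
  | .rMap => _root_.rMap A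

variable (ν ν' : A ⟶ A)

/-- A generator acting on the first strands. -/
def Gen.act : Gen → ∀ n, Mor A n
  | .mul, n + 2 => some ⟨n + 1, (α_ A A (pw A n)).inv ≫ μ[A] ▷ pw A n⟩
  | .one, n => some ⟨n + 1, (λ_ (pw A n)).inv ≫ η[A] ▷ pw A n⟩
  | .comul, n + 1 => some ⟨n + 2, Δ[A] ▷ pw A n ≫ (α_ A A (pw A n)).hom⟩
  | .counit, n + 1 => some ⟨n, ε[A] ▷ pw A n ≫ (λ_ (pw A n)).hom⟩
  | .br, n + 2 =>
    some ⟨n + 2, (α_ A A (pw A n)).inv ≫ (β_ A A).hom ▷ pw A n ≫ (α_ A A (pw A n)).hom⟩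
  | .brInv, n + 2 =>
    some ⟨n + 2, (α_ A A (pw A n)).inv ≫ (β_ A A).inv ▷ pw A n ≫ (α_ A A (pw A n)).hom⟩
  | .endo φ, n + 1 => some ⟨n + 1, φ.map ν ν' ▷ pw A n⟩
  | _, _ => none

/-- A generator acting at a given depth. -/
def act : ℕ → Gen → ∀ n, Mor A n
  | 0, g, n => g.act ν ν' n
  | k + 1, g, n + 1 => lift (act k g n)
  | _ + 1, _, 0 => none

/-- Evaluation of a diagram. -/
def eval : Word → ∀ n, Mor A n
  | [], n => some ⟨n, 𝟙 _⟩
  | x :: w, n => andThen (act ν ν' x.1 x.2 n) (eval w)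

/-- Two diagrams with `n` inputs are equal on every power of `A` with at least `n` factors. -/
def Rel (n : ℕ) (w w' : Word) : Prop := ∀ j, eval ν ν' w (j + n) = eval ν ν' w' (j + n)

variable {ν ν'}

theorem Rel.symm {n : ℕ} {w w' : Word} (h : Rel ν ν' n w w') : Rel ν ν' n w' w :=
  fun j => (h j).symm

theorem eval_append (w w' : Word) (n : ℕ) :
    eval ν ν' (w ++ w') n = andThen (eval ν ν' w n) (eval ν ν' w') := by
  induction w generalizing n with
  | nil => rw [List.nil_append, eval, id_andThen]
  | cons x w ih =>
    rw [List.cons_append, eval, eval, andThen_assoc]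
    congr 1
    funext k
    exact ih k

theorem eval_shift_one (w : Word) (n : ℕ) :
    eval ν ν' (shift 1 w) (n + 1) = lift (eval ν ν' w n) := by
  induction w generalizing n with
  | nil =>
    simp only [shift, eval, lift, List.map_nil, Option.map_some, MonoidalCategory.whiskerLeft_id]
  | cons x w ih =>
    change andThen (act ν ν' (1 + x.1) x.2 (n + 1)) (eval ν ν' (shift 1 w)) =
      lift (andThen (act ν ν' x.1 x.2 n) (eval ν ν' w))
    rw [lift_andThen _ _ _ ih, Nat.add_comm 1, act]

theorem shift_zero (w : Word) : shift 0 w = w := by simp [shift]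

theorem shift_succ (k : ℕ) (w : Word) : shift (k + 1) w = shift 1 (shift k w) := by
  simp only [shift, List.map_map]
  congr 1
  funext x
  simp only [Function.comp_apply, Prod.mk.injEq, and_true]
  omega

theorem Rel.shift {n : ℕ} {w w' : Word} (h : Rel ν ν' n w w') (k : ℕ) :
    Rel ν ν' (k + n) (shift k w) (shift k w') := by
  intro j
  induction k with
  | zero =>
    rw [shift_zero, shift_zero, Nat.zero_add]
    exact h j
  | succ k ih =>
    rw [shift_succ k w, shift_succ k w', show j + (k + 1 + n) = j + (k + n) + 1 by omega, eval_shift_one,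
      eval_shift_one, ih]

theorem act_zero (g : Gen) (n : ℕ) : act ν ν' 0 g n = g.act ν ν' n := by
  cases n <;> rfl

theorem act_succ (k : ℕ) (g : Gen) (n : ℕ) : act ν ν' (k + 1) g (n + 1) = lift (act ν ν' k g n) :=
  rfl

/-- The bound `k + g.dom ≤ n` is carried through the induction because without it truncated
subtraction would not commute with adding a strand. -/
theorem act_width (k : ℕ) (g : Gen) (n : ℕ) (p) (h : act ν ν' k g n = some p) :
    p.1 = n - g.dom + g.cod ∧ k + g.dom ≤ n := by
  induction k generalizing n with
  | zero =>
    rw [act_zero] at h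
    rcases g with _ | _ | _ | _ | _ | _ | _ <;> rcases n with _ | _ | n <;>
      first
      | (simp [Gen.act] at h; done)
      | (simp only [Gen.act, Option.some.injEq] at h; subst h; simp [Gen.dom, Gen.cod])
  | succ k ih =>
    rcases n with _ | n
    · simp [act] at h
    · rw [act_succ] at h
      rcases h' : act ν ν' k g n with _ | q
      · rw [h'] at h
        cases h
      · rw [h'] at h
        obtain ⟨h1, h2⟩ := ih n q h'
        cases h
        simp only
        omega

theorem eval_width (w : Word) (n : ℕ) (p) (h : eval ν ν' w n = some p) : p.1 = width w n := by
  induction w generalizing n p with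
  | nil => cases h; rfl
  | cons x w ih =>
    rw [eval] at h
    rcases h' : act ν ν' x.1 x.2 n with _ | ⟨k, f⟩
    · rw [h'] at h
      cases h
    · rw [h', andThen_some] at h
      rcases h'' : eval ν ν' w k with _ | q
      · rw [h''] at h
        cases h
      · rw [h''] at h
        cases h
        rw [width, ← (act_width _ _ _ _ h').1]
        exact ih _ _ h''

/-! ### Interchange of operations on disjoint strands. -/

/-- This is naturality of the generator in the strands to its right. When there are too few strands
both sides are undefined. -/
theorem swap_zero (g g' : Gen) (k n : ℕ) :
    andThen (act ν ν' 0 g n) (act ν ν' (g.cod + k) g') =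
      andThen (act ν ν' (g.dom + k) g' n) (act ν ν' 0 g) := by
  have e1 : ∀ k, 1 + k = k + 1 := fun k => Nat.add_comm 1 k
  have e2 : ∀ k, 2 + k = k + 1 + 1 := fun k => Nat.add_comm 2 k
  have e3 : act ν ν' 0 g = g.act ν ν' := funext (act_zero g)
  rw [e3]
  rcases g with _ | _ | _ | _ | _ | _ | φ <;>
    simp only [Gen.dom, Gen.cod, Nat.zero_add, e1, e2]
  · rcases n with _ | _ | n
    · rfl
    · rfl
    · change Option.map _ (lift (act ν ν' k g' n)) = andThen (lift (lift (act ν ν' k g' n))) _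
      rcases act ν ν' k g' n with _ | ⟨p, f⟩
      · rfl
      · exact congrArg (fun h => some (Sigma.mk _ h)) (natural_two_one f)
  · change Option.map _ (lift (act ν ν' k g' n)) = andThen (act ν ν' k g' n) _
    rcases act ν ν' k g' n with _ | ⟨p, f⟩
    · rfl
    · exact congrArg (fun h => some (Sigma.mk _ h)) (natural_zero_one f)
  · rcases n with _ | n
    · rfl
    · change Option.map _ (lift (lift (act ν ν' k g' n))) = andThen (lift (act ν ν' k g' n)) _
      rcases act ν ν' k g' n with _ | ⟨p, f⟩
      · rfl
      · exact congrArg (fun h => some (Sigma.mk _ h)) (natural_one_two f)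
  · rcases n with _ | n
    · rfl
    · change Option.map _ (act ν ν' k g' n) = andThen (lift (act ν ν' k g' n)) _
      rcases act ν ν' k g' n with _ | ⟨p, f⟩
      · rfl
      · exact congrArg (fun h => some (Sigma.mk _ h)) (natural_one_zero f)
  · rcases n with _ | _ | n
    · rfl
    · rfl
    · change Option.map _ (lift (lift (act ν ν' k g' n))) = andThen (lift (lift (act ν ν' k g' n))) _
      rcases act ν ν' k g' n with _ | ⟨p, f⟩
      · rfl
      · exact congrArg (fun h => some (Sigma.mk _ h)) (natural_two_two f)
  · rcases n with _ | _ | n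
    · rfl
    · rfl
    · change Option.map _ (lift (lift (act ν ν' k g' n))) = andThen (lift (lift (act ν ν' k g' n))) _
      rcases act ν ν' k g' n with _ | ⟨p, f⟩
      · rfl
      · exact congrArg (fun h => some (Sigma.mk _ h)) (natural_two_two f)
  · rcases n with _ | n
    · rfl
    · change Option.map _ (lift (act ν ν' k g' n)) = andThen (lift (act ν ν' k g' n)) _
      rcases act ν ν' k g' n with _ | ⟨p, f⟩
      · rfl
      · exact congrArg (fun h => some (Sigma.mk _ h)) (natural_one_one f)

theorem swap_at (g g' : Gen) (k l n : ℕ) :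
    andThen (act ν ν' k g n) (act ν ν' (k + g.cod + l) g') =
      andThen (act ν ν' (k + g.dom + l) g' n) (act ν ν' k g) := by
  induction k generalizing n with
  | zero => simpa only [Nat.zero_add] using swap_zero g g' l n
  | succ k ih =>
    rw [show k + 1 + g.cod + l = k + g.cod + l + 1 by omega,
      show k + 1 + g.dom + l = k + g.dom + l + 1 by omega]
    rcases n with _ | n
    · rfl
    · rw [act_succ, act_succ, ← lift_andThen _ _ _ (act_succ _ _), ih,
        lift_andThen _ _ _ (act_succ _ _)]

theorem eval_cons_cons (x y : Op) (w : Word) (n : ℕ) :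
    eval ν ν' (x :: y :: w) n =
      andThen (andThen (act ν ν' x.1 x.2 n) (act ν ν' y.1 y.2)) (eval ν ν' w) := by
  rw [andThen_assoc]
  rfl

theorem eval_swap_right {x y : Op} (h : x.1 + x.2.cod ≤ y.1) (w : Word) (n : ℕ) :
    eval ν ν' (x :: y :: w) n =
      eval ν ν' ((y.1 - x.2.cod + x.2.dom, y.2) :: x :: w) n := by
  obtain ⟨l, hl⟩ := Nat.exists_eq_add_of_le h
  rw [eval_cons_cons, eval_cons_cons, hl, swap_at]
  dsimp only
  rw [show x.1 + x.2.cod + l - x.2.cod + x.2.dom = x.1 + x.2.dom + l by omega]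

theorem eval_swap_left {x y : Op} (h : y.1 + y.2.dom ≤ x.1) (w : Word) (n : ℕ) :
    eval ν ν' (x :: y :: w) n =
      eval ν ν' (y :: (x.1 - y.2.dom + y.2.cod, x.2) :: w) n := by
  obtain ⟨l, hl⟩ := Nat.exists_eq_add_of_le h
  rw [eval_cons_cons, eval_cons_cons, hl, ← swap_at]
  dsimp only
  rw [show y.1 + y.2.dom + l - y.2.dom + y.2.cod = y.1 + y.2.cod + l by omega]

theorem eval_swap {x y : Op} {p : Op × Op} (h : swap x y = some p) (w : Word) (n : ℕ) :
    eval ν ν' (x :: y :: w) n = eval ν ν' (p.1 :: p.2 :: w) n := by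
  rw [swap] at h
  split_ifs at h with h1 h2
  · cases h
    exact eval_swap_right h1 w n
  · cases h
    exact eval_swap_left h2 w n

/-! ### Soundness of the rewriting checker. -/

theorem eval_cons_congr (x : Op) {w w' : Word} (h : ∀ n, eval ν ν' w n = eval ν ν' w' n) (n : ℕ) :
    eval ν ν' (x :: w) n = eval ν ν' (x :: w') n := by
  rw [eval, eval, funext h]

theorem eval_push (x : Op) (w : Word) (n : ℕ) :
    eval ν ν' (push x w) n = eval ν ν' (x :: w) n := by
  induction w generalizing n with
  | nil => rfl
  | cons y w ih =>
    rw [push]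
    split_ifs with h
    · rw [eval_swap_right h, eval_cons_congr _ ih]
    · rfl

theorem eval_pushAll (w : Word) (n : ℕ) : eval ν ν' (pushAll w) n = eval ν ν' w n := by
  induction w generalizing n with
  | nil => rfl
  | cons x w ih => rw [pushAll, eval_push, eval_cons_congr _ ih]

theorem eval_norm (w : Word) (n : ℕ) : eval ν ν' (norm w) n = eval ν ν' w n := by
  rw [norm, eval_pushAll, eval_pushAll]

theorem eval_insertLabel (x : ℕ × Op) (w w' : List (ℕ × Op)) (h : insertLabel x w = some w')
    (n : ℕ) : eval ν ν' (w'.map Prod.snd) n = eval ν ν' (x.2 :: w.map Prod.snd) n := by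
  induction w generalizing x w' n with
  | nil =>
    cases h
    rfl
  | cons y w ih =>
    rw [insertLabel] at h
    split_ifs at h
    · rcases h1 : swap x.2 y.2 with _ | p
      · rw [h1] at h
        cases h
      · simp only [h1] at h
        rcases h2 : insertLabel (x.1, p.2) w with _ | w₁
        · rw [h2] at h
          cases h
        · rw [h2] at h
          cases h
          rw [List.map_cons, List.map_cons, eval_swap h1]
          exact eval_cons_congr _ (fun k => ih _ _ h2 k) n
    · cases h
      rfl

theorem eval_sortLabel (l : ℕ) (w : Word) (w' : List (ℕ × Op)) (h : sortLabel l w = some w')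
    (n : ℕ) : eval ν ν' (w'.map Prod.snd) n = eval ν ν' w n := by
  induction w generalizing l w' n with
  | nil =>
    cases h
    rfl
  | cons x w ih =>
    rw [sortLabel] at h
    rcases h1 : sortLabel (l / 10) w with _ | w₁
    · rw [h1] at h
      cases h
    · rw [h1, Option.bind_some] at h
      rw [eval_insertLabel _ _ _ h]
      exact eval_cons_congr _ (fun k => ih _ _ h1 k) n

theorem Rel.eval_eq {p : ℕ} {w w' : Word} (h : Rel ν ν' p w w') (k n : ℕ) (hn : k + p ≤ n) :
    eval ν ν' (Diagram.shift k w) n = eval ν ν' (Diagram.shift k w') n := by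
  obtain ⟨j, rfl⟩ := Nat.exists_eq_add_of_le' hn
  exact h.shift k j

/-- The checker tests widths on `N` strands only, whereas the conclusion is needed on `j + N`
strands for every `j`. -/
theorem width_mono (w : Word) {k l : ℕ} (h : k ≤ l) : width w k ≤ width w l := by
  induction w generalizing k l with
  | nil => exact h
  | cons x w ih =>
    rw [width, width]
    exact ih (by omega)

/-- Agreement on one number of strands is enough: if `a` is defined it ends on exactly `width a N`
strands, and otherwise both sides are undefined. -/
theorem eval_append_congr (a b : Word) {w w' : Word} (N : ℕ)
    (h : eval ν ν' w (width a N) = eval ν ν' w' (width a N)) :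
    eval ν ν' (a ++ (w ++ b)) N = eval ν ν' (a ++ (w' ++ b)) N := by
  rw [eval_append, eval_append]
  rcases h' : eval ν ν' a N with _ | ⟨k, f⟩
  · rfl
  · obtain rfl : k = width a N := eval_width _ _ _ h'
    rw [andThen_some, andThen_some, eval_append, eval_append, h]

/-- Sorting by labels and normalising only interchange disjoint operations, so they preserve the
value. The replacement of the middle block is the one place where `hR` enters. No uniqueness of
normal forms is needed. -/
theorem eval_rewrite {N : ℕ} {R : Rule} {src tgt : Word} (hR : Rel ν ν' R.inp src tgt)
    {k l : ℕ} {w w' : Word} (h : rewrite N R src tgt k l w = some w') (j : ℕ) :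
    eval ν ν' w (j + N) = eval ν ν' w' (j + N) := by
  rw [rewrite] at h
  rcases h1 : sortLabel l w with _ | L
  · simp [h1] at h
  · simp only [h1] at h
    split_ifs at h with h2
    obtain ⟨h2, h3⟩ := h2
    cases h
    rw [eval_norm, ← eval_sortLabel _ _ _ h1]
    have hw := h3.trans (width_mono _ (Nat.le_add_left N j))
    rw [← eval_append_congr _ _ _ (hR.eval_eq k _ hw), ← eval_append_congr _ _ _ ?_, ← List.map_append,
      ← List.map_append, List.takeWhile_append_dropWhile, List.takeWhile_append_dropWhile]
    rw [← eval_norm (List.map _ _), h2, eval_norm]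

theorem eval_apply {N : ℕ} {R : Rule} (hR : Rel ν ν' R.inp R.lhs R.rhs) {S : Step} {w w' : Word}
    (h : S.apply N R w = some w') (j : ℕ) : eval ν ν' w (j + N) = eval ν ν' w' (j + N) := by
  rw [Step.apply] at h
  split_ifs at h
  · exact eval_rewrite hR.symm h j
  · exact eval_rewrite hR h j

theorem eval_run {N : ℕ} {rules : List Rule} (hR : ∀ R ∈ rules, Rel ν ν' R.inp R.lhs R.rhs)
    (l : List Step) {w w' : Word} (h : run N rules l w = some w') (j : ℕ) :
    eval ν ν' w (j + N) = eval ν ν' w' (j + N) := by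
  induction l generalizing w with
  | nil =>
    cases h
    rfl
  | cons S l ih =>
    rw [run] at h
    rcases h1 : rules[S.rule]? with _ | R
    · simp [h1] at h
    · simp only [h1] at h
      rcases h2 : S.apply N R w with _ | w₁
      · simp [h2] at h
      · rw [h2, Option.bind_some] at h
        rw [eval_apply (hR R (List.mem_of_getElem? h1)) h2, ih h]

variable (ν ν') in
/-- A list of equations which are known to hold. -/
inductive Known : List Rule → Prop
  | nil : Known []
  | cons {N : ℕ} {w w' : Word} {l : List Rule} (h : Rel ν ν' N w w') (hl : Known l) :
    Known (⟨N, w, w'⟩ :: l)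

infixr:67 " ∷ " => Known.cons

theorem Known.rel {l : List Rule} (h : Known ν ν' l) : ∀ R ∈ l, Rel ν ν' R.inp R.lhs R.rhs := by
  induction h with
  | nil => simp
  | cons h _ ih => simpa using ⟨h, ih⟩

/-- Diagrams related by a checked rewriting are equal. -/
theorem Known.derive {rules : List Rule} (hR : Known ν ν' rules) {N : ℕ} {w w' : Word}
    -- The list `l` is a certificate; by default the kernel evaluates the checker on it.
    (l : List Step) (h : check N rules l w w' = true := by decide +kernel) : Rel ν ν' N w w' := by
  intro j
  have h' : run N rules l (norm w) = some (norm w') := by simpa [check] using h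
  rw [← eval_norm w, ← eval_norm w', eval_run hR.rel l h']

end Diagram

/-! ### The basic equations between diagrams -/

namespace Diagram

variable {𝒱 : Type u} [Category.{v} 𝒱] [MonoidalCategory 𝒱]

/-- The axioms come with associators and unitors, while words act on right-nested powers. Whiskering
by the remaining strands `W` and inserting coherence isomorphisms by `⊗≫` bridges the two. -/
theorem whisker_transport {X Y X' Y' : 𝒱} {f g : X ⟶ Y} (h : f = g) (W : 𝒱)
    [MonoidalCoherence X' (X ⊗ W)] [MonoidalCoherence (Y ⊗ W) Y'] {F G : X' ⟶ Y'}
    (hF : F = 𝟙 X' ⊗≫ f ▷ W ⊗≫ 𝟙 Y') (hG : G = 𝟙 X' ⊗≫ g ▷ W ⊗≫ 𝟙 Y') : F = G := by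
  rw [hF, hG, h]

variable [BraidedCategory 𝒱] {A : 𝒱} [MonObj A] [ComonObj A] {ν ν' : A ⟶ A}

theorem mul_assoc : Rel ν ν' 3 [m 0, m 0] [m 1, m 0] := by
  intro j
  refine congrArg (fun h => some (Sigma.mk (j + 1) h)) ?_
  dsimp only [pw, Endo.map]
  exact whisker_transport (MonObj.mul_assoc A) (pw A j) (by monoidal) (by monoidal)

theorem one_mul : Rel ν ν' 1 [u 0, m 0] [] := by
  intro j
  refine congrArg (fun h => some (Sigma.mk (j + 1) h)) ?_
  dsimp only [pw, Endo.map]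
  exact whisker_transport (MonObj.one_mul A) (pw A j) (by monoidal) (by monoidal)

theorem mul_one : Rel ν ν' 1 [u 1, m 0] [] := by
  intro j
  refine congrArg (fun h => some (Sigma.mk (j + 1) h)) ?_
  dsimp only [pw, Endo.map]
  exact whisker_transport (MonObj.mul_one A) (pw A j) (by monoidal) (by monoidal)

theorem comul_assoc : Rel ν ν' 1 [d 0, d 0] [d 0, d 1] := by
  intro j
  refine congrArg (fun h => some (Sigma.mk (j + 3) h)) ?_
  dsimp only [pw, Endo.map]
  exact whisker_transport ((ComonObj.comul_assoc A).symm) (pw A j) (by monoidal) (by monoidal)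

theorem counit_comul : Rel ν ν' 1 [d 0, e 0] [] := by
  intro j
  refine congrArg (fun h => some (Sigma.mk (j + 1) h)) ?_
  dsimp only [pw, Endo.map]
  exact whisker_transport (ComonObj.counit_comul A) (pw A j) (by monoidal) (by monoidal)

theorem comul_counit : Rel ν ν' 1 [d 0, e 1] [] := by
  intro j
  refine congrArg (fun h => some (Sigma.mk (j + 1) h)) ?_
  dsimp only [pw, Endo.map]
  exact whisker_transport (ComonObj.comul_counit A) (pw A j) (by monoidal) (by monoidal)

theorem br_brInv : Rel ν ν' 2 [c 0, b 0] [] := by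
  intro j
  refine congrArg (fun h => some (Sigma.mk (j + 2) h)) ?_
  dsimp only [pw, Endo.map]
  exact whisker_transport ((β_ A A).hom_inv_id) (pw A j) (by monoidal) (by monoidal)

theorem brInv_br : Rel ν ν' 2 [b 0, c 0] [] := by
  intro j
  refine congrArg (fun h => some (Sigma.mk (j + 2) h)) ?_
  dsimp only [pw, Endo.map]
  exact whisker_transport ((β_ A A).inv_hom_id) (pw A j) (by monoidal) (by monoidal)

theorem mul_comul [WeakBimonoid A] : Rel ν ν' 2 [m 0, d 0] [d 0, d 2, c 1, m 0, m 1] := by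
  intro j
  refine congrArg (fun h => some (Sigma.mk (j + 2) h)) ?_
  dsimp only [pw, Endo.map]
  have h := WeakBimonoid.mul_comul (A := A)
  simp only [tensorμ, MonoidalCategory.tensorHom_def] at h
  exact whisker_transport h (pw A j) (by monoidal) (by monoidal)

theorem counit_mul_left [WeakBimonoid A] : Rel ν ν' 3 [m 0, m 0, e 0] [d 1, m 0, e 0, m 0, e 0] :=
  by
  intro j
  refine congrArg (fun h => some (Sigma.mk (j) h)) ?_
  dsimp only [pw, Endo.map]
  have h := WeakBimonoid.counit_mul_left (A := A)
  simp only [MonoidalCategory.tensorHom_def] at h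
  exact whisker_transport h (pw A j) (by monoidal) (by monoidal)

theorem counit_mul_right [WeakBimonoid A] : Rel ν ν' 3 [m 0, m 0, e 0] [d 1, b 1, m 0, e 0, m 0,
  e 0] := by
  intro j
  refine congrArg (fun h => some (Sigma.mk (j) h)) ?_
  dsimp only [pw, Endo.map]
  have h := WeakBimonoid.counit_mul_right (A := A)
  simp only [MonoidalCategory.tensorHom_def] at h
  exact whisker_transport h (pw A j) (by monoidal) (by monoidal)

theorem comul_unit_left [WeakBimonoid A] : Rel ν ν' 0 [u 0, d 0, d 0] [u 0, d 0, u 2, d 2, m 1] :=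
  by
  intro j
  refine congrArg (fun h => some (Sigma.mk (j + 3) h)) ?_
  dsimp only [pw, Endo.map]
  have h := WeakBimonoid.comul_unit_left (A := A)
  simp only [MonoidalCategory.tensorHom_def] at h
  exact whisker_transport h (pw A j) (by monoidal) (by monoidal)

theorem comul_unit_right [WeakBimonoid A] : Rel ν ν' 0 [u 0, d 0, d 0] [u 0, d 0, u 2, d 2, b 1,
  m 1] := by
  intro j
  refine congrArg (fun h => some (Sigma.mk (j + 3) h)) ?_
  dsimp only [pw, Endo.map]
  have h := WeakBimonoid.comul_unit_right (A := A)
  simp only [MonoidalCategory.tensorHom_def] at h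
  exact whisker_transport h (pw A j) (by monoidal) (by monoidal)

theorem source_eq : Rel ν ν' 1 [s 0] [u 0, d 0, m 1, e 1] := by
  intro j
  refine congrArg (fun h => some (Sigma.mk (j + 1) h)) ?_
  dsimp only [pw, Endo.map]
  have h := show source A = _ from rfl
  -- At this point `h` reads `source A = source A`, and only its right-hand side is to be unfolded.
  rw (occs := .pos [2]) [source] at h
  exact whisker_transport h (pw A j) (by monoidal) (by monoidal)

theorem target_eq : Rel ν ν' 1 [t 0] [u 1, d 1, c 0, m 1, e 1] := by
  intro j
  refine congrArg (fun h => some (Sigma.mk (j + 1) h)) ?_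
  dsimp only [pw, Endo.map]
  have h := show target A = _ from rfl
  rw (occs := .pos [2]) [target] at h
  exact whisker_transport h (pw A j) (by monoidal) (by monoidal)

theorem rMap_eq : Rel ν ν' 1 [r 0] [u 0, d 0, c 1, m 0, e 0] := by
  intro j
  refine congrArg (fun h => some (Sigma.mk (j + 1) h)) ?_
  dsimp only [pw, Endo.map]
  have h := show rMap A = _ from rfl
  rw (occs := .pos [2]) [rMap] at h
  exact whisker_transport h (pw A j) (by monoidal) (by monoidal)

theorem mul_left_br : Rel ν ν' 3 [m 0, c 0] [c 1, c 0, m 1] := by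
  intro j
  refine congrArg (fun h => some (Sigma.mk (j + 2) h)) ?_
  dsimp only [pw, Endo.map]
  have h := BraidedCategory.braiding_naturality_left μ[A] A
  rw [BraidedCategory.braiding_tensor_left_hom] at h
  exact whisker_transport h (pw A j) (by monoidal) (by monoidal)

theorem mul_right_br : Rel ν ν' 3 [m 1, c 0] [c 0, c 1, m 0] := by
  intro j
  refine congrArg (fun h => some (Sigma.mk (j + 2) h)) ?_
  dsimp only [pw, Endo.map]
  have h := BraidedCategory.braiding_naturality_right A μ[A]
  rw [BraidedCategory.braiding_tensor_right_hom] at h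
  exact whisker_transport h (pw A j) (by monoidal) (by monoidal)

theorem one_left_br : Rel ν ν' 1 [u 0, c 0] [u 1] := by
  intro j
  refine congrArg (fun h => some (Sigma.mk (j + 2) h)) ?_
  dsimp only [pw, Endo.map]
  have h := BraidedCategory.braiding_naturality_left η[A] A
  rw [braiding_tensorUnit_left] at h
  exact whisker_transport h (pw A j) (by monoidal) (by monoidal)

theorem one_right_br : Rel ν ν' 1 [u 1, c 0] [u 0] := by
  intro j
  refine congrArg (fun h => some (Sigma.mk (j + 2) h)) ?_
  dsimp only [pw, Endo.map]
  have h := BraidedCategory.braiding_naturality_right A η[A]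
  rw [braiding_tensorUnit_right] at h
  exact whisker_transport h (pw A j) (by monoidal) (by monoidal)

theorem comul_left_br : Rel ν ν' 2 [d 0, c 1, c 0] [c 0, d 1] := by
  intro j
  refine congrArg (fun h => some (Sigma.mk (j + 3) h)) ?_
  dsimp only [pw, Endo.map]
  have h := BraidedCategory.braiding_naturality_left Δ[A] A
  rw [BraidedCategory.braiding_tensor_left_hom] at h
  exact whisker_transport h (pw A j) (by monoidal) (by monoidal)

theorem comul_right_br : Rel ν ν' 2 [d 1, c 0, c 1] [c 0, d 0] := by
  intro j
  refine congrArg (fun h => some (Sigma.mk (j + 3) h)) ?_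
  dsimp only [pw, Endo.map]
  have h := BraidedCategory.braiding_naturality_right A Δ[A]
  rw [BraidedCategory.braiding_tensor_right_hom] at h
  exact whisker_transport h (pw A j) (by monoidal) (by monoidal)

theorem counit_left_br : Rel ν ν' 2 [e 0] [c 0, e 1] := by
  intro j
  refine congrArg (fun h => some (Sigma.mk (j + 1) h)) ?_
  dsimp only [pw, Endo.map]
  have h := BraidedCategory.braiding_naturality_left ε[A] A
  rw [braiding_tensorUnit_left] at h
  exact whisker_transport h (pw A j) (by monoidal) (by monoidal)

theorem counit_right_br : Rel ν ν' 2 [e 1] [c 0, e 0] := by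
  intro j
  refine congrArg (fun h => some (Sigma.mk (j + 1) h)) ?_
  dsimp only [pw, Endo.map]
  have h := BraidedCategory.braiding_naturality_right A ε[A]
  rw [braiding_tensorUnit_right] at h
  exact whisker_transport h (pw A j) (by monoidal) (by monoidal)

theorem endo_left_br (φ : Endo) :
    Rel ν ν' 2 [(0, .endo φ), c 0] [c 0, (1, .endo φ)] := by
  intro j
  refine congrArg (fun h => some (Sigma.mk (j + 2) h)) ?_
  dsimp only [pw]
  exact whisker_transport (BraidedCategory.braiding_naturality_left (φ.map ν ν') A) (pw A j)
    (by monoidal) (by monoidal)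

theorem endo_right_br (φ : Endo) :
    Rel ν ν' 2 [(1, .endo φ), c 0] [c 0, (0, .endo φ)] := by
  intro j
  refine congrArg (fun h => some (Sigma.mk (j + 2) h)) ?_
  dsimp only [pw]
  exact whisker_transport (BraidedCategory.braiding_naturality_right A (φ.map ν ν')) (pw A j)
    (by monoidal) (by monoidal)

theorem mul_left_brInv : Rel ν ν' 3 [m 0, b 0] [b 1, b 0, m 1] := by
  intro j
  refine congrArg (fun h => some (Sigma.mk (j + 2) h)) ?_
  dsimp only [pw, Endo.map]
  have h := BraidedCategory.braiding_inv_naturality_left μ[A] A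
  rw [BraidedCategory.braiding_tensor_right_inv] at h
  exact whisker_transport h (pw A j) (by monoidal) (by monoidal)

theorem mul_right_brInv : Rel ν ν' 3 [m 1, b 0] [b 0, b 1, m 0] := by
  intro j
  refine congrArg (fun h => some (Sigma.mk (j + 2) h)) ?_
  dsimp only [pw, Endo.map]
  have h := BraidedCategory.braiding_inv_naturality_right A μ[A]
  rw [BraidedCategory.braiding_tensor_left_inv] at h
  exact whisker_transport h (pw A j) (by monoidal) (by monoidal)

theorem one_left_brInv : Rel ν ν' 1 [u 0, b 0] [u 1] := by
  intro j
  refine congrArg (fun h => some (Sigma.mk (j + 2) h)) ?_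
  dsimp only [pw, Endo.map]
  have h := BraidedCategory.braiding_inv_naturality_left η[A] A
  rw [braiding_inv_tensorUnit_right] at h
  exact whisker_transport h (pw A j) (by monoidal) (by monoidal)

theorem one_right_brInv : Rel ν ν' 1 [u 1, b 0] [u 0] := by
  intro j
  refine congrArg (fun h => some (Sigma.mk (j + 2) h)) ?_
  dsimp only [pw, Endo.map]
  have h := BraidedCategory.braiding_inv_naturality_right A η[A]
  rw [braiding_inv_tensorUnit_left] at h
  exact whisker_transport h (pw A j) (by monoidal) (by monoidal)

theorem comul_left_brInv : Rel ν ν' 2 [d 0, b 1, b 0] [b 0, d 1] := by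
  intro j
  refine congrArg (fun h => some (Sigma.mk (j + 3) h)) ?_
  dsimp only [pw, Endo.map]
  have h := BraidedCategory.braiding_inv_naturality_left Δ[A] A
  rw [BraidedCategory.braiding_tensor_right_inv] at h
  exact whisker_transport h (pw A j) (by monoidal) (by monoidal)

theorem comul_right_brInv : Rel ν ν' 2 [d 1, b 0, b 1] [b 0, d 0] := by
  intro j
  refine congrArg (fun h => some (Sigma.mk (j + 3) h)) ?_
  dsimp only [pw, Endo.map]
  have h := BraidedCategory.braiding_inv_naturality_right A Δ[A]
  rw [BraidedCategory.braiding_tensor_left_inv] at h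
  exact whisker_transport h (pw A j) (by monoidal) (by monoidal)

theorem counit_left_brInv : Rel ν ν' 2 [e 0] [b 0, e 1] := by
  intro j
  refine congrArg (fun h => some (Sigma.mk (j + 1) h)) ?_
  dsimp only [pw, Endo.map]
  have h := BraidedCategory.braiding_inv_naturality_left ε[A] A
  rw [braiding_inv_tensorUnit_right] at h
  exact whisker_transport h (pw A j) (by monoidal) (by monoidal)

theorem counit_right_brInv : Rel ν ν' 2 [e 1] [b 0, e 0] := by
  intro j
  refine congrArg (fun h => some (Sigma.mk (j + 1) h)) ?_
  dsimp only [pw, Endo.map]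
  have h := BraidedCategory.braiding_inv_naturality_right A ε[A]
  rw [braiding_inv_tensorUnit_left] at h
  exact whisker_transport h (pw A j) (by monoidal) (by monoidal)

theorem endo_left_brInv (φ : Endo) :
    Rel ν ν' 2 [(0, .endo φ), b 0] [b 0, (1, .endo φ)] := by
  intro j
  refine congrArg (fun h => some (Sigma.mk (j + 2) h)) ?_
  dsimp only [pw]
  exact whisker_transport (BraidedCategory.braiding_inv_naturality_left (φ.map ν ν') A) (pw A j)
    (by monoidal) (by monoidal)

theorem endo_right_brInv (φ : Endo) :
    Rel ν ν' 2 [(1, .endo φ), b 0] [b 0, (0, .endo φ)] := by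
  intro j
  refine congrArg (fun h => some (Sigma.mk (j + 2) h)) ?_
  dsimp only [pw]
  exact whisker_transport (BraidedCategory.braiding_inv_naturality_right A (φ.map ν ν')) (pw A j)
    (by monoidal) (by monoidal)

theorem br_left_br : Rel ν ν' 3 [c 0, c 1, c 0] [c 1, c 0, c 1] := by
  intro j
  refine congrArg (fun h => some (Sigma.mk (j + 3) h)) ?_
  dsimp only [pw, Endo.map]
  have h := BraidedCategory.braiding_naturality_left (β_ A A).hom A
  rw [BraidedCategory.braiding_tensor_left_hom] at h
  exact whisker_transport h (pw A j) (by monoidal) (by monoidal)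

theorem br_left_brInv : Rel ν ν' 3 [c 0, b 1, b 0] [b 1, b 0, c 1] := by
  intro j
  refine congrArg (fun h => some (Sigma.mk (j + 3) h)) ?_
  dsimp only [pw, Endo.map]
  have h := BraidedCategory.braiding_inv_naturality_left (β_ A A).hom A
  rw [BraidedCategory.braiding_tensor_right_inv] at h
  exact whisker_transport h (pw A j) (by monoidal) (by monoidal)

theorem brInv_left_brInv : Rel ν ν' 3 [b 0, b 1, b 0] [b 1, b 0, b 1] := by
  intro j
  refine congrArg (fun h => some (Sigma.mk (j + 3) h)) ?_
  dsimp only [pw, Endo.map]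
  have h := BraidedCategory.braiding_inv_naturality_left (β_ A A).inv A
  rw [BraidedCategory.braiding_tensor_right_inv] at h
  exact whisker_transport h (pw A j) (by monoidal) (by monoidal)

theorem antipode_id (hν : IsAntipode ν) : Rel ν ν' 1 [d 0, n 0, m 0] [t 0] := by
  intro j
  refine congrArg (fun h => some (Sigma.mk (j + 1) h)) ?_
  dsimp only [pw, Endo.map]
  have h := hν.antipode_id
  simp only [convolution, MonoidalCategory.tensorHom_def] at h
  exact whisker_transport h (pw A j) (by monoidal) (by monoidal)

theorem id_antipode (hν : IsAntipode ν) : Rel ν ν' 1 [d 0, n 1, m 0] [r 0] := by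
  intro j
  refine congrArg (fun h => some (Sigma.mk (j + 1) h)) ?_
  dsimp only [pw, Endo.map]
  have h := hν.id_antipode
  simp only [convolution, MonoidalCategory.tensorHom_def] at h
  exact whisker_transport h (pw A j) (by monoidal) (by monoidal)

theorem antipode_id_antipode (hν : IsAntipode ν) : Rel ν ν' 1 [d 0, d 0, n 0, m 0, n 1,
  m 0] [n 0] := by
  intro j
  refine congrArg (fun h => some (Sigma.mk (j + 1) h)) ?_
  dsimp only [pw, Endo.map]
  have h := hν.antipode_id_antipode
  simp only [convolution, MonoidalCategory.tensorHom_def] at h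
  exact whisker_transport h (pw A j) (by monoidal) (by monoidal)

theorem antipode_antipodeInv (h : ν ≫ ν' = 𝟙 A) : Rel ν ν' 1 [n 0, i 0] [] := by
  intro j
  refine congrArg (fun h => some (Sigma.mk (j + 1) h)) ?_
  dsimp only [pw, Endo.map]
  exact whisker_transport (h) (pw A j) (by monoidal) (by monoidal)

theorem antipodeInv_antipode (h : ν' ≫ ν = 𝟙 A) : Rel ν ν' 1 [i 0, n 0] [] := by
  intro j
  refine congrArg (fun h => some (Sigma.mk (j + 1) h)) ?_
  dsimp only [pw, Endo.map]
  exact whisker_transport (h) (pw A j) (by monoidal) (by monoidal)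

end Diagram

/-! ### Diagrammatic identities in weak bimonoids -/

set_option linter.unusedSectionVars false

namespace Diagram

/-! ### The image of the target morphism. -/

variable {𝒱 : Type u} [Category.{v} 𝒱] [MonoidalCategory 𝒱] [BraidedCategory 𝒱] {A : 𝒱} [MonObj A]
  [ComonObj A] [WeakBimonoid A] {ν ν' : A ⟶ A}

/-- Units slide freely through braids, so the second `δ η` may be created between the legs of the
first. The axiom with `c⁻¹` thereby becomes one with `c`; `comul_unit_br_left` pulls the new strand
the other way. -/
theorem comul_unit_br_right : Rel ν ν' 0 [u 0, d 0, d 1] [u 0, d 0, u 1, d 1, c 2, m 1] :=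
  (comul_assoc ∷ comul_unit_right ∷ brInv_br ∷ comul_right_brInv ∷ one_right_brInv ∷
    .nil).derive [bw 0 0 110, fw 1 0 111, bw 2 2 200000, fw 3 1 22110010, fw 4 1 2221001]

/-- Elements `x` in the image of `t` satisfy `δ x = 1₁ ⊗ x 1₂`; the other order, `1₁ ⊗ 1₂ x`, is
`target_comul`. -/
theorem target_comul_br : Rel ν ν' 1 [t 0, d 0] [t 0, u 1, d 1, c 0, m 1] :=
  (target_eq ∷ comul_right_br ∷ comul_assoc ∷ comul_unit_br_right ∷ mul_right_br ∷
    mul_left_br ∷ counit_left_br ∷ (endo_left_br .target) ∷ .nil).derive [fw 0 0 21,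
    bw 1 0 122100, fw 2 1 2222110, fw 3 1 2222111, fw 4 1 2210100000, bw 5 2 22110010000,
    bw 6 2 2110000000, bw 0 1 211101100, bw 7 0 21100]

theorem one_comul_mul_comul : Rel ν ν' 1 [u 0, d 0, d 2, c 1, m 0, m 1] [d 0] :=
  (mul_comul ∷ one_mul ∷ .nil).derive [bw 0 0 111101, fw 1 0 211]

/-- Insert `δ x = 1₁ ⊗ x 1₂` into `δ (x a) = δ x δ a` and absorb the `δ η` into `δ a`. -/
theorem target_mul_comul : Rel ν ν' 2 [t 0, m 0, d 0] [t 0, d 1, c 0, m 1] :=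
  (mul_comul ∷ target_comul_br ∷ mul_left_br ∷ one_comul_mul_comul ∷ mul_assoc ∷
    mul_right_br ∷ .nil).derive [fw 0 0 110, fw 1 0 222110, fw 2 1 221100000,
    bw 3 1 2222222221, fw 4 2 211000000000000, bw 5 0 121100000000000, fw 3 1 22222222111111,
    fw 3 1 222111111]

theorem target_target_mul_comul : Rel ν ν' 2 [t 0, t 1, m 0, d 0] [t 0, t 1, m 0, u 1, d 1, c 0,
    m 1] :=
  (target_mul_comul ∷ target_comul_br ∷ mul_assoc ∷ mul_left_br ∷ .nil).derive [fw 0 0 1110,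
    fw 1 1 22211, bw 2 1 10010000, bw 3 0 21101000]

/-- If `z = x y` with both factors in the image of `t`, then `δ z = 1₁ ⊗ z 1₂`, and applying `1 ⊗ ε`
turns this into `z = t z`. -/
theorem target_target_mul_target : Rel ν ν' 2 [t 0, t 1, m 0, t 0] [t 0, t 1, m 0] :=
  (target_eq ∷ target_target_mul_comul ∷ comul_counit ∷ .nil).derive [fw 0 0 1000,
    bw 1 0 21111111, fw 2 0 11000]

theorem comul_unit_br_left : Rel ν ν' 0 [u 0, d 0, d 1] [u 0, d 0, u 1, d 1, c 0, m 1] :=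
  (comul_assoc ∷ comul_unit_right ∷ brInv_br ∷ comul_left_brInv ∷ one_left_brInv ∷
    .nil).derive [bw 0 0 110, fw 1 0 111, bw 2 0 200000, fw 3 0 22111000, fw 4 0 2221100]

theorem target_target : Rel ν ν' 1 [t 0, t 0] [t 0] :=
  (target_eq ∷ (endo_right_br .target) ∷ comul_unit_br_left ∷ counit_comul ∷ .nil).derive
    [fw 0 0 21, bw 1 0 122100, fw 0 1 222100, bw 2 1 2222111111, fw 3 2 2221100, bw 0 0 11111]

theorem comul_one_comul_mul : Rel ν ν' 1 [d 0, u 2, d 2, c 1, m 0, m 1] [d 0] :=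
  (mul_comul ∷ mul_one ∷ .nil).derive [bw 0 0 111110, fw 1 0 211]

/-- Expand `t` and multiply `δ a` on the right by another `δ η`. Weak comultiplicativity of the unit
then recombines the factors into `1₁ ⊗ δ (a 1₂)`, with one leg killed by the counit. -/
theorem comul_target_left : Rel ν ν' 1 [d 0, t 0] [u 1, d 1, c 0, m 1] :=
  (target_eq ∷ comul_one_comul_mul ∷ one_right_br ∷ comul_right_br ∷ comul_left_br ∷
    mul_assoc ∷ mul_left_br ∷ mul_right_br ∷ comul_unit_br_right ∷ mul_comul ∷ counit_comul ∷
    .nil).derive [fw 0 0 10, bw 1 0 222221, bw 2 2 22222100000, bw 3 2 222211000000,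
    fw 1 0 2221221111100, fw 4 0 22121100, bw 1 1 2221000, fw 5 1 211000000000,
    fw 6 3 222110000000, bw 7 2 2212110000000, bw 8 1 222222111111, bw 9 1 211110100,
    fw 10 1 110000]

theorem counit_mul_br_right : Rel ν ν' 3 [m 1, m 0, e 0] [d 1, c 2, m 1, e 1, m 0, e 0] :=
  (mul_assoc ∷ counit_mul_right ∷ brInv_br ∷ br_brInv ∷ mul_left_brInv ∷ counit_left_brInv ∷
    .nil).derive [bw 0 0 211, fw 1 0 111, bw 2 0 222222, bw 3 2 22222000, fw 2 0 2222222211,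
    bw 4 1 22211100, bw 5 1 2211000]

theorem mul_target_br : Rel ν ν' 2 [m 0, t 0] [d 1, c 0, m 1, e 1, t 0] :=
  (target_eq ∷ mul_left_br ∷ mul_assoc ∷ counit_mul_br_right ∷ comul_left_br ∷
    comul_right_br ∷ one_right_br ∷ (endo_right_br .target) ∷ .nil).derive [fw 0 0 10,
    fw 1 0 221100, fw 2 1 2110000, fw 3 1 1101000, bw 4 1 2222221100, fw 5 2 22222211010,
    fw 6 2 2222222101, bw 0 1 222111110, fw 7 0 22110]

/-- This makes the projection `A ⟶ C` a comonoid morphism, and it removes inner copies of `t` when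
coassociativity of `C` is proved. -/
theorem comul_target_target : Rel ν ν' 1 [d 0, t 0, t 1] [t 0, d 0, t 0, t 1] :=
  (target_target ∷ comul_target_left ∷ (endo_right_br .target) ∷ mul_target_br ∷ comul_assoc ∷
    comul_right_br ∷ target_eq ∷ .nil).derive [bw 0 1 210, bw 0 0 1000, fw 1 0 21221,
    bw 2 0 1222100, fw 3 1 2110000, fw 2 0 2222211000, bw 4 1 2222222110, fw 0 1 2110000000,
    fw 5 0 222211100, bw 6 0 22211111]

theorem one_target : Rel ν ν' 0 [u 0, t 0] [u 0] :=
  (target_eq ∷ one_left_br ∷ one_mul ∷ comul_counit ∷ .nil).derive [fw 0 0 10, fw 1 0 221100,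
    fw 2 1 21100, fw 3 0 110]

/-- Together with `target_source` this says that `s` and `t` have the same image, so the source may
take values in the object that splits `t`. -/
theorem source_target : Rel ν ν' 1 [s 0, t 0] [s 0] :=
  (target_eq ∷ (endo_left_br .source) ∷ source_eq ∷ one_left_brInv ∷ comul_left_brInv ∷
    brInv_br ∷ counit_left_br ∷ mul_left_br ∷ comul_unit_br_right ∷ counit_comul ∷
    .nil).derive [fw 0 0 10, fw 1 0 221100, fw 2 1 221000, bw 3 0 222222221,
    bw 4 0 2222222110, fw 5 0 22222211000, fw 6 2 221000000, fw 7 2 2221100000,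
    fw 5 1 22222221100, bw 8 0 212211111, fw 9 1 122100, bw 2 0 1111]

theorem source_counit : Rel ν ν' 1 [s 0, e 0] [e 0] :=
  (source_eq ∷ counit_comul ∷ one_mul ∷ .nil).derive [fw 0 0 21, fw 1 0 12210, fw 2 0 211]

/-- The mirror of `comul_target_left`: the `δ η` is now multiplied in on the left of `a`. -/
theorem comul_source_left : Rel ν ν' 1 [d 0, s 0] [u 0, d 0, m 1] :=
  (source_eq ∷ one_comul_mul_comul ∷ mul_assoc ∷ comul_unit_left ∷ comul_assoc ∷ mul_comul ∷
    counit_comul ∷ .nil).derive [fw 0 0 10, bw 1 0 22221, bw 2 1 2100100000,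
    bw 3 0 2211122110, fw 4 0 22122100, bw 5 1 21111001, fw 6 1 11000]

theorem source_comul_br : Rel ν ν' 1 [s 0, d 0, t 0, t 1, c 0] [d 0, s 0, s 1] :=
  (source_eq ∷ comul_assoc ∷ (endo_left_br .target) ∷ comul_target_left ∷ mul_assoc ∷
    comul_left_br ∷ one_left_br ∷ comul_source_left ∷ source_target ∷ .nil).derive
    [fw 0 0 22221, fw 1 0 22212210, fw 2 0 11000000, fw 3 1 22122100, fw 4 2 2221100000,
    fw 5 0 2122110000, fw 6 0 222211000, bw 0 1 21111000, bw 7 0 22111, fw 8 1 2110]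

theorem target_counit : Rel ν ν' 1 [t 0, e 0] [e 0] :=
  (target_eq ∷ counit_right_br ∷ counit_comul ∷ mul_one ∷ .nil).derive [fw 0 0 21,
    bw 1 0 122100, fw 2 1 22110, fw 3 0 211]

/-- Sources and targets of the same arrow may be read off in either order. This is also why the left
and right coactions commute, and why the idempotents of composable pairs commute with the coactions
and with each other. -/
theorem comul_source_target_br : Rel ν ν' 1 [d 0, s 0, t 1, c 0] [d 0, t 0, s 1] :=
  ((endo_left_br .source) ∷ target_eq ∷ comul_left_br ∷ comul_source_left ∷ mul_assoc ∷
    source_eq ∷ comul_target_left ∷ .nil).derive [fw 0 0 1100, fw 1 1 2210, fw 2 0 21221100,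
    fw 3 1 1221000, fw 4 2 21100000, bw 5 1 11110000, bw 6 0 21111]

theorem mul_target : Rel ν ν' 2 [m 0, t 0] [d 1, m 0, e 0, t 0] :=
  (target_eq ∷ mul_left_br ∷ counit_mul_left ∷ comul_left_br ∷ counit_left_br ∷ .nil).derive
    [fw 0 0 10, fw 1 0 221100, fw 2 1 1110000, bw 3 1 222221100, bw 1 0 2111000000,
    bw 4 0 110000000, bw 0 2 22111011]

theorem counit_mul_br_left : Rel ν ν' 3 [m 1, m 0, e 0] [d 1, c 0, m 1, e 1, m 0, e 0] :=
  (mul_assoc ∷ counit_mul_right ∷ brInv_br ∷ br_brInv ∷ mul_right_brInv ∷ counit_right_brInv ∷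
    .nil).derive [bw 0 0 211, fw 1 0 111, bw 2 0 222222, bw 3 0 22222000, fw 2 0 2222222211,
    bw 4 0 21221100, bw 5 0 1221000]

theorem target_mul_counit : Rel ν ν' 2 [t 0, m 0, e 0] [m 0, e 0] :=
  (target_eq ∷ counit_mul_br_left ∷ one_mul ∷ .nil).derive [fw 0 0 221, bw 1 0 1111110,
    fw 2 1 2211]

theorem target_mul_target : Rel ν ν' 2 [t 0, m 0, t 0] [m 0, t 0] :=
  (mul_target ∷ target_mul_counit ∷ .nil).derive [fw 0 0 110, fw 1 0 11100, bw 0 0 1111]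

theorem target_source : Rel ν ν' 1 [t 0, s 0] [t 0] :=
  (target_eq ∷ (endo_right_br .source) ∷ source_eq ∷ comul_unit_left ∷ comul_counit ∷
    .nil).derive [fw 0 0 21, bw 1 0 122100, fw 2 1 222100, bw 3 1 222211111, fw 4 1 2221100,
    bw 0 0 11111]

theorem target_target_mul_source : Rel ν ν' 2 [t 0, t 1, m 0] [t 0, t 1, m 0, s 0] :=
  (target_target_mul_target ∷ target_source ∷ .nil).derive [bw 0 0 111, bw 1 0 1000,
    fw 0 0 21111]

theorem mul_source : Rel ν ν' 2 [m 0, s 0] [d 0, m 1, e 1, s 0] :=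
  (source_eq ∷ mul_assoc ∷ counit_mul_left ∷ .nil).derive [fw 0 0 10, bw 1 1 21001,
    fw 2 1 11100, bw 0 0 1111000]

theorem target_comul : Rel ν ν' 1 [t 0, d 0] [t 0, u 0, d 0, m 1] :=
  (target_eq ∷ one_left_brInv ∷ comul_left_brInv ∷ brInv_br ∷ comul_unit_left ∷ .nil).derive
    [fw 0 0 21, bw 1 0 222221, bw 2 0 2222110, fw 3 0 22211000, fw 4 0 122211,
    bw 3 0 22222000, fw 2 0 2222221110, fw 1 0 222222211, bw 0 0 22211111]

theorem one_comul_target : Rel ν ν' 0 [u 0, d 0, t 0] [u 0, d 0] :=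
  (target_eq ∷ comul_unit_br_left ∷ counit_comul ∷ .nil).derive [fw 0 0 100, bw 1 0 2111111,
    fw 2 1 1100]

theorem target_comul_target : Rel ν ν' 1 [t 0, d 0, t 0] [t 0, d 0] :=
  (target_comul ∷ one_comul_target ∷ .nil).derive [fw 0 0 211, fw 1 0 12110, bw 0 0 1111]

theorem target_comul_source : Rel ν ν' 1 [t 0, d 0, s 0] [t 0, d 0] :=
  (target_comul_target ∷ target_source ∷ .nil).derive [bw 0 0 211, fw 1 0 1100, fw 0 0 111]

/-- The product in `C` is recovered from comultiplication and the pairing `ε μ`, as `x y = x₁ ε (x₂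
y)`. It rests on `s` fixing the image of `t`. -/
theorem target_target_mul : Rel ν ν' 2 [t 0, t 1, m 0] [t 0, t 1, d 0, m 1, e 1] :=
  (target_target_mul_source ∷ mul_source ∷ target_comul_source ∷ .nil).derive [fw 0 0 111,
    fw 1 0 1100, fw 2 0 122110]

theorem target_right_mul_target : Rel ν ν' 2 [t 1, m 0, t 0] [t 1, d 0, m 1, e 1, t 0] :=
  (target_mul_target ∷ target_target_mul ∷ target_mul_counit ∷ comul_target_target ∷
    .nil).derive [bw 0 0 110, fw 1 0 2111, bw 2 1 211000, bw 3 0 1221110, fw 2 1 211100]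

/-! ### The separable Frobenius structure on the image of `t`. -/

/-- By coassociativity `x₁ ⊗ x₂ y = x₁ ⊗ x₂ ε (x₃ y) = δ (x y)`, up to `t ⊗ t`. The other half uses
`t (x y) = ε (x y₁) t y₂` in the same way. -/
theorem frobenius_left : Rel ν ν' 2 [t 0, t 1, d 0, m 1, t 0, t 1] [t 0, t 1, m 0, d 0, t 0, t 1]
    :=
  (target_right_mul_target ∷ comul_assoc ∷ target_target_mul ∷ .nil).derive [fw 0 1 211001,
    bw 1 0 22221100, bw 2 0 22211111]

theorem frobenius_right : Rel ν ν' 2 [t 0, t 1, d 1, m 0, t 0, t 1] [t 0, t 1, m 0, d 0, t 0, t 1]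
    :=
  (mul_target ∷ comul_assoc ∷ comul_target_target ∷ .nil).derive [fw 0 0 110000,
    fw 1 1 22221210, fw 2 2 22211100, bw 0 0 110222110, bw 2 0 1111000]

/-- Expanding `t` turns `a₁ t a₂` into `(1 ⊗ ε) δ (a 1)`. -/
theorem comul_target_mul : Rel ν ν' 1 [d 0, t 1, m 0] [] :=
  (target_eq ∷ mul_comul ∷ mul_one ∷ comul_counit ∷ .nil).derive [fw 0 1 210, bw 1 0 1211110,
    fw 2 0 2211, fw 3 0 11]

theorem target_comul_target_mul : Rel ν ν' 1 [t 0, d 0, t 1, m 0] [t 0] :=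
  (comul_target_mul ∷ .nil).derive [fw 0 0 1110]

/-! ### The idempotent of composable pairs. -/

/-- The pairing `ε μ` sees its left argument only through `t`. Dually it sees its right argument
only through `s` (`middle_eq_source`), so either label can be inserted to make a commutation rule
applicable. -/
theorem middle_eq_target : Rel ν ν' 2 [d 0, t 1, d 2, b 2, m 1, e 1] [d 0, d 2, b 2, m 1, e 1] :=
  (target_mul_counit ∷ .nil).derive [fw 0 1 111000]

theorem comul_source_cross : Rel ν ν' 2 [d 0, s 1, b 0, d 1, t 2, d 3, b 3, m 2, e 2] [d 0, t 1,
    d 2, b 2, m 1, e 1, d 0, s 1, b 0] :=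
  (comul_left_brInv ∷ comul_assoc ∷ (endo_left_brInv .target) ∷ comul_source_target_br ∷
    br_brInv ∷ .nil).derive [bw 0 0 222110000, fw 1 0 2222212100, bw 2 1 2221100000,
    bw 3 1 2222111000, fw 4 1 22211000000, bw 1 0 222221100]

theorem comul_source_middle_right : Rel ν ν' 2 [d 0, s 1, b 0, d 1, d 3, b 3, m 2, e 2] [d 0, d 2,
    b 2, m 1, e 1, d 0, s 1, b 0] :=
  (middle_eq_target ∷ comul_source_cross ∷ .nil).derive [bw 0 1 11100011, fw 1 0 111111111,
    fw 0 0 222111111]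

/-- The two pairings combine into `(ε ⊗ ε) δ` of one product, which is a single `ε`. -/
theorem middle_middle : Rel ν ν' 2 [d 0, d 2, b 2, m 1, e 1, d 0, d 2, b 2, m 1, e 1] [d 0, d 2,
    b 2, m 1, e 1] :=
  (comul_assoc ∷ comul_left_brInv ∷ brInv_left_brInv ∷ comul_right_brInv ∷ counit_left_br ∷
    mul_left_br ∷ brInv_br ∷ mul_comul ∷ counit_comul ∷ .nil).derive [fw 0 0 2212210000,
    bw 1 1 2222222110, bw 2 1 22222211100, fw 0 1 22222222211, fw 3 1 22222221110,
    fw 4 2 2210000000, fw 5 2 22211000000, fw 6 1 222222211000, bw 7 1 2121110100,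
    fw 8 1 1210000]

theorem comul_source_target_eq : Rel ν ν' 1 [d 0, s 1, t 1, b 0] [d 0, s 1, b 0] :=
  (source_target ∷ .nil).derive [fw 0 1 2110]

theorem comul_source_target_coassoc : Rel ν ν' 1 [d 0, s 1, t 1, b 0, d 1, s 2, t 2, b 1] [d 0,
    s 1, t 1, b 0, d 0, t 0, t 1] :=
  (comul_left_brInv ∷ source_target ∷ comul_assoc ∷ (endo_left_brInv .source) ∷
    (endo_left_brInv .target) ∷ brInv_left_brInv ∷ (endo_right_brInv .source) ∷
    comul_right_brInv ∷ source_comul_br ∷ br_brInv ∷ .nil).derive [bw 0 0 22211000,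
    fw 1 1 222222110, fw 2 0 22222121, bw 3 1 22211000, bw 4 1 22110000, bw 5 0 11100000,
    fw 1 1 22211000, fw 6 1 2100100, fw 6 0 2221100, fw 7 0 2221110, bw 8 0 211100,
    fw 9 0 11000000, bw 6 0 222110, bw 1 1 222210]

theorem comul_source_coassoc : Rel ν ν' 1 [d 0, s 1, b 0, d 1, s 2, b 1] [d 0, s 1, b 0, d 0, t 0,
    t 1] :=
  (comul_source_target_eq ∷ comul_source_target_coassoc ∷ .nil).derive [bw 0 1 111000,
    bw 0 0 2222111, fw 1 0 11111111, fw 0 0 2221111]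

theorem comul_source_target_counit : Rel ν ν' 1 [d 0, s 1, t 1, b 0, e 0] [] :=
  (counit_right_brInv ∷ source_target ∷ source_counit ∷ comul_counit ∷ .nil).derive
    [bw 0 0 11000, fw 1 1 2110, fw 2 1 110, fw 3 0 11]

theorem comul_source_counit : Rel ν ν' 1 [d 0, s 1, b 0, e 0] [] :=
  (comul_source_target_eq ∷ comul_source_target_counit ∷ .nil).derive [bw 0 0 2111,
    fw 1 0 11111]

theorem source_mul_counit : Rel ν ν' 2 [s 1, m 0, e 0] [m 0, e 0] :=
  (source_eq ∷ counit_mul_left ∷ mul_one ∷ .nil).derive [fw 0 1 221, bw 1 0 111110,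
    fw 2 0 2211]

theorem middle_eq_source : Rel ν ν' 2 [d 0, d 2, s 3, b 2, m 1, e 1] [d 0, d 2, b 2, m 1, e 1] :=
  ((endo_right_brInv .source) ∷ source_mul_counit ∷ .nil).derive [fw 0 1 222110,
    fw 1 1 110100]

theorem comul_target_cross : Rel ν ν' 2 [d 1, t 2, d 0, d 2, s 3, b 2, m 1, e 1] [d 0, d 2, s 3,
    b 2, m 1, e 1, d 1, t 2] :=
  (comul_assoc ∷ br_brInv ∷ comul_source_target_br ∷ (endo_left_brInv .target) ∷
    comul_left_brInv ∷ .nil).derive [fw 0 1 22222121, bw 1 2 22220000, fw 2 2 2222211110,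
    fw 3 2 222211000, bw 0 1 222222211, fw 4 1 222121100]

theorem comul_target_middle_left : Rel ν ν' 2 [d 1, t 2, d 0, d 2, b 2, m 1, e 1] [d 0, d 2, b 2,
    m 1, e 1, d 1, t 2] :=
  (middle_eq_source ∷ comul_target_cross ∷ .nil).derive [bw 0 0 1111100, fw 1 0 11111111,
    fw 0 0 11122111]

theorem comul_target_coassoc : Rel ν ν' 1 [d 0, t 1, d 0, t 1] [d 0, t 1, d 1, t 1, t 2] :=
  (comul_assoc ∷ comul_target_target ∷ .nil).derive [fw 0 0 2121, fw 1 1 1110]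

theorem comul_target_counit : Rel ν ν' 1 [d 0, t 1, e 1] [] :=
  (target_counit ∷ comul_counit ∷ .nil).derive [fw 0 1 110, fw 1 0 11]

/-- Both sides equal `1₁ ⊗ a 1₂ b`. This exchange of the target of `a` for the source of `b`
underlies the equalizing property of the idempotent and axiom (B2). -/
theorem comul_target_mul_right : Rel ν ν' 2 [d 0, t 0, m 1] [d 1, c 0, s 0, m 1] :=
  (comul_target_left ∷ mul_assoc ∷ comul_source_left ∷ (endo_right_br .source) ∷ .nil).derive
    [fw 0 0 121, fw 1 1 11000, bw 2 1 22111, fw 3 0 2110]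

theorem comul_target_mul_counit : Rel ν ν' 2 [d 0, t 0, m 1, e 1] [d 1, c 0, s 0, m 1, e 1] :=
  (comul_target_mul_right ∷ .nil).derive [fw 0 0 1211]

theorem middle_target_eq_source : Rel ν ν' 2 [d 0, d 2, b 2, m 1, e 1, d 0, t 1] [d 0, d 2, b 2,
    m 1, e 1, d 1, s 2, b 1] :=
  (comul_assoc ∷ comul_target_mul_counit ∷ (endo_right_br .source) ∷ counit_right_brInv ∷
    mul_right_brInv ∷ br_brInv ∷ comul_right_brInv ∷ (endo_right_brInv .source) ∷
    brInv_left_brInv ∷ (endo_left_brInv .source) ∷ comul_left_brInv ∷ .nil).derive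
    [fw 0 0 2122100, fw 1 1 1111000, bw 2 1 12210000, fw 3 1 10000000, fw 4 1 211000000,
    fw 5 1 2221100000, bw 6 1 22222110, bw 7 1 222212100, fw 8 1 222111000, fw 9 2 222221100,
    bw 0 1 222222211, fw 10 1 222212110]

theorem comul_source_brInv_mul : Rel ν ν' 1 [d 0, s 1, b 0, m 0] [] :=
  (source_eq ∷ one_left_br ∷ comul_left_br ∷ br_brInv ∷ mul_comul ∷ one_mul ∷ comul_counit ∷
    .nil).derive [fw 0 1 2210, bw 1 0 2222210, bw 2 0 22221100, fw 3 0 211000000,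
    bw 4 0 1211101, fw 5 0 2211, fw 6 0 11]

/-- The contraction undoes the left coaction, since `s a₂ a₁ = a` in the crossed form
`comul_source_brInv_mul`. With `middle_target_eq_source` and `middle_eq_target` it exhibits a split
equalizer. -/
theorem source_brInv_middle : Rel ν ν' 2 [d 1, s 2, b 1, d 2, b 2, m 1, e 1] [] :=
  (comul_left_brInv ∷ comul_assoc ∷ mul_right_brInv ∷ counit_right_brInv ∷
    comul_source_brInv_mul ∷ comul_counit ∷ .nil).derive [bw 0 1 2221100, fw 1 1 22222121,
    bw 2 1 21110000, bw 3 1 1100000, fw 4 2 211110, fw 5 1 11]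

/-- The two idempotents meet only in the middle factor, which the left one reads through `s` and the
right one through `t`; those readings commute. -/
theorem middle_cross : Rel ν ν' 3 [d 0, d 2, s 3, b 2, m 1, e 1, d 1, t 2, d 3, b 3, m 2, e 2]
    [d 1, t 2, d 3, b 3, m 2, e 2, d 0, d 2, s 3, b 2, m 1, e 1] :=
  (comul_left_brInv ∷ comul_assoc ∷ (endo_left_brInv .target) ∷ comul_source_target_br ∷
    br_brInv ∷ .nil).derive [bw 0 1 222222110000, fw 1 1 2222222212100, bw 2 2 2222221100000,
    bw 3 2 2222222111000, fw 4 2 22222211000000, bw 1 1 222222221100]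

theorem middle_comm : Rel ν ν' 3 [d 0, d 2, b 2, m 1, e 1, d 1, d 3, b 3, m 2, e 2] [d 1, d 3,
    b 3, m 2, e 2, d 0, d 2, b 2, m 1, e 1] :=
  (middle_eq_source ∷ middle_eq_target ∷ middle_cross ∷ .nil).derive [bw 0 0 1112221100,
    bw 1 2 22211100011, fw 2 0 111111111111, fw 1 1 222222111111, fw 0 0 11111100000]

/-! ### Composition and identities on composable pairs. -/

theorem mul_source_br : Rel ν ν' 2 [m 0, s 0] [d 0, c 1, m 0, e 0, s 0] :=
  (source_eq ∷ counit_mul_br_right ∷ .nil).derive [fw 0 0 10, fw 1 1 11001, bw 0 2 22111100]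

/-- On composable pairs the source of a product depends only on the left factor, and the target only
on the right factor (`middle_mul_target`). These say that `μ` is a bicomodule morphism. -/
theorem middle_mul_source : Rel ν ν' 2 [d 0, d 2, b 2, m 1, e 1, m 0, d 0, s 1, b 0] [d 0, d 2,
    b 2, m 1, e 1, d 0, s 1, b 0, m 1] :=
  (mul_comul ∷ comul_assoc ∷ mul_source_br ∷ (endo_left_br .source) ∷ comul_left_br ∷
    comul_right_br ∷ comul_counit ∷ mul_left_brInv ∷ mul_source ∷ br_brInv ∷ .nil).derive
    [fw 0 0 221100000, fw 1 0 222221221000, fw 2 2 221100000000, bw 3 3 222211000000000,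
    bw 4 1 222222110000000, fw 1 1 2222222212210000, bw 3 2 2222221100000000,
    fw 5 2 2222211000000100, bw 1 0 222222222221100, bw 0 0 212111100000000,
    fw 6 0 211000000000, fw 7 0 1100000000, bw 8 1 22221111000, fw 9 1 221100000,
    fw 8 1 2211000, bw 1 0 222221100]

theorem middle_mul_target : Rel ν ν' 2 [d 0, d 2, b 2, m 1, e 1, m 0, d 0, t 1] [d 0, d 2, b 2,
    m 1, e 1, d 1, t 2, m 0] :=
  (counit_left_br ∷ mul_left_br ∷ brInv_br ∷ mul_comul ∷ comul_counit ∷ mul_target_br ∷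
    (endo_right_br .target) ∷ (endo_left_brInv .target) ∷ comul_assoc ∷ comul_left_brInv ∷
    .nil).derive [fw 0 1 22210000, fw 1 1 222211000, fw 2 1 2222222110, bw 3 0 22121111,
    fw 4 0 22110, fw 3 0 211, fw 5 2 211000, bw 6 2 212210000, bw 2 2 222222000,
    bw 1 2 22110010000, bw 0 2 2110000000, bw 2 1 222220000, bw 1 1 22110100000,
    bw 0 1 2110000000, fw 7 2 222221100, bw 8 1 222222211, fw 9 1 222212110]

theorem target_comul_source_right : Rel ν ν' 1 [t 0, d 0, s 1] [t 0, d 0, t 1, c 0] :=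
  (target_comul_target ∷ comul_source_target_br ∷ target_source ∷ .nil).derive [bw 0 0 211,
    bw 1 0 1110, bw 0 0 22211, fw 2 0 211000, fw 0 0 21211]

theorem target_comul_eq_source : Rel ν ν' 1 [t 0, d 0, t 0, t 1] [t 0, d 0, s 1, b 0] :=
  (target_comul_target ∷ br_brInv ∷ target_comul_source_right ∷ .nil).derive [fw 0 0 1211,
    bw 1 0 0, bw 2 0 21111]

theorem target_comul_eq_target : Rel ν ν' 1 [t 0, d 0, t 0, t 1] [t 0, d 0, t 1] :=
  (target_comul_target ∷ .nil).derive [fw 0 0 1211]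

theorem source_comul : Rel ν ν' 1 [s 0, d 0] [s 0, u 0, d 0, m 1] :=
  (source_eq ∷ comul_unit_left ∷ .nil).derive [fw 0 0 21, fw 1 0 12211, bw 0 0 2221111]

theorem comul_source_middle : Rel ν ν' 1 [d 0, s 1, b 0, d 0, d 2, b 2, m 1, e 1] [d 0, s 1, b 0]
    :=
  ((endo_right_brInv .source) ∷ source_comul ∷ mul_assoc ∷ comul_left_brInv ∷
    comul_source_left ∷ comul_counit ∷ comul_assoc ∷ mul_right_brInv ∷
    comul_source_brInv_mul ∷ .nil).derive [fw 0 0 22222110, fw 1 0 22110000,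
    fw 2 1 2110000000, bw 0 0 2222212210, bw 3 0 2222221100, bw 4 0 21110000000,
    fw 5 0 2110000000, fw 6 0 22222121, bw 7 0 21110000, bw 0 0 1100000, fw 8 1 2211110]

theorem comul_target_middle : Rel ν ν' 1 [d 0, t 1, d 0, d 2, b 2, m 1, e 1] [d 0, t 1] :=
  (comul_assoc ∷ counit_left_br ∷ comul_target_mul ∷ mul_left_br ∷ brInv_br ∷ target_comul ∷
    mul_assoc ∷ comul_target_left ∷ comul_counit ∷ .nil).derive [fw 0 0 2212221,
    fw 1 1 1000000, bw 2 2 20000000, fw 3 1 22221100000, fw 2 2 211100000000,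
    fw 4 2 222110000, fw 5 2 2221100, bw 6 2 210100000, bw 7 1 221111000, fw 0 1 2221210,
    fw 2 2 2211100, fw 8 1 2110]

theorem comul_comul_middle : Rel ν ν' 2 [d 0, d 2, c 1, d 2, d 4, b 4, m 3, e 3] [d 0, d 2, b 2,
    m 1, e 1, d 0, d 2, c 1] :=
  (comul_left_br ∷ brInv_br ∷ mul_left_br ∷ counit_left_br ∷ comul_assoc ∷ comul_left_brInv ∷
    .nil).derive [bw 0 1 22110000, bw 1 1 222222000, bw 2 2 22110010000, bw 3 2 2110000000,
    bw 4 1 222222211, fw 5 1 222221110, bw 4 0 22211000]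

/-- The extra pairing is one leg of `δ (a₂ b₂)` followed by `ε`. Hence the right coaction lands in
pairs without projecting. -/
theorem comul_comul_mul_middle : Rel ν ν' 2 [d 0, d 2, c 1, m 2, d 0, d 2, b 2, m 1, e 1] [d 0,
    d 2, c 1, m 2] :=
  (comul_assoc ∷ counit_left_br ∷ mul_left_br ∷ brInv_br ∷ comul_right_br ∷ comul_left_br ∷
    mul_comul ∷ counit_comul ∷ .nil).derive [fw 0 0 221222210, fw 1 1 100000000,
    fw 2 1 2110000000, fw 3 2 22211000000, bw 4 2 222121000, fw 0 1 2222222211,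
    fw 5 1 2212211000, bw 6 2 211110010, fw 7 2 110000]

theorem comul_comul_mul_mul : Rel ν ν' 2 [d 0, d 2, c 1, m 2, m 0] [m 0, d 0] :=
  (mul_comul ∷ .nil).derive [bw 0 0 11111]

theorem mul_middle_right : Rel ν ν' 3 [d 1, d 3, b 3, m 2, e 2, m 1, d 0, d 2, b 2, m 1, e 1]
    [d 1, d 3, b 3, m 2, e 2, d 0, d 2, b 2, m 1, e 1, m 1] :=
  (middle_eq_source ∷ middle_mul_source ∷ .nil).derive [bw 0 0 11111000000,
    fw 1 1 222111111111, fw 0 0 111211100000]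

theorem middle_mul : Rel ν ν' 2 [d 0, d 2, b 2, m 1, e 1, m 0] [m 0] :=
  (counit_left_br ∷ mul_left_br ∷ brInv_br ∷ mul_comul ∷ comul_counit ∷ .nil).derive
    [fw 0 1 210000, fw 1 1 2211000, fw 2 1 22222110, bw 3 0 121111, fw 4 0 110]

theorem mul_middle_left : Rel ν ν' 3 [d 0, d 2, b 2, m 1, e 1, m 0, d 0, d 2, b 2, m 1, e 1] [d 0,
    d 2, b 2, m 1, e 1, d 1, d 3, b 3, m 2, e 2, m 0] :=
  (middle_eq_target ∷ middle_mul_target ∷ .nil).derive [bw 0 0 11100000011,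
    fw 1 0 221111111100, fw 0 2 222211110011]

/-! ### The antipode reverses comultiplication. -/

theorem antipode_rMap (hν : IsAntipode ν) : Rel ν ν' 1 [d 0, n 0, r 1, m 0] [n 0] :=
  ((id_antipode hν) ∷ comul_assoc ∷ mul_assoc ∷ (antipode_id_antipode hν) ∷ .nil).derive
    [bw 0 1 2210, bw 1 0 222211, bw 2 0 101000, fw 3 0 111111]

theorem rMap_mul_counit : Rel ν ν' 2 [r 1, m 0, e 0] [m 0, e 0] :=
  (rMap_eq ∷ counit_mul_br_right ∷ one_mul ∷ .nil).derive [fw 0 1 221, bw 1 0 1111110,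
    fw 2 1 2211]

theorem rMap_mul_source : Rel ν ν' 2 [r 1, m 0, s 0] [m 0, s 0] :=
  (source_eq ∷ mul_assoc ∷ rMap_mul_counit ∷ .nil).derive [fw 0 0 100, bw 1 1 210010,
    fw 2 1 110001, fw 1 1 21100, bw 0 0 11110]

/-- Write `ν = ν ⋆ r`. Under `s` the factor `r` may be dropped, leaving `s (ν ⋆ 1) = s t = t`. -/
theorem antipode_source (hν : IsAntipode ν) : Rel ν ν' 1 [n 0, s 0] [t 0] :=
  ((antipode_rMap hν) ∷ rMap_mul_source ∷ (antipode_id hν) ∷ target_source ∷ .nil).derive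
    [bw 0 0 21, fw 1 0 11010, fw 2 0 2111, fw 3 0 11]

theorem antipode_comul_insert (hν : IsAntipode ν) : Rel ν ν' 1 [n 0, d 0] [d 0, r 1, d 1, n 0,
    d 0, c 1, m 2, m 0] :=
  ((antipode_rMap hν) ∷ mul_comul ∷ .nil).derive [bw 0 0 21, fw 1 0 11000]

theorem rMap_comul : Rel ν ν' 1 [r 0, d 0] [r 0, u 1, d 1, m 0] :=
  (rMap_eq ∷ comul_left_br ∷ comul_assoc ∷ comul_unit_left ∷ mul_left_br ∷ one_left_br ∷
    .nil).derive [fw 0 0 21, bw 1 1 221100, bw 2 0 2222110, fw 3 0 2221211, fw 4 1 221100000,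
    bw 0 0 1121110000, fw 1 0 221110, fw 5 0 22211]

theorem one_comul_rMap : Rel ν ν' 0 [u 0, d 0, r 1] [u 0, d 0] :=
  (rMap_eq ∷ comul_unit_br_right ∷ counit_comul ∷ .nil).derive [fw 0 1 100, bw 1 0 2111111,
    fw 2 1 1100]

theorem rMap_comul_rMap : Rel ν ν' 1 [r 0, d 0, r 1] [r 0, d 0] :=
  (rMap_comul ∷ one_comul_rMap ∷ .nil).derive [fw 0 0 211, fw 1 1 22111, bw 0 0 1111]

theorem mul_rMap_br : Rel ν ν' 2 [m 0, r 0] [d 0, c 1, m 0, e 0, r 0] :=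
  (rMap_eq ∷ mul_right_br ∷ counit_mul_br_left ∷ comul_right_br ∷ comul_left_br ∷
    one_left_br ∷ (endo_left_br .rMap) ∷ .nil).derive [fw 0 0 10, fw 1 1 221001,
    fw 2 0 1110000, bw 3 1 2222212100, fw 4 0 22221221100, fw 5 0 2222222110,
    bw 0 1 221121110, fw 6 1 22110]

theorem comul_mul_counit_mul : Rel ν ν' 2 [d 1, d 0, c 1, m 2, e 2, m 0] [m 0] :=
  (mul_comul ∷ comul_counit ∷ .nil).derive [bw 0 0 121111, fw 1 0 110]

theorem mul_comul_rMap : Rel ν ν' 2 [m 0, d 0, r 1] [d 0, c 1, r 2, m 0] :=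
  (mul_comul ∷ mul_rMap_br ∷ (endo_left_br .rMap) ∷ comul_left_br ∷ comul_right_br ∷
    comul_assoc ∷ comul_mul_counit_mul ∷ .nil).derive [fw 0 0 211, fw 1 2 211000,
    bw 2 3 222110000, bw 3 1 222221100, bw 2 2 2222211000, fw 4 2 2222110001,
    bw 5 0 222222211, fw 6 0 111111000, fw 2 1 2110]

theorem rMap_comul_antipode (hν : IsAntipode ν) : Rel ν ν' 1 [r 0, d 0] [d 0, n 1, d 0, r 1, c 1,
    m 0] :=
  (rMap_comul_rMap ∷ (id_antipode hν) ∷ mul_comul_rMap ∷ comul_assoc ∷ (endo_left_br .rMap) ∷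
    .nil).derive [bw 0 0 11, bw 1 0 221, fw 2 0 11100, fw 3 0 222121, bw 4 1 211000,
    bw 3 0 222211]

/-- In `δ (ν a₁) δ (r a₂)`, rewriting `δ r` by `rMap_comul_antipode` produces a factor that merges
with `ν` into `δ (ν ⋆ 1) = δ t`. Next, `target_comul_antipode` is applied to this `δ t`, and
regrouping leaves one `t` and one `r`. -/
theorem antipode_comul_expand (hν : IsAntipode ν) : Rel ν ν' 1 [d 0, r 1, d 1, n 0, d 0, c 1, m 2,
    m 0] [d 0, d 1, n 2, n 1, c 1, t 0, d 0, c 1, m 2, m 0] :=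
  ((rMap_comul_antipode hν) ∷ comul_assoc ∷ mul_right_br ∷ (id_antipode hν) ∷ mul_left_br ∷
    mul_assoc ∷ mul_comul ∷ (antipode_id hν) ∷ .nil).derive [fw 0 1 22222110,
    fw 1 1 222222221210, fw 2 1 221001000000, bw 3 2 2222222210000, fw 1 2 222222222212100,
    bw 4 2 221100010000000, bw 1 1 22222222222110, bw 5 0 11000000000000,
    bw 5 2 22210001000000, bw 6 0 21221110100000, bw 1 0 22222222211, fw 7 0 22221110000,
    fw 4 1 211000000]

theorem comul_mul_mul_counit : Rel ν ν' 2 [d 1, d 0, c 1, m 2, m 0, e 0] [m 0] :=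
  (mul_comul ∷ counit_comul ∷ .nil).derive [bw 0 0 211111, fw 1 0 110]

theorem mul_comul_target : Rel ν ν' 2 [m 0, d 0, t 0] [d 1, c 0, m 1, t 0] :=
  (mul_comul ∷ mul_target_br ∷ (endo_right_br .target) ∷ comul_right_br ∷
    comul_mul_mul_counit ∷ comul_assoc ∷ comul_left_br ∷ .nil).derive [fw 0 0 211,
    fw 1 0 110000, bw 2 0 122100000, bw 3 1 222212100, bw 4 3 2222100000,
    fw 5 1 222222222222121, bw 2 1 222122222210000, fw 6 0 221222222110000,
    fw 4 3 22111110000100, fw 4 1 111110010, fw 2 0 2110]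

theorem target_comul_antipode (hν : IsAntipode ν) : Rel ν ν' 1 [t 0, d 0] [d 0, n 0, d 1, t 1,
    c 0, m 1] :=
  (target_comul_target ∷ (antipode_id hν) ∷ mul_comul_target ∷ (endo_right_br .target) ∷
    .nil).derive [bw 0 0 11, bw 1 0 221, fw 2 0 11100, bw 3 0 121000]

theorem antipode_comul_cross (hν : IsAntipode ν) : Rel ν ν' 1 [d 0, d 1, n 2, n 1, c 1, t 0, d 0,
    c 1, m 2, m 0] [d 0, d 1, d 2, n 3, r 2, t 1, n 0, c 0, m 1, c 1, m 0] :=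
  (mul_left_br ∷ (target_comul_antipode hν) ∷ mul_assoc ∷ comul_assoc ∷ (id_antipode hν) ∷
    .nil).derive [bw 0 1 2110010000, fw 1 0 222110000, fw 2 1 2211000000000,
    fw 3 0 2222222212221, fw 3 1 2222222122210, bw 3 2 2222222221100, fw 4 2 2222221110000]

theorem mul_rMap : Rel ν ν' 2 [m 0, r 0] [d 0, m 1, e 1, r 0] :=
  (rMap_eq ∷ counit_left_brInv ∷ mul_left_brInv ∷ br_brInv ∷ mul_assoc ∷ counit_mul_left ∷
    .nil).derive [fw 0 0 10, fw 1 0 100000, fw 2 0 2110000, fw 3 1 22211000, bw 4 1 210001,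
    fw 5 1 111000, bw 3 1 22200000, bw 2 0 2111000000, bw 1 0 110000000, bw 0 0 11111000]

/-- After projecting by `t` and `r`, comultiplication is insensitive to a crossing. This brings `r`
and `t` next to the two antipodes that absorb them through `ν ⋆ r = ν` and `t ⋆ ν = ν`. -/
theorem comul_rMap_target : Rel ν ν' 1 [d 0, r 1, t 0] [d 0, c 0, r 1, t 0] :=
  (target_eq ∷ one_left_brInv ∷ comul_left_brInv ∷ rMap_eq ∷ brInv_br ∷ comul_right_brInv ∷
    mul_rMap_br ∷ mul_rMap ∷ comul_left_br ∷ (endo_right_br .target) ∷ .nil).derive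
    [fw 0 0 100, bw 1 0 2222100, bw 2 0 22211000, fw 3 1 222222210, fw 4 0 2211000000000,
    bw 4 2 22000222220, bw 3 3 2211111000000, fw 5 1 222211001, bw 4 0 22222000,
    bw 6 1 1111100000, fw 2 0 2221110, fw 1 0 222211, fw 7 1 11000, bw 8 0 2221100,
    bw 0 1 22111011, fw 9 0 2110]

theorem comul_target_antipode_mul (hν : IsAntipode ν) : Rel ν ν' 1 [d 0, t 0, n 1, m 0] [n 0] :=
  ((antipode_id hν) ∷ (antipode_id_antipode hν) ∷ .nil).derive [bw 0 0 2100, fw 1 0 111111]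

theorem antipode_comul_contract (hν : IsAntipode ν) : Rel ν ν' 1 [d 0, d 1, d 2, n 3, r 2, t 1,
    n 0, c 0, m 1, c 1, m 0] [d 0, n 1, n 0, c 0] :=
  (comul_assoc ∷ comul_rMap_target ∷ (endo_right_br .target) ∷ (endo_left_br .rMap) ∷
    mul_left_br ∷ mul_right_br ∷ (antipode_rMap hν) ∷ (comul_target_antipode_mul hν) ∷
    .nil).derive [bw 0 1 22222222110, fw 1 1 22222111000, fw 0 1 222222221210,
    bw 2 1 222221210000, bw 3 1 222221100000, bw 4 0 221101000000, bw 5 0 11100000000,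
    bw 0 0 2222222211, fw 6 0 2111100000, fw 7 1 2211110]

theorem antipode_comul (hν : IsAntipode ν) : Rel ν ν' 1 [n 0, d 0] [d 0, n 1, n 0, c 0] :=
  ((antipode_comul_insert hν) ∷ (antipode_comul_expand hν) ∷ (antipode_comul_cross hν) ∷
    (antipode_comul_contract hν) ∷ .nil).derive [fw 0 0 11, fw 1 0 11111111,
    fw 2 0 1111111111, fw 3 0 11111111111]

/-! ### `θ` and its inverse take values in composable pairs. -/

theorem twist_target_eq_source (hν : IsAntipode ν) : Rel ν ν' 2 [d 1, c 0, m 1, n 1, d 0, t 1]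
    [d 1, c 0, m 1, n 1, d 1, s 2, b 1] :=
  (comul_right_br ∷ comul_assoc ∷ (endo_right_br .target) ∷ comul_target_left ∷ mul_assoc ∷
    mul_left_br ∷ (antipode_source hν) ∷ br_brInv ∷ (endo_left_br .source) ∷
    (antipode_comul hν) ∷ .nil).derive [bw 0 0 212210, fw 1 1 2222211, bw 2 1 1221000,
    fw 3 2 2222110, bw 4 2 210010000, bw 5 1 221101000, bw 3 1 21100011, bw 6 1 100000,
    bw 7 1 0, fw 8 1 211000000, bw 9 1 221111000]

/-- A morphism equalizing the two coactions is fixed by the idempotent: insert `t` in the pairing,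
trade it for `s`, and contract. -/
theorem twist_middle (hν : IsAntipode ν) : Rel ν ν' 2 [d 1, c 0, m 1, n 1, d 0, d 2, b 2, m 1,
    e 1] [d 1, c 0, m 1, n 1] :=
  (target_mul_counit ∷ (twist_target_eq_source hν) ∷ source_brInv_middle ∷ .nil).derive
    [bw 0 1 110000000, fw 1 0 2211221111, fw 2 0 11111110000]

theorem twistInv_target_eq_source (hν : IsAntipode ν) (h₁ : ν ≫ ν' = 𝟙 A) (h₂ : ν' ≫ ν = 𝟙 A) :
    Rel ν ν' 2 [d 0, m 1, i 1, b 0, d 0, t 1] [d 0, m 1, i 1, b 0, d 1, s 2, b 1] :=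
  ((antipodeInv_antipode h₂) ∷ comul_right_brInv ∷ (antipode_comul hν) ∷
    (endo_right_brInv .target) ∷ (antipode_antipodeInv h₁) ∷ (antipode_source hν) ∷ br_brInv ∷
    (endo_right_br .source) ∷ (endo_left_br .antipodeInv) ∷ comul_source_left ∷ mul_assoc ∷
    (endo_left_brInv .source) ∷ comul_assoc ∷ comul_left_brInv ∷ .nil).derive [bw 0 1 222000,
    bw 1 0 21100000, fw 2 1 222110000, bw 3 1 11000000000, bw 2 1 22211110000,
    bw 4 1 220000000, bw 5 2 22221000000, bw 6 1 220000000000, fw 7 1 22210010000000,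
    fw 8 1 22221100000000, bw 2 1 22222111100000, fw 0 1 222222211000, fw 9 1 2221210000,
    fw 0 1 22222221100, bw 10 2 222210010, bw 9 1 222221110, fw 11 1 22110000,
    bw 12 0 22222211, fw 13 0 21211000]

theorem twistInv_middle (hν : IsAntipode ν) (h₁ : ν ≫ ν' = 𝟙 A) (h₂ : ν' ≫ ν = 𝟙 A) : Rel ν ν' 2
    [d 0, m 1, i 1, b 0, d 0, d 2, b 2, m 1, e 1] [d 0, m 1, i 1, b 0] :=
  (target_mul_counit ∷ (twistInv_target_eq_source hν h₁ h₂) ∷ source_brInv_middle ∷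
    .nil).derive [bw 0 1 110000000, fw 1 0 2211221111, fw 2 0 11111110000]

/-! ### The antipode reverses multiplication. -/

theorem mul_antipode_insert (hν : IsAntipode ν) : Rel ν ν' 2 [m 0, n 0] [d 0, d 2, c 1, m 0, n 0,
    m 1, r 1, m 0] :=
  ((antipode_rMap hν) ∷ mul_comul ∷ .nil).derive [bw 0 0 10, fw 1 0 22211]

theorem rMap_mul_rMap : Rel ν ν' 2 [r 1, m 0, r 0] [m 0, r 0] :=
  (mul_rMap ∷ rMap_mul_counit ∷ .nil).derive [fw 0 0 110, fw 1 1 21101, bw 0 0 1111]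

theorem rMap_comul_br : Rel ν ν' 1 [r 0, d 0] [r 0, u 0, d 0, c 1, m 0] :=
  (rMap_eq ∷ one_right_brInv ∷ comul_right_brInv ∷ brInv_br ∷ comul_unit_br_right ∷
    .nil).derive [fw 0 0 21, bw 1 0 222221, bw 2 0 2222110, fw 3 1 22211000, fw 4 1 222111,
    bw 3 1 220222200, fw 2 0 22222221110, fw 1 0 2222222211, bw 0 0 112222111]

theorem rMap_mul_comul : Rel ν ν' 2 [r 1, m 0, d 0] [d 0, r 2, c 1, m 0] :=
  (mul_comul ∷ rMap_comul_br ∷ mul_right_br ∷ comul_one_comul_mul ∷ mul_left_br ∷ mul_assoc ∷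
    .nil).derive [fw 0 0 110, fw 1 1 222211, fw 2 1 221010000, bw 3 1 2222222100,
    bw 4 2 221100010000000, fw 3 1 22222211110110, bw 5 0 110000000, fw 3 0 212111110]

/-- Since `r (a b) = r (a r b)`, the formula `r = 1 ⋆ ν` gives `a₁ r b ν a₂`. Its companion is `t (a
b) = ν b₁ t a b₂`. -/
theorem mul_rMap_antipode (hν : IsAntipode ν) : Rel ν ν' 2 [m 0, r 0] [d 0, c 1, r 1, m 0, n 1,
    m 0] :=
  (rMap_mul_rMap ∷ (id_antipode hν) ∷ rMap_mul_comul ∷ mul_assoc ∷ (endo_left_br .antipode) ∷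
    (endo_right_br .rMap) ∷ .nil).derive [bw 0 0 11, bw 1 0 100, fw 2 0 22111, fw 3 0 110000,
    bw 4 1 221100, fw 5 1 221001, fw 4 1 222110, bw 3 0 110000]

theorem mul_antipode_expand (hν : IsAntipode ν) : Rel ν ν' 2 [d 0, d 2, c 1, m 0, n 0, m 1, r 1,
    m 0] [d 0, d 2, c 1, m 0, t 0, c 1, n 1, n 2, m 1, m 0] :=
  ((mul_rMap_antipode hν) ∷ mul_assoc ∷ (endo_left_br .antipode) ∷ comul_left_br ∷
    comul_right_br ∷ (id_antipode hν) ∷ comul_assoc ∷ mul_comul ∷ (antipode_id hν) ∷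
    .nil).derive [fw 0 2 22211000, fw 1 2 222110000000, bw 2 3 222222110000,
    bw 3 1 222222221100, bw 2 2 2222222211000, fw 4 2 2222222110001, bw 5 3 222222100000,
    fw 1 3 22222110000000, bw 6 2 22222222110000, bw 6 0 22222222222211,
    bw 1 2 22210010000000, bw 7 0 22121111000000, bw 1 0 10100000000, fw 8 0 21110000000,
    fw 2 1 222222110, bw 4 1 222221210]

theorem mul_target_antipode (hν : IsAntipode ν) : Rel ν ν' 2 [m 0, t 0] [d 1, c 0, t 1, m 1, n 0,
    m 0] :=
  (target_mul_target ∷ (antipode_id hν) ∷ target_mul_comul ∷ (endo_right_br .antipode) ∷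
    (endo_left_br .target) ∷ .nil).derive [bw 0 0 11, bw 1 0 100, fw 2 0 22111, bw 3 0 212100,
    fw 4 0 221100, fw 3 0 222110]

theorem mul_antipode_cross (hν : IsAntipode ν) : Rel ν ν' 2 [d 0, d 2, c 1, m 0, t 0, c 1, n 1,
    n 2, m 1, m 0] [d 0, c 1, d 1, c 0, n 0, t 1, r 2, n 3, m 2, m 1, m 0] :=
  (comul_right_br ∷ (endo_left_br .antipode) ∷ (mul_target_antipode hν) ∷ mul_assoc ∷
    comul_assoc ∷ (endo_right_br .antipode) ∷ (endo_left_br .target) ∷ (id_antipode hν) ∷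
    .nil).derive [fw 0 1 2222221101, bw 1 1 222222110, fw 2 0 211000000, fw 3 0 1100000000000,
    fw 3 1 2211000000000, fw 4 1 2222221221000, bw 5 0 2122100000000, bw 6 0 2211000000000,
    bw 3 2 2222211000000, fw 7 2 2222221110000, fw 6 0 22110000000, fw 5 0 22211000000,
    fw 1 1 22222222110]

/-- The images of `t` and `r` commute. This plays the part that `comul_rMap_target` plays for
comultiplication. -/
theorem target_rMap_mul : Rel ν ν' 2 [t 0, r 1, m 0] [t 0, r 1, c 0, m 0] :=
  (target_eq ∷ rMap_eq ∷ counit_left_br ∷ mul_left_br ∷ mul_right_br ∷ rMap_comul_br ∷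
    rMap_comul ∷ (endo_left_br .target) ∷ .nil).derive [fw 0 0 210, fw 1 1 2222221,
    fw 2 1 21000000000, fw 3 1 221100000000, bw 1 1 2222211222111, bw 4 0 122110000,
    bw 5 1 22211111, fw 6 1 22211, fw 4 0 2211000, bw 0 1 21110011, bw 7 0 2110]

theorem mul_antipode_contract (hν : IsAntipode ν) : Rel ν ν' 2 [d 0, c 1, d 1, c 0, n 0, t 1, r 2,
    n 3, m 2, m 1, m 0] [c 0, n 0, n 1, m 0] :=
  ((endo_left_br .antipode) ∷ (endo_right_br .antipode) ∷ (endo_left_br .target) ∷ mul_assoc ∷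
    target_rMap_mul ∷ comul_right_br ∷ (endo_right_br .rMap) ∷ mul_left_br ∷
    (comul_target_antipode_mul hν) ∷ mul_right_br ∷ (antipode_rMap hν) ∷ .nil).derive
    [bw 0 1 22222222110, bw 1 0 21221000000, bw 2 0 22110000000, bw 3 1 21000100000,
    fw 2 0 22211000000, fw 4 1 22110010000, fw 3 1 211000000000, bw 2 0 222211000000,
    bw 5 1 222222221100, fw 6 1 2221000100000, bw 7 1 2221100010000, bw 1 1 222222211000,
    bw 7 0 222211010000, bw 6 1 22110000000, bw 3 0 11000000000, fw 8 0 22221111000,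
    bw 9 0 21110000, fw 10 1 2221111, fw 1 0 2101, fw 0 0 2211]

theorem mul_antipode (hν : IsAntipode ν) : Rel ν ν' 2 [m 0, n 0] [c 0, n 0, n 1, m 0] :=
  ((mul_antipode_insert hν) ∷ (mul_antipode_expand hν) ∷ (mul_antipode_cross hν) ∷
    (mul_antipode_contract hν) ∷ .nil).derive [fw 0 0 11, fw 1 0 11111111, fw 2 0 1111111111,
    fw 3 0 11111111111]

theorem mul_antipodeInv (hν : IsAntipode ν) (h₁ : ν ≫ ν' = 𝟙 A) (h₂ : ν' ≫ ν = 𝟙 A) : Rel ν ν' 2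
    [m 0, i 0] [b 0, i 0, i 1, m 0] :=
  ((antipodeInv_antipode h₂) ∷ brInv_br ∷ (mul_antipode hν) ∷ (antipode_antipodeInv h₁) ∷
    (endo_right_brInv .antipodeInv) ∷ (endo_left_brInv .antipodeInv) ∷ .nil).derive
    [bw 0 0 22, bw 0 1 2222, bw 1 0 222020, bw 2 0 21111000, fw 3 0 110000, fw 4 0 2101,
    fw 5 0 2211]

theorem source_comul_target : Rel ν ν' 1 [s 0, d 0, t 0] [s 0, d 0] :=
  (source_comul ∷ one_comul_target ∷ .nil).derive [fw 0 0 211, fw 1 0 12110, bw 0 0 1111]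

/-- After `s` the first leg of `δ` lies in the image of `t`, so the `t` in `ν = t ⋆ ν` has no effect
and `1 ⋆ ν = r` remains. -/
theorem source_antipode_eq (hν : IsAntipode ν) : Rel ν ν' 1 [s 0, n 0] [s 0, r 0] :=
  ((comul_target_antipode_mul hν) ∷ source_comul_target ∷ (id_antipode hν) ∷ .nil).derive
    [bw 0 0 10, fw 1 0 21211, fw 2 0 1110]

theorem source_rMap : Rel ν ν' 1 [s 0, r 0] [r 0] :=
  (rMap_eq ∷ (endo_right_br .source) ∷ source_eq ∷ counit_mul_left ∷ mul_one ∷ .nil).derive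
    [fw 0 0 10, fw 1 1 221001, fw 2 1 221000, bw 3 0 111110000, fw 4 0 2211000, bw 0 0 11111]

theorem source_antipode (hν : IsAntipode ν) : Rel ν ν' 1 [s 0, n 0] [r 0] :=
  ((source_antipode_eq hν) ∷ source_rMap ∷ .nil).derive [fw 0 0 11, fw 1 0 11]

theorem rMap_antipodeInv (hν : IsAntipode ν) (h₁ : ν ≫ ν' = 𝟙 A) : Rel ν ν' 1 [r 0, i 0] [s 0] :=
  ((source_antipode hν) ∷ (antipode_antipodeInv h₁) ∷ .nil).derive [bw 0 0 21, fw 1 0 110]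

/-! ### Invertibility of `θ`. -/

/-- On all of `A ⊗ A` the composite is only `a s b₂ ⊗ b₁`. On composable pairs the source of `b`
becomes the target of `a`, and `a₁ t a₂ = a` finishes. -/
theorem twist_twistInv (hν : IsAntipode ν) (h₁ : ν ≫ ν' = 𝟙 A) (h₂ : ν' ≫ ν = 𝟙 A) : Rel ν ν' 2
    [d 1, c 0, m 1, n 1, d 0, m 1, i 1, b 0] [d 1, s 2, b 1, m 0] :=
  (comul_right_br ∷ (mul_antipodeInv hν h₁ h₂) ∷ comul_assoc ∷
    (endo_left_brInv .antipodeInv) ∷ (endo_right_br .antipodeInv) ∷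
    (endo_right_brInv .antipodeInv) ∷ (antipode_antipodeInv h₁) ∷ mul_right_brInv ∷ br_brInv ∷
    mul_assoc ∷ (id_antipode hν) ∷ (rMap_antipodeInv hν h₁) ∷ .nil).derive [bw 0 0 22212210,
    fw 1 1 211000000, fw 2 1 22222222211, bw 3 1 22211000000, bw 4 1 22221221000,
    bw 5 1 22110000000, fw 6 2 22211000000, fw 7 1 221100000, fw 8 1 2222110000,
    fw 9 1 21100000, fw 7 0 11000000, fw 8 0 221100000, bw 6 3 2222200, fw 5 2 222101000,
    fw 3 2 222211000, bw 1 2 221111000, fw 10 2 2221110, fw 11 2 22110]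

theorem middle_twist_twistInv (hν : IsAntipode ν) (h₁ : ν ≫ ν' = 𝟙 A) (h₂ : ν' ≫ ν = 𝟙 A) : Rel ν
    ν' 2 [d 0, d 2, b 2, m 1, e 1, d 1, c 0, m 1, n 1, d 0, m 1, i 1, b 0] [d 0, d 2, b 2, m 1,
    e 1] :=
  ((twist_twistInv hν h₁ h₂) ∷ middle_target_eq_source ∷ comul_target_mul ∷ .nil).derive
    [fw 0 0 1111111000100, bw 1 0 211111111, fw 2 0 11100000]

theorem twistInv_twist (hν : IsAntipode ν) (h₂ : ν' ≫ ν = 𝟙 A) : Rel ν ν' 2 [d 0, m 1, i 1, b 0,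
    d 1, c 0, m 1, n 1] [d 0, t 1, m 1] :=
  ((mul_antipode hν) ∷ comul_right_br ∷ brInv_br ∷ comul_assoc ∷ (antipodeInv_antipode h₂) ∷
    mul_assoc ∷ (antipode_id hν) ∷ .nil).derive [fw 0 1 11000000, fw 1 0 2221110000,
    fw 2 0 222211000, fw 3 0 2212221, fw 4 2 2211000, bw 5 1 10100, fw 6 1 21110]

theorem middle_twistInv_twist (hν : IsAntipode ν) (h₂ : ν' ≫ ν = 𝟙 A) : Rel ν ν' 2 [d 0, d 2, b 2,
    m 1, e 1, d 0, m 1, i 1, b 0, d 1, c 0, m 1, n 1] [d 0, d 2, b 2, m 1, e 1] :=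
  ((twistInv_twist hν h₂) ∷ middle_target_eq_source ∷ comul_source_brInv_mul ∷ .nil).derive
    [fw 0 0 1111111100000, fw 1 0 21111111, fw 2 2 222111100]

/-! ### The squared antipode on the object of objects. -/

/-- By the two reversal laws `ν (ν a₂) ν a₁ = ν (a₁ ν a₂)`, that is, `t ν = ν r`. -/
theorem antipode_target (hν : IsAntipode ν) : Rel ν ν' 1 [n 0, t 0] [r 0, n 0] :=
  ((antipode_id hν) ∷ (antipode_comul hν) ∷ (endo_left_br .antipode) ∷ (mul_antipode hν) ∷
    (id_antipode hν) ∷ .nil).derive [bw 0 0 10, fw 1 0 2211, fw 2 0 221100, bw 3 0 111100,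
    fw 4 0 2111]

/-- From `ν ν s = ν r = t ν` the square of `ν` maps the common image of `s` and `t` into the image
of `t`. -/
theorem target_antipode_antipode_eq (hν : IsAntipode ν) : Rel ν ν' 1 [t 0, n 0, n 0] [t 0, n 0,
    n 0, t 0] :=
  (target_source ∷ (source_antipode hν) ∷ (antipode_target hν) ∷ target_target ∷ .nil).derive
    [bw 0 0 221, fw 1 0 2110, bw 2 0 110, bw 3 0 100, fw 2 0 2110, bw 1 0 2210, fw 0 0 22211]

theorem object_object_inv (hν : IsAntipode ν) (h₁ : ν ≫ ν' = 𝟙 A) : Rel ν ν' 1 [t 0, n 0, n 0,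
    t 0, t 0, i 0, i 0, t 0] [t 0] :=
  ((target_antipode_antipode_eq hν) ∷ (antipode_antipodeInv h₁) ∷ target_target ∷ .nil).derive
    [bw 0 0 22221111, bw 0 0 2221111, fw 1 0 221100, fw 1 0 2110, fw 2 0 11]

theorem target_antipodeInv (hν : IsAntipode ν) (h₁ : ν ≫ ν' = 𝟙 A) (h₂ : ν' ≫ ν = 𝟙 A) : Rel ν ν'
    1 [t 0, i 0] [i 0, r 0] :=
  ((antipodeInv_antipode h₂) ∷ (antipode_target hν) ∷ (antipode_antipodeInv h₁) ∷ .nil).derive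
    [bw 0 0 22, fw 1 0 2110, fw 2 0 1100]

theorem target_antipodeInv_antipodeInv (hν : IsAntipode ν) (h₁ : ν ≫ ν' = 𝟙 A) (h₂ : ν' ≫ ν = 𝟙 A)
    : Rel ν ν' 1 [t 0, i 0, i 0] [t 0, i 0, i 0, t 0] :=
  ((target_antipodeInv hν h₁ h₂) ∷ (rMap_antipodeInv hν h₁) ∷ source_target ∷ .nil).derive
    [fw 0 0 211, fw 1 0 110, bw 2 0 10, bw 1 0 210, bw 0 0 2211]

theorem object_inv_object (hν : IsAntipode ν) (h₁ : ν ≫ ν' = 𝟙 A) (h₂ : ν' ≫ ν = 𝟙 A) : Rel ν ν' 1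
    [t 0, i 0, i 0, t 0, t 0, n 0, n 0, t 0] [t 0] :=
  ((target_antipodeInv_antipodeInv hν h₁ h₂) ∷ (antipodeInv_antipode h₂) ∷ target_target ∷
    .nil).derive [bw 0 0 22221111, bw 0 0 2221111, fw 1 0 221100, fw 1 0 2110, fw 2 0 11]

theorem antipode_counit (hν : IsAntipode ν) : Rel ν ν' 1 [n 0, e 0] [e 0] :=
  ((antipode_rMap hν) ∷ rMap_mul_counit ∷ (antipode_id hν) ∷ target_counit ∷ .nil).derive
    [bw 0 0 21, fw 1 0 11010, fw 2 0 2111, fw 3 0 11]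

theorem antipode_target_eq (hν : IsAntipode ν) : Rel ν ν' 1 [n 0, t 0] [s 0, t 0, n 0, n 0, t 0]
    :=
  ((antipode_target hν) ∷ (source_antipode hν) ∷ source_target ∷
    (target_antipode_antipode_eq hν) ∷ .nil).derive [fw 0 0 11, bw 1 0 21, bw 2 0 221,
    fw 3 0 1110]

theorem antipode_antipode_comul (hν : IsAntipode ν) : Rel ν ν' 1 [t 0, n 0, n 0, d 0, t 0, t 1]
    [t 0, d 0, c 0, c 0, n 0, n 0, n 1, n 1, t 0, t 1] :=
  ((antipode_comul hν) ∷ (endo_left_br .target) ∷ (endo_right_br .target) ∷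
    (endo_left_br .antipode) ∷ (endo_right_br .antipode) ∷ .nil).derive [fw 0 0 221100,
    bw 1 0 21100000, bw 2 0 11000000, fw 0 0 22222110, bw 3 0 2222110000, bw 4 0 2212100000,
    bw 1 0 2211000000, bw 2 0 2110000000, fw 1 0 2110000000, fw 2 0 1100000000,
    fw 2 0 2210010000, fw 1 0 2110000000, fw 3 0 2221100000, fw 4 0 2211000000,
    fw 3 0 2222110000, fw 4 0 2221100000, fw 4 0 2222211000, fw 4 0 2222221100,
    fw 3 0 2222110000, fw 3 0 2222211000]

theorem target_antipode (hν : IsAntipode ν) : Rel ν ν' 1 [t 0, n 0] [n 0, r 0] :=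
  ((antipode_id hν) ∷ (mul_antipode hν) ∷ (endo_left_br .antipode) ∷
    (endo_right_br .antipode) ∷ (antipode_comul hν) ∷ (id_antipode hν) ∷ .nil).derive
    [bw 0 0 21, fw 1 0 1100, bw 2 0 221100, bw 3 0 211000, fw 2 0 211000, bw 4 0 221111,
    fw 5 0 1110]

theorem antipode_antipode_target (hν : IsAntipode ν) : Rel ν ν' 1 [n 0, n 0, t 0] [t 0, n 0, n 0]
    :=
  ((antipode_target hν) ∷ (target_antipode hν) ∷ .nil).derive [fw 0 0 110, bw 1 0 211]

theorem comul_object_object (hν : IsAntipode ν) : Rel ν ν' 1 [t 0, d 0, t 0, t 1, c 0, c 0, t 0,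
    n 0, n 0, t 0, t 1, n 1, n 1, t 1] [t 0, d 0, c 0, c 0, n 0, n 0, n 1, n 1, t 0, t 1] :=
  ((endo_left_br .target) ∷ (endo_left_br .antipode) ∷ (endo_right_br .target) ∷
    (endo_right_br .antipode) ∷ target_target ∷ (target_antipode_antipode_eq hν) ∷
    target_comul_target ∷ (antipode_antipode_target hν) ∷ .nil).derive [bw 0 0 22222221100000,
    bw 1 0 22222211000000, bw 1 0 22222110000000, bw 0 0 22221100000000,
    bw 2 0 22222222110000, bw 3 0 22222221100000, bw 3 0 22222211000000,
    bw 2 0 22222110000000, bw 2 0 22211000000000, bw 3 0 22110000000000,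
    bw 3 0 21100000000000, bw 0 0 22221100000000, bw 1 0 22211000000000,
    bw 1 0 22110000000000, bw 2 0 11000000000000, bw 0 0 21100000000000,
    fw 4 1 22222222221100, bw 5 1 2222222111100, fw 6 0 222222122211, fw 6 0 22222122211,
    bw 7 1 2222211100, fw 0 0 2110000000, fw 2 0 1100000000, fw 2 0 2210010000,
    fw 0 0 2110000000, fw 1 0 2221100000, fw 3 0 2211000000, fw 1 0 2222110000,
    fw 3 0 2221100000, fw 3 0 2222211000, fw 3 0 2222221100, fw 1 0 2222110000,
    fw 1 0 2222211000]

theorem object_comul (hν : IsAntipode ν) : Rel ν ν' 1 [t 0, n 0, n 0, t 0, d 0, t 0, t 1] [t 0,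
    d 0, t 0, t 1, c 0, c 0, t 0, n 0, n 0, t 0, t 1, n 1, n 1, t 1] :=
  ((target_antipode_antipode_eq hν) ∷ (antipode_antipode_comul hν) ∷
    (comul_object_object hν) ∷ .nil).derive [bw 0 0 2221111, fw 1 0 111111, bw 2 0 1111111111]

/-! ### `θ` is a morphism of comodules. -/

/-- Reversal of comultiplication gathers the left side into `a₁ ⊗ b₁ ⊗ ν (a₂ b₂)` followed by the
standard coaction on the last two factors. `twist_coaction_split` extracts the same final coaction
from the other side, so only `twist_coaction` is left to compare. -/
theorem coaction_antipode (hν : IsAntipode ν) : Rel ν ν' 2 [d 0, d 2, c 1, m 2, d 0, d 2, c 1,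
    n 4, c 3, c 2, d 4, c 3, m 4, n 4] [d 0, d 2, c 1, m 2, n 2, d 1, d 3, c 2] :=
  (comul_assoc ∷ comul_left_br ∷ br_left_br ∷ mul_left_br ∷ (endo_left_br .antipode) ∷
    comul_right_br ∷ mul_comul ∷ (antipode_comul hν) ∷ .nil).derive [fw 0 0 22222122222210,
    bw 1 3 22222110000000, bw 2 2 221101000000000, bw 3 3 221100100000000,
    bw 4 3 21100000000000, bw 0 2 22222211000000, bw 5 2 22222221221000,
    fw 0 1 222222222222211, fw 5 1 222211100000000, fw 1 1 22222122211000,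
    bw 6 2 2222121110010, bw 7 2 2211110000]

theorem twist_coaction_expand (hν : IsAntipode ν) (h₁ : ν ≫ ν' = 𝟙 A) (h₂ : ν' ≫ ν = 𝟙 A) : Rel ν
    ν' 2 [d 1, c 0, m 1, n 1, d 0, d 2, c 1, m 2, i 2, b 1, b 0] [d 0, d 2, c 1, d 1, s 2, b 1,
    m 0, m 2, n 2] :=
  ((antipode_comul hν) ∷ mul_left_br ∷ (endo_left_br .antipodeInv) ∷ br_brInv ∷
    (mul_antipodeInv hν h₁ h₂) ∷ (endo_left_brInv .antipodeInv) ∷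
    (endo_right_brInv .antipodeInv) ∷ (antipode_antipodeInv h₁) ∷ mul_comul ∷ comul_left_br ∷
    comul_assoc ∷ comul_right_br ∷ (twist_twistInv hν h₁ h₂) ∷ .nil).derive
    [fw 0 1 22222211000, bw 1 1 2221101000000, bw 2 1 221100000000, fw 3 1 211000000000,
    fw 4 1 2110000000, bw 5 1 222110000000, bw 6 1 221100000000, fw 7 1 222221100000,
    fw 8 1 2222221100, bw 7 1 2222200000000, fw 6 1 221001000000000, fw 5 1 222110000000000,
    bw 9 0 222222222221100, bw 10 1 2222222222222211, bw 4 1 2111100000000000,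
    fw 11 1 22222222211010, fw 12 0 1111111100000]

theorem coaction_source_expand : Rel ν ν' 2 [d 0, d 2, c 1, d 1, s 2, b 1, m 0, m 2, n 2] [d 1,
    c 0, d 1, d 3, c 2, s 2, m 1, m 2, b 0, n 2] :=
  (comul_right_br ∷ comul_assoc ∷ (endo_right_br .source) ∷ br_brInv ∷ mul_right_brInv ∷
    comul_left_br ∷ .nil).derive [bw 0 1 222122100, fw 1 1 2222222211, bw 2 2 2212210000,
    bw 3 0 2200000000, bw 4 0 111000000000, fw 5 0 22122211000, fw 2 2 2222100100]

theorem comul_source_mul_mul : Rel ν ν' 2 [d 0, d 2, c 1, s 1, m 0, m 1] [d 0, m 1] :=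
  ((endo_right_br .source) ∷ comul_source_left ∷ mul_assoc ∷ comul_one_comul_mul ∷
    .nil).derive [bw 0 1 212100, fw 1 1 222211, bw 2 2 2100100, fw 3 0 1211111]

theorem coaction_expand : Rel ν ν' 2 [d 0, d 2, c 1, m 2, n 2] [d 1, c 0, d 1, m 2, b 0, n 2] :=
  (br_brInv ∷ comul_left_br ∷ .nil).derive [bw 0 0 0, fw 1 0 2122110]

theorem coaction_source : Rel ν ν' 2 [d 0, d 2, c 1, d 1, s 2, b 1, m 0, m 2, n 2] [d 0, d 2, c 1,
    m 2, n 2] :=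
  (coaction_source_expand ∷ comul_source_mul_mul ∷ coaction_expand ∷ .nil).derive
    [fw 0 0 111111111, fw 1 1 2112111010, bw 2 0 111111]

theorem twist_coaction (hν : IsAntipode ν) (h₁ : ν ≫ ν' = 𝟙 A) (h₂ : ν' ≫ ν = 𝟙 A) : Rel ν ν' 2
    [d 1, c 0, m 1, n 1, d 0, d 2, c 1, m 2, i 2, b 1, b 0] [d 0, d 2, c 1, m 2, n 2] :=
  ((twist_coaction_expand hν h₁ h₂) ∷ coaction_source ∷ .nil).derive [fw 0 0 11111111111,
    fw 1 0 111111111]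

theorem twist_coaction_split : Rel ν ν' 2 [d 1, c 0, m 1, n 1, d 0, d 2, c 1, m 2, d 0, d 2, c 1,
    i 4, b 3, b 2, b 1, b 0] [d 1, c 0, m 1, n 1, d 0, d 2, c 1, m 2, i 2, b 1, b 0, d 1, d 3,
    c 2] :=
  (comul_assoc ∷ br_left_brInv ∷ comul_left_brInv ∷ .nil).derive [fw 0 0 2222122222100000,
    fw 1 1 2111000000000000, fw 2 2 2221110000000000, bw 0 0 222222221100000,
    fw 2 0 121100000000000]

theorem twist_coaction_eq (hν : IsAntipode ν) (h₁ : ν ≫ ν' = 𝟙 A) (h₂ : ν' ≫ ν = 𝟙 A) : Rel ν ν' 2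
    [d 0, d 2, c 1, m 2, d 0, d 2, c 1, n 4, c 3, c 2, d 4, c 3, m 4, n 4] [d 1, c 0, m 1, n 1,
    d 0, d 2, c 1, m 2, d 0, d 2, c 1, i 4, b 3, b 2, b 1, b 0] :=
  ((coaction_antipode hν) ∷ (twist_coaction hν h₁ h₂) ∷ twist_coaction_split ∷ .nil).derive
    [fw 0 0 11111111111111, bw 1 0 22211111, bw 2 0 11111111111111]

/-! ### `θ` and the objects of a composable pair. -/

theorem twist_span (hν : IsAntipode ν) : Rel ν ν' 2 [d 1, c 0, m 1, n 1, d 0, t 1, s 0, t 2] [d 1,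
    c 0, m 1, d 0, t 1, r 2, s 0, n 2] :=
  ((antipode_target hν) ∷ .nil).derive [fw 0 1 22211000]

theorem middle_comul_br : Rel ν ν' 2 [d 0, d 2, b 2, m 1, e 1, d 1, c 0] [d 1, c 0, d 1, d 3, b 3,
    m 2, e 2] :=
  (comul_left_brInv ∷ comul_assoc ∷ counit_left_br ∷ mul_left_br ∷ brInv_br ∷ comul_left_br ∷
    .nil).derive [bw 0 1 2222110, fw 1 1 22222211, fw 2 1 21000000, fw 3 1 221100000,
    fw 4 1 2222211000, fw 5 0 12211000]

theorem middle_twist_cross : Rel ν ν' 2 [d 0, d 2, b 2, m 1, e 1, d 1, c 0, m 1, d 0, t 1, r 2]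
    [d 1, c 0, d 1, d 3, b 3, m 2, e 2, d 2, c 1, m 2, t 1, r 2] :=
  (comul_right_br ∷ comul_assoc ∷ middle_comul_br ∷ .nil).derive [bw 0 0 21221000000,
    fw 1 2 222222221100, fw 2 0 222211112111]

theorem comul_rMap_left : Rel ν ν' 1 [d 0, r 1] [u 0, d 0, c 1, m 0] :=
  (rMap_eq ∷ one_comul_mul_comul ∷ one_left_br ∷ comul_left_br ∷ comul_right_br ∷
    mul_right_br ∷ mul_assoc ∷ mul_left_br ∷ comul_unit_br_left ∷ comul_assoc ∷ mul_comul ∷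
    comul_counit ∷ .nil).derive [fw 0 1 10, bw 1 0 222221, bw 2 0 2222100000,
    bw 3 0 222110000000, fw 1 0 2222222111111, fw 4 1 22211001, bw 1 1 2221000,
    fw 5 0 221100000000, bw 6 2 2210010000000, bw 7 1 2221101000000, bw 8 0 222211112211,
    bw 9 0 222222110, bw 10 0 121111000, fw 11 0 110000]

theorem comul_br_target_rMap : Rel ν ν' 2 [d 1, c 0, m 1, t 0, r 1] [d 0, b 0, m 1, r 0, t 1, c 0]
    :=
  ((endo_right_br .target) ∷ rMap_mul_rMap ∷ comul_rMap_left ∷ mul_target ∷ comul_right_br ∷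
    counit_comul ∷ mul_left_br ∷ (endo_left_br .rMap) ∷ mul_rMap ∷ target_mul_target ∷
    br_brInv ∷ (endo_left_brInv .target) ∷ (endo_right_brInv .rMap) ∷ .nil).derive
    [bw 0 0 12210, bw 1 1 11000, fw 2 1 222211, fw 3 1 22211000, bw 4 2 2222221100,
    bw 2 1 22221221110, fw 5 1 222122210, bw 0 1 2221100, bw 6 0 2111000, bw 7 0 110000,
    fw 1 0 211100, fw 8 0 21100, bw 3 1 2211011, bw 9 1 22110, bw 10 0 202200,
    fw 0 0 22221010, bw 5 0 22222220, fw 2 0 2222222110, fw 4 1 222222211001,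
    bw 3 0 11222211000, bw 2 0 222221111, fw 11 0 2221100, fw 9 1 2111000, fw 12 0 222110]

/-- On composable pairs `t b₁ ⊗ r (a b₂) = t b ⊗ r a`: once the outputs are projected by `t` and
`r`, the product no longer matters. This reduces (G3) to a permutation of strands. -/
theorem middle_target_rMap : Rel ν ν' 2 [d 0, d 2, b 2, m 1, e 1, d 1, c 0, m 1, t 0, r 1] [d 0,
    d 2, b 2, m 1, e 1, c 0, t 0, r 1] :=
  (comul_br_target_rMap ∷ comul_assoc ∷ (endo_right_brInv .rMap) ∷ target_mul_target ∷
    (endo_left_brInv .target) ∷ comul_rMap_target ∷ (endo_right_br .target) ∷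
    (endo_left_br .rMap) ∷ br_brInv ∷ middle_target_eq_source ∷ comul_source_brInv_mul ∷
    .nil).derive [fw 0 0 1111000100, fw 1 0 22222122100, bw 2 0 21221000000,
    bw 3 1 21100000000, bw 4 0 222110000000, bw 1 0 222222221100, fw 5 0 222211100000,
    fw 1 0 2222222122100, bw 6 0 2222121000000, bw 7 0 2222110000000, fw 8 0 2221100000000,
    bw 1 0 22222221100, fw 9 0 22221111111, fw 10 2 222222111100, fw 7 0 11000000,
    fw 6 0 21000100]

theorem middle_br_comul : Rel ν ν' 2 [d 0, d 2, b 2, m 1, e 1, c 0, d 0, t 1, r 2] [d 1, c 0, d 1,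
    d 3, b 3, m 2, e 2, c 1, t 1, r 2] :=
  ((endo_left_br .rMap) ∷ comul_right_br ∷ (endo_right_br .target) ∷ middle_comul_br ∷
    .nil).derive [bw 0 0 221100000, bw 1 0 211000000, bw 2 1 1100000000, fw 0 0 2110000000,
    fw 3 0 2211112111, fw 0 1 1100000000, fw 2 1 2100001000]

theorem middle_twist_br : Rel ν ν' 2 [d 0, d 2, b 2, m 1, e 1, d 1, c 0, m 1, d 0, t 1, r 2] [d 0,
    d 2, b 2, m 1, e 1, c 0, d 0, t 1, r 2] :=
  (middle_twist_cross ∷ middle_target_rMap ∷ middle_br_comul ∷ .nil).derive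
    [fw 0 0 11111111111, fw 1 1 111111101110, bw 2 0 1111111111]

theorem middle_span_object (hν : IsAntipode ν) : Rel ν ν' 2 [d 0, d 2, b 2, m 1, e 1, d 0, t 1,
    s 0, t 2, c 0, c 1, t 2, n 2, n 2, t 2] [d 0, d 2, b 2, m 1, e 1, c 0, d 0, t 1, r 2, s 0,
    n 2] :=
  (comul_assoc ∷ (endo_left_br .target) ∷ (endo_left_br .antipode) ∷
    (endo_left_brInv .target) ∷ (antipode_target_eq hν) ∷ middle_target_eq_source ∷
    comul_source_target_br ∷ br_brInv ∷ counit_left_brInv ∷ (endo_right_br .target) ∷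
    (endo_right_br .source) ∷ (antipode_target hν) ∷ comul_right_br ∷ (endo_left_br .rMap) ∷
    .nil).derive [fw 0 0 222222221221000, bw 1 1 222110000000000, bw 2 1 221100000000000,
    bw 2 1 211000000000000, bw 1 0 222211000000000, bw 2 0 222110000000000,
    bw 2 0 221100000000000, bw 1 1 110000000000000, bw 1 0 211000000000000,
    bw 3 1 222222222222110, bw 4 0 221111100000000, bw 0 0 222222211000, fw 3 1 222222222110,
    fw 5 0 222211111211, bw 3 2 2222222110000, bw 6 2 2222222211100, fw 7 2 22222221100000,
    fw 8 1 222210020000, fw 9 1 1000000001000, fw 10 0 2210010000000, fw 11 0 2222110000000,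
    bw 8 1 2222221100000, fw 12 0 221100000100, fw 2 0 22211000000, fw 13 0 22221100000]

theorem middle_twist_span (hν : IsAntipode ν) : Rel ν ν' 2 [d 0, d 2, b 2, m 1, e 1, d 1, c 0,
    m 1, n 1, d 0, t 1, s 0, t 2] [d 0, d 2, b 2, m 1, e 1, d 0, t 1, s 0, t 2, c 0, c 1, t 2,
    n 2, n 2, t 2] :=
  ((twist_span hν) ∷ middle_twist_br ∷ (middle_span_object hν) ∷ .nil).derive
    [fw 0 0 1111111000100, fw 1 0 2112111111111, bw 2 0 11111111111]

end Diagram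

/-! ### Retracts of powers and representatives of morphisms between them -/

namespace Diagram

section

variable {𝒱 : Type u} [Category.{v} 𝒱]

/-- `X` is presented as a retract of `X'`. -/
class Cut (X : 𝒱) (X' : outParam 𝒱) where
  incl : X ⟶ X'
  proj : X' ⟶ X
  incl_proj : incl ≫ proj = 𝟙 X

namespace Cut

attribute [simp] incl_proj

/-- The idempotent of `X'` split by `X`. -/
def idem (X : 𝒱) {X' : 𝒱} [Cut X X'] : X' ⟶ X' := proj (X := X) ≫ incl (X := X)

@[simp]
theorem incl_proj_assoc {X X' Y : 𝒱} [Cut X X'] (f : X ⟶ Y) :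
    incl (X := X) ≫ proj (X := X) ≫ f = f := by
  rw [← Category.assoc, incl_proj, Category.id_comp]

instance refl (X : 𝒱) : Cut X X := ⟨𝟙 X, 𝟙 X, Category.id_comp _⟩

instance tensor [MonoidalCategory 𝒱] (X Y : 𝒱) {X' Y' : 𝒱} [Cut X X'] [Cut Y Y'] :
    Cut (X ⊗ Y) (X' ⊗ Y') where
  incl := incl (X := X) ⊗ₘ incl (X := Y)
  proj := proj (X := X) ⊗ₘ proj (X := Y)
  incl_proj := by rw [tensorHom_comp_tensorHom, incl_proj, incl_proj, id_tensorHom_id]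

theorem idem_refl (X : 𝒱) : idem X = 𝟙 X := Category.id_comp _

theorem idem_tensor [MonoidalCategory 𝒱] (X Y : 𝒱) {X' Y' : 𝒱} [Cut X X'] [Cut Y Y'] :
    idem (X ⊗ Y) = idem X ▷ Y' ≫ X' ◁ idem Y := by
  rw [idem, idem, idem, ← MonoidalCategory.tensorHom_def, ← tensorHom_comp_tensorHom]
  rfl

end Cut

open Cut

/-- `F'` is a representative of `F : X ⟶ Y`, where `X` and `Y` are retracts of `X'` and `Y'`. -/
class Rep {X Y X' Y' : 𝒱} [Cut X X'] [Cut Y Y'] (F : X ⟶ Y) (F' : outParam (X' ⟶ Y')) :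
    Prop where
  comm : F ≫ incl (X := Y) = incl (X := X) ≫ F'

/-- Morphisms are equal if their representatives agree on the idempotent of the source. -/
theorem Rep.ext {X Y X' Y' : 𝒱} [Cut X X'] [Cut Y Y'] {F G : X ⟶ Y} (F' G' : X' ⟶ Y')
    [hF : Rep F F'] [hG : Rep G G'] (h : idem X ≫ F' = idem X ≫ G') : F = G := by
  have : F ≫ incl (X := Y) = G ≫ incl (X := Y) := by
    rw [hF.comm, hG.comm, ← incl_proj_assoc (X := X) (incl (X := X) ≫ F'),
      ← incl_proj_assoc (X := X) (incl (X := X) ≫ G')]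
    simpa only [idem, Category.assoc] using congrArg (incl (X := X) ≫ ·) h
  simpa using congrArg (· ≫ proj (X := Y)) this

namespace Rep

variable {X Y Z W X' Y' Z' W' : 𝒱} [Cut X X'] [Cut Y Y'] [Cut Z Z'] [Cut W W']

instance id (X : 𝒱) {X' : 𝒱} [Cut X X'] : Rep (𝟙 X) (𝟙 X') := ⟨by simp⟩

instance comp (F : X ⟶ Y) (G : Y ⟶ Z) (F' : X' ⟶ Y') (G' : Y' ⟶ Z') [hF : Rep F F']
    [hG : Rep G G'] : Rep (F ≫ G) (F' ≫ G') :=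
  ⟨by rw [Category.assoc, hG.comm, ← Category.assoc, hF.comm, Category.assoc]⟩

/-- Representatives may be precomposed with the idempotent. -/
theorem of_idem {F : X ⟶ Y} {F' : X' ⟶ Y'} (F'' : X' ⟶ Y') [hF : Rep F F'']
    (h : idem X ≫ F'' = idem X ≫ F') : Rep F F' :=
  ⟨by
    rw [hF.comm, ← incl_proj_assoc (X := X) (incl (X := X) ≫ F''),
      ← incl_proj_assoc (X := X) (incl (X := X) ≫ F')]
    simpa only [idem, Category.assoc] using congrArg (incl (X := X) ≫ ·) h⟩

variable [MonoidalCategory 𝒱]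

instance whiskerLeft (X : 𝒱) {X' : 𝒱} [Cut X X'] (F : Y ⟶ Z) (F' : Y' ⟶ Z') [hF : Rep F F'] :
    Rep (X ◁ F) (X' ◁ F') :=
  ⟨by
    change X ◁ F ≫ (_ ⊗ₘ _) = (_ ⊗ₘ _) ≫ X' ◁ F'
    rw [← id_tensorHom, ← id_tensorHom, tensorHom_comp_tensorHom, tensorHom_comp_tensorHom,
      hF.comm, Category.id_comp, Category.comp_id]⟩

instance whiskerRight (X : 𝒱) {X' : 𝒱} [Cut X X'] (F : Y ⟶ Z) (F' : Y' ⟶ Z') [hF : Rep F F'] :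
    Rep (F ▷ X) (F' ▷ X') :=
  ⟨by
    change F ▷ X ≫ (_ ⊗ₘ _) = (_ ⊗ₘ _) ≫ F' ▷ X'
    rw [← tensorHom_id, ← tensorHom_id, tensorHom_comp_tensorHom, tensorHom_comp_tensorHom,
      hF.comm, Category.id_comp, Category.comp_id]⟩

instance tensorHom (F : X ⟶ Y) (G : Z ⟶ W) (F' : X' ⟶ Y') (G' : Z' ⟶ W') [hF : Rep F F']
    [hG : Rep G G'] : Rep (F ⊗ₘ G) (F' ▷ Z' ≫ Y' ◁ G') := by
  rw [MonoidalCategory.tensorHom_def]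
  infer_instance

instance associator_hom (X Y Z : 𝒱) {X' Y' Z' : 𝒱} [Cut X X'] [Cut Y Y'] [Cut Z Z'] :
    Rep (α_ X Y Z).hom (α_ X' Y' Z').hom := ⟨(associator_naturality _ _ _).symm⟩

instance associator_inv (X Y Z : 𝒱) {X' Y' Z' : 𝒱} [Cut X X'] [Cut Y Y'] [Cut Z Z'] :
    Rep (α_ X Y Z).inv (α_ X' Y' Z').inv := ⟨(associator_inv_naturality _ _ _).symm⟩

instance leftUnitor_hom (X : 𝒱) {X' : 𝒱} [Cut X X'] : Rep (λ_ X).hom (λ_ X').hom :=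
  ⟨by
    change _ = (𝟙 _ ⊗ₘ _) ≫ _
    rw [id_tensorHom, leftUnitor_naturality]⟩

instance leftUnitor_inv (X : 𝒱) {X' : 𝒱} [Cut X X'] : Rep (λ_ X).inv (λ_ X').inv :=
  ⟨by
    change _ ≫ (𝟙 _ ⊗ₘ _) = _
    rw [id_tensorHom, leftUnitor_inv_naturality]⟩

instance rightUnitor_hom (X : 𝒱) {X' : 𝒱} [Cut X X'] : Rep (ρ_ X).hom (ρ_ X').hom :=
  ⟨by
    change _ = (_ ⊗ₘ 𝟙 _) ≫ _
    rw [tensorHom_id, rightUnitor_naturality]⟩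

instance rightUnitor_inv (X : 𝒱) {X' : 𝒱} [Cut X X'] : Rep (ρ_ X).inv (ρ_ X').inv :=
  ⟨by
    change _ ≫ (_ ⊗ₘ 𝟙 _) = _
    rw [tensorHom_id, rightUnitor_inv_naturality]⟩

variable [BraidedCategory 𝒱]

instance braiding_hom (X Y : 𝒱) {X' Y' : 𝒱} [Cut X X'] [Cut Y Y'] :
    Rep (β_ X Y).hom (β_ X' Y').hom := ⟨(BraidedCategory.braiding_naturality _ _).symm⟩

instance braiding_inv (X Y : 𝒱) {X' Y' : 𝒱} [Cut X X'] [Cut Y Y'] :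
    Rep (β_ X Y).inv (β_ X' Y').inv := ⟨(BraidedCategory.braiding_inv_naturality _ _).symm⟩

instance endo {A : 𝒱} (f : A ⟶ A) : Rep f f := ⟨by simp [incl]⟩

section

variable (A : 𝒱)

instance mul [MonObj A] : Rep μ[A] μ[A] := ⟨by simp [incl]⟩

instance one [MonObj A] : Rep η[A] η[A] := ⟨by simp [incl]⟩

instance comul [ComonObj A] : Rep Δ[A] Δ[A] := ⟨by simp [incl]⟩

instance counit [ComonObj A] : Rep ε[A] ε[A] := ⟨by simp [incl]⟩

end

/-- Separate versions for one, two and three factors are needed because `A ⊗ B` is a retract of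
itself through `Cut.tensor` of identities, not through `Cut.refl`. -/
instance incl_one (C : 𝒱) {A : 𝒱} [Cut C A] : Rep (incl (X := C)) (𝟙 A) := ⟨by simp [incl]⟩

instance proj_one (C : 𝒱) {A : 𝒱} [Cut C A] : Rep (proj (X := C)) (idem C) :=
  ⟨by simp [idem, incl]⟩

instance incl_two (P : 𝒱) {A B : 𝒱} [Cut P (A ⊗ B)] : Rep (incl (X := P)) (𝟙 (A ⊗ B)) :=
  ⟨by simp [incl]⟩

instance proj_two (P : 𝒱) {A B : 𝒱} [Cut P (A ⊗ B)] : Rep (proj (X := P)) (idem P) :=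
  ⟨by simp [idem, incl]⟩

instance incl_three (T : 𝒱) {A B D : 𝒱} [Cut T ((A ⊗ B) ⊗ D)] :
    Rep (incl (X := T)) (𝟙 ((A ⊗ B) ⊗ D)) :=
  ⟨by simp [incl]⟩

instance proj_three (T : 𝒱) {A B D : 𝒱} [Cut T ((A ⊗ B) ⊗ D)] :
    Rep (proj (X := T)) (idem T) :=
  ⟨by simp [idem, incl]⟩

end Rep

end

/-! ### Words as explicit morphisms. -/

section

variable {𝒱 : Type u} [Category.{v} 𝒱] [MonoidalCategory 𝒱] [BraidedCategory 𝒱] {A : 𝒱} [MonObj A]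
  [ComonObj A]

/-- The action of a generator in explicit form. -/
class Acts (ν ν' : A ⟶ A) (k : ℕ) (g : Gen) (n : ℕ) (m : outParam ℕ)
    (f : outParam (pw A n ⟶ pw A m)) : Prop where
  eq : act ν ν' k g n = some ⟨m, f⟩

/-- The evaluation of a diagram in explicit form. -/
class Evaluates (ν ν' : A ⟶ A) (w : Word) (n : ℕ) (m : outParam ℕ)
    (f : outParam (pw A n ⟶ pw A m)) : Prop where
  eq : eval ν ν' w n = some ⟨m, f⟩

variable (ν ν' : A ⟶ A)

/-- Instance search on these classes computes the composite denoted by a concrete word, which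
`Rel.transport` then compares with the goal up to coherence. -/
instance Acts.mul (n : ℕ) :
    Acts ν ν' 0 .mul (n + 2) (n + 1) ((α_ A A (pw A n)).inv ≫ μ[A] ▷ pw A n) := ⟨rfl⟩

instance Acts.one (n : ℕ) : Acts ν ν' 0 .one n (n + 1) ((λ_ (pw A n)).inv ≫ η[A] ▷ pw A n) :=
  ⟨act_zero _ _⟩

instance Acts.comul (n : ℕ) :
    Acts ν ν' 0 .comul (n + 1) (n + 2) (Δ[A] ▷ pw A n ≫ (α_ A A (pw A n)).hom) := ⟨rfl⟩

instance Acts.counit (n : ℕ) :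
    Acts ν ν' 0 .counit (n + 1) n (ε[A] ▷ pw A n ≫ (λ_ (pw A n)).hom) := ⟨rfl⟩

instance Acts.br (n : ℕ) : Acts ν ν' 0 .br (n + 2) (n + 2)
    ((α_ A A (pw A n)).inv ≫ (β_ A A).hom ▷ pw A n ≫ (α_ A A (pw A n)).hom) := ⟨rfl⟩

instance Acts.brInv (n : ℕ) : Acts ν ν' 0 .brInv (n + 2) (n + 2)
    ((α_ A A (pw A n)).inv ≫ (β_ A A).inv ▷ pw A n ≫ (α_ A A (pw A n)).hom) := ⟨rfl⟩

instance Acts.antipode (n : ℕ) :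
    Acts ν ν' 0 (.endo .antipode) (n + 1) (n + 1) (ν ▷ pw A n) := ⟨rfl⟩

instance Acts.antipodeInv (n : ℕ) :
    Acts ν ν' 0 (.endo .antipodeInv) (n + 1) (n + 1) (ν' ▷ pw A n) := ⟨rfl⟩

instance Acts.source (n : ℕ) :
    Acts ν ν' 0 (.endo .source) (n + 1) (n + 1) (source A ▷ pw A n) := ⟨rfl⟩

instance Acts.target (n : ℕ) :
    Acts ν ν' 0 (.endo .target) (n + 1) (n + 1) (target A ▷ pw A n) := ⟨rfl⟩

instance Acts.succ (k : ℕ) (g : Gen) (n m : ℕ) (f : pw A n ⟶ pw A m) [h : Acts ν ν' k g n m f] :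
    Acts ν ν' (k + 1) g (n + 1) (m + 1) (A ◁ f) :=
  ⟨by rw [act_succ, h.eq, lift_some]⟩

instance Evaluates.nil (n : ℕ) : Evaluates ν ν' [] n n (𝟙 _) := ⟨rfl⟩

instance Evaluates.cons (k : ℕ) (g : Gen) (w : Word) (n m l : ℕ) (f : pw A n ⟶ pw A m)
    (f' : pw A m ⟶ pw A l) [h : Acts ν ν' k g n m f] [h' : Evaluates ν ν' w m l f'] :
    Evaluates ν ν' ((k, g) :: w) n l (f ≫ f') :=
  ⟨by rw [eval, h.eq, andThen_some, h'.eq, Option.map_some]⟩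

variable {ν ν'}

/-- Transport of an equation between diagrams along coherence isomorphisms. -/
theorem Rel.transport {n : ℕ} {w w' : Word} (h : Rel ν ν' n w w') {k : ℕ}
    {f g : pw A n ⟶ pw A k} [hf : Evaluates ν ν' w n k f] [hg : Evaluates ν ν' w' n k g] {X Y : 𝒱}
    [MonoidalCoherence X (pw A n)] [MonoidalCoherence (pw A k) Y] {F G : X ⟶ Y}
    (hF : F = 𝟙 X ⊗≫ f ⊗≫ 𝟙 Y := by dsimp only [pw]; monoidal)
    (hG : G = 𝟙 X ⊗≫ g ⊗≫ 𝟙 Y := by dsimp only [pw]; monoidal) : F = G := by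
  have h0 := h 0
  rw [Nat.zero_add, hf.eq, hg.eq] at h0
  obtain rfl : f = g := by simpa using h0
  rw [hF, hG]

end

end Diagram

/-! ### Split equalizers as tensor products of bicomodules -/

section

variable {𝒱 : Type u} [Category.{v} 𝒱] [MonoidalCategory 𝒱] {C M N P : 𝒱} [ComonObj C]

/-- A tensor product of bicomodules given by a split equalizer. -/
def TensorOver.ofSplit (X : Bicomodule C M) (Y : Bicomodule C N) (i : P ⟶ M ⊗ N)
    (w : i ≫ (X.right ▷ N ≫ (α_ M C N).hom) = i ≫ M ◁ Y.left) (r : M ⊗ N ⟶ P)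
    (ir : i ≫ r = 𝟙 P) (c : M ⊗ (C ⊗ N) ⟶ M ⊗ N) (hc : M ◁ Y.left ≫ c = 𝟙 (M ⊗ N))
    (hc' : (X.right ▷ N ≫ (α_ M C N).hom) ≫ c = r ≫ i) (Z : Bicomodule C P)
    (left_incl : Z.left ≫ C ◁ i = i ≫ X.left ▷ N ≫ (α_ C M N).hom)
    (right_incl : Z.right ≫ i ▷ C = i ≫ M ◁ Y.right ≫ (α_ M N C).inv) : TensorOver X Y :=
  have hs : IsSplitEqualizer (X.right ▷ N ≫ (α_ M C N).hom) (M ◁ Y.left) i := ⟨r, c, w, ir, hc, hc'⟩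
  { obj := P
    incl := i
    w := w
    isLimit := hs.isEqualizer
    preserves := fun _ =>
      -- Split equalizers are absolute, so preservation by `Z ⊗ -` needs no further argument.
      have : HasSplitEqualizer (X.right ▷ N ≫ (α_ M C N).hom) (M ◁ Y.left) := ⟨_, _, ⟨hs⟩⟩
      inferInstance
    bicomodule := Z
    left_incl := left_incl
    right_incl := right_incl }

end

/-! ### The quantum category of a weak bimonoid -/

namespace WeakBimonoid

open Diagram Diagram.Cut

variable {𝒱 : Type u} [Category.{v} 𝒱] [MonoidalCategory 𝒱] [BraidedCategory 𝒱] {A : 𝒱} [MonObj A]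
  [ComonObj A] [WeakBimonoid A]

section

variable (C : 𝒱) [Cut C A] [hC : Fact (idem C = target A)]

instance objectMon : MonObj C where
  mul := (incl (X := C) ⊗ₘ incl (X := C)) ≫ μ[A] ≫ proj (X := C)
  one := η[A] ≫ proj (X := C)
  one_mul := by
    refine Rep.ext _ _ ?_
    simp only [idem_tensor, idem_refl, hC.out]
    -- No antipode occurs in these words; the identities `𝟙 A` are placeholders for its two labels.
    have h : Rel (𝟙 A) (𝟙 A) 1 [t 0, u 0, t 0, m 0, t 0] [t 0] :=
      (one_target ∷ one_mul ∷ target_target ∷ .nil).derive [fw 0 0 22110, fw 1 0 2110, fw 2 0 11]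
    exact h.transport
  mul_one := by
    refine Rep.ext _ _ ?_
    simp only [idem_tensor, idem_refl, hC.out]
    have h : Rel (𝟙 A) (𝟙 A) 1 [t 0, u 1, t 1, m 0, t 0] [t 0] :=
      (one_target ∷ mul_one ∷ target_target ∷ .nil).derive [fw 0 1 22211, fw 1 0 2101, fw 2 0 11]
    exact h.transport
  mul_assoc := by
    refine Rep.ext _ _ ?_
    simp only [idem_tensor, hC.out]
    have h : Rel (𝟙 A) (𝟙 A) 3 [t 0, t 1, t 2, m 0, t 0, m 0, t 0] [t 0, t 1, t 2, m 1, t 1, m 0,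
      t 0]
      :=
      (target_target_mul_target ∷ mul_assoc ∷ .nil).derive [fw 0 0 2211110, fw 1 0 211000,
        bw 0 1 222111]
    exact h.transport

instance objectComon : ComonObj C where
  comul := incl (X := C) ≫ Δ[A] ≫ (proj (X := C) ⊗ₘ proj (X := C))
  counit := incl (X := C) ≫ ε[A]
  counit_comul := by
    refine Rep.ext _ _ ?_
    simp only [hC.out]
    have h : Rel (𝟙 A) (𝟙 A) 1 [t 0, d 0, t 0, t 1, e 0] [t 0] :=
      (target_counit ∷ counit_comul ∷ target_target ∷ .nil).derive [fw 0 0 11000, fw 1 0 1210,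
        fw 2 0 11]
    exact h.transport
  comul_counit := by
    refine Rep.ext _ _ ?_
    simp only [hC.out]
    have h : Rel (𝟙 A) (𝟙 A) 1 [t 0, d 0, t 0, t 1, e 1] [t 0] :=
      (target_counit ∷ comul_counit ∷ target_target ∷ .nil).derive [fw 0 1 21100, fw 1 0 2110,
        fw 2 0 11]
    exact h.transport
  comul_assoc := by
    refine Rep.ext _ _ ?_
    simp only [hC.out]
    have h : Rel (𝟙 A) (𝟙 A) 1 [t 0, d 0, t 0, t 1, d 1, t 1, t 2] [t 0, d 0, t 0, t 1, d 0, t 0,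
      t 1]
      :=
      (comul_target_target ∷ comul_assoc ∷ .nil).derive [bw 0 1 2111100, bw 1 0 222110,
        fw 0 0 111000]
    exact h.transport

instance rep_mul : Rep μ[C] (μ[A] ≫ target A) := by
  change Rep ((incl (X := C) ⊗ₘ incl (X := C)) ≫ μ[A] ≫ proj (X := C)) _
  refine Rep.of_idem _ ?_
  simp only [idem_tensor, hC.out, id_whiskerRight, MonoidalCategory.whiskerLeft_id,
    Category.assoc, Category.id_comp, Category.comp_id]

instance rep_comul : Rep Δ[C] (Δ[A] ≫ target A ▷ A ≫ A ◁ target A) := by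
  change Rep (incl (X := C) ≫ Δ[A] ≫ (proj (X := C) ⊗ₘ proj (X := C))) _
  refine Rep.of_idem _ ?_
  simp only [hC.out, Category.id_comp]

instance rep_counit : Rep ε[C] ε[A] := by
  change Rep (incl (X := C) ≫ ε[A]) _
  refine Rep.of_idem _ ?_
  simp only [hC.out, Category.id_comp]

theorem isSeparableFrobenius_object : IsSeparableFrobenius C where
  frobenius := by
    refine Rep.ext _ _ ?_
    simp only [idem_tensor, hC.out]
    have h : Rel (𝟙 A) (𝟙 A) 2 [t 0, t 1, d 0, t 0, t 1, m 1, t 1] [t 0, t 1, d 1, t 1, t 2, m 0,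
      t 0]
      :=
      (target_mul_target ∷ frobenius_left ∷ frobenius_right ∷ target_comul_target ∷ .nil).derive
        [fw 0 1 2111000, fw 1 0 111111, bw 2 0 111111, bw 3 1 222211]
    exact h.transport
  separable := by
    refine Rep.ext _ _ ?_
    simp only [hC.out]
    have h : Rel (𝟙 A) (𝟙 A) 1 [t 0, d 0, t 0, t 1, m 0, t 0] [t 0] :=
      (target_comul_target ∷ target_comul_target_mul ∷ target_target ∷ .nil).derive [fw 0 0 221211,
        fw 1 0 21111, fw 2 0 11]
    exact h.transport

theorem source_isComonHom :
    IsComonHom (M := A) (N := coop C) (source A ≫ proj (X := C)) where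
  hom_counit := by
    change (source A ≫ proj (X := C)) ≫ ε[C] = ε[A]
    refine Rep.ext _ _ ?_
    simp only [idem_refl, hC.out]
    have h : Rel (𝟙 A) (𝟙 A) 1 [s 0, t 0, e 0] [e 0] :=
      (source_target ∷ source_counit ∷ .nil).derive [fw 0 0 211, fw 1 0 11]
    exact h.transport
  hom_comul := by
    change (source A ≫ proj (X := C)) ≫ Δ[C] ≫ (β_ C C).hom =
      Δ[A] ≫ ((source A ≫ proj (X := C)) ⊗ₘ (source A ≫ proj (X := C)))
    refine Rep.ext _ _ ?_
    simp only [idem_refl, hC.out]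
    have h : Rel (𝟙 A) (𝟙 A) 1 [s 0, t 0, d 0, t 0, t 1, c 0] [d 0, s 0, t 0, s 1, t 1] :=
      (source_target ∷ source_comul_br ∷ .nil).derive [fw 0 0 222211, fw 1 0 11111, bw 0 1 210,
        bw 0 0 1000]
    exact h.transport

theorem target_isComonHom : IsComonHom (M := A) (N := C) (proj (X := C)) where
  hom_counit := by
    refine Rep.ext _ _ ?_
    simp only [idem_refl, hC.out]
    have h : Rel (𝟙 A) (𝟙 A) 1 [t 0, e 0] [e 0] :=
      (target_counit ∷ .nil).derive [fw 0 0 11]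
    exact h.transport
  hom_comul := by
    refine Rep.ext _ _ ?_
    simp only [idem_refl, hC.out]
    have h : Rel (𝟙 A) (𝟙 A) 1 [t 0, d 0, t 0, t 1] [d 0, t 0, t 1] :=
      (comul_target_target ∷ .nil).derive [bw 0 0 1111]
    exact h.transport

theorem comul_source_target : Δ[A] ≫ ((source A ≫ proj (X := C)) ⊗ₘ proj (X := C)) ≫
    (β_ C C).hom = Δ[A] ≫ (proj (X := C) ⊗ₘ (source A ≫ proj (X := C))) := by
  refine Rep.ext _ _ ?_
  simp only [idem_refl, hC.out]
  have h : Rel (𝟙 A) (𝟙 A) 1 [d 0, s 0, t 0, t 1, c 0] [d 0, t 0, s 1, t 1] :=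
    ((endo_left_br .target) ∷ comul_source_target_br ∷ .nil).derive [fw 0 0 11000, fw 1 0 21111]
  exact h.transport

/-- The weak bimonoid as a bicomodule over the comonoid split by its target morphism. -/
def arrows : Bicomodule C A where
  left := Δ[A] ≫ A ◁ (source A ≫ proj (X := C)) ≫ (β_ C A).inv
  right := Δ[A] ≫ A ◁ proj (X := C)
  left_coassoc := by
    refine Rep.ext _ _ ?_
    simp only [idem_refl, hC.out]
    have h : Rel (𝟙 A) (𝟙 A) 1 [d 0, s 1, t 1, b 0, d 1, s 2, t 2, b 1] [d 0, s 1, t 1, b 0, d 0,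
      t 0,
      t 1] :=
      (comul_left_brInv ∷ source_target ∷ comul_assoc ∷ (endo_left_brInv .source) ∷
        (endo_left_brInv .target) ∷ brInv_left_brInv ∷ (endo_right_brInv .source) ∷
        comul_right_brInv ∷ source_comul_br ∷ br_brInv ∷ .nil).derive [bw 0 0 22211000,
        fw 1 1 222222110, fw 2 0 22222121, bw 3 1 22211000, bw 4 1 22110000, bw 5 0 11100000,
        fw 1 1 22211000, fw 6 1 2100100, fw 6 0 2221100, fw 7 0 2221110, bw 8 0 211100,
        fw 9 0 11000000, bw 6 0 222110, bw 1 1 222210]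
    exact h.transport
  left_counit := by
    refine Rep.ext _ _ ?_
    simp only [idem_refl, hC.out]
    have h : Rel (𝟙 A) (𝟙 A) 1 [d 0, s 1, t 1, b 0, e 0] [] :=
      (counit_right_brInv ∷ source_target ∷ source_counit ∷ comul_counit ∷ .nil).derive
        [bw 0 0 11000, fw 1 1 2110, fw 2 1 110, fw 3 0 11]
    exact h.transport
  right_coassoc := by
    refine Rep.ext _ _ ?_
    simp only [idem_refl, hC.out]
    have h : Rel (𝟙 A) (𝟙 A) 1 [d 0, t 1, d 0, t 1] [d 0, t 1, d 1, t 1, t 2] :=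
      (comul_assoc ∷ comul_target_target ∷ .nil).derive [fw 0 0 2121, fw 1 1 1110]
    exact h.transport
  right_counit := by
    refine Rep.ext _ _ ?_
    simp only [idem_refl, hC.out]
    have h : Rel (𝟙 A) (𝟙 A) 1 [d 0, t 1, e 1] [] :=
      (target_counit ∷ comul_counit ∷ .nil).derive [fw 0 1 110, fw 1 0 11]
    exact h.transport
  comm := by
    refine Rep.ext _ _ ?_
    simp only [idem_refl, hC.out]
    have h : Rel (𝟙 A) (𝟙 A) 1 [d 0, s 1, t 1, b 0, d 1, t 2] [d 0, t 1, d 0, s 1, t 1, b 0] :=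
      (comul_left_brInv ∷ source_target ∷ comul_assoc ∷ (endo_left_brInv .target) ∷
        comul_source_target_br ∷ br_brInv ∷ .nil).derive [bw 0 0 211000, fw 1 1 2222110,
        fw 2 0 222121, bw 3 1 211000, bw 4 1 221110, fw 5 1 2110000, bw 1 1 21000, bw 2 0 222211]
    exact h.transport

/-- Because `t s = s`, the projection to `C` can be dropped from the representative, which shortens
all later words. -/
instance rep_arrows_left : Rep (arrows C).left (Δ[A] ≫ A ◁ source A ≫ (β_ A A).inv) := by
  change Rep (Δ[A] ≫ A ◁ (source A ≫ proj (X := C)) ≫ (β_ C A).inv) _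
  refine Rep.of_idem _ ?_
  simp only [idem_refl, hC.out]
  have h : Rel (𝟙 A) (𝟙 A) 1 [d 0, s 1, t 1, b 0] [d 0, s 1, b 0] :=
    (source_target ∷ .nil).derive [fw 0 1 2110]
  exact h.transport

instance rep_arrows_right : Rep (arrows C).right (Δ[A] ≫ A ◁ target A) := by
  change Rep (Δ[A] ≫ A ◁ proj (X := C)) _
  refine Rep.of_idem _ ?_
  simp only [idem_refl, hC.out, Category.id_comp]

/-! ### Composable pairs. -/

variable (P : 𝒱) [Cut P (A ⊗ A)] [hP : Fact (idem P = middle A)]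

/-- The object of composable pairs as a bicomodule. -/
def pairs : Bicomodule C P where
  left := incl (X := P) ≫ (arrows C).left ▷ A ≫ (α_ C A A).hom ≫ C ◁ proj (X := P)
  right := incl (X := P) ≫ A ◁ (arrows C).right ≫ (α_ A A C).inv ≫ proj (X := P) ▷ C
  left_coassoc := by
    refine Rep.ext _ _ ?_
    simp only [hP.out, middle, MonoidalCategory.tensorHom_def]
    have h : Rel (𝟙 A) (𝟙 A) 2 [d 0, d 2, b 2, m 1, e 1, d 0, s 1, b 0, d 1, d 3, b 3, m 2, e 2,
      d 1,
      s 2, b 1, d 2, d 4, b 4, m 3, e 3] [d 0, d 2, b 2, m 1, e 1, d 0, s 1, b 0, d 1, d 3, b 3,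
        m 2,
      e 2, d 0, t 0, t 1] :=
      -- The idempotents slide past the coactions and merge into one, leaving coassociativity for
      -- the arrows.
      (comul_source_middle_right ∷ middle_middle ∷ comul_source_coassoc ∷ .nil).derive
        [fw 0 0 222222111111000221100, fw 0 1 111111000000000110000, fw 0 0 222111111000000110000,
        fw 1 0 222222222111111221111, fw 1 0 2222221111111111, fw 2 0 11111100000,
        bw 1 0 22222211111, bw 0 0 2221111110001100]
    exact h.transport
  left_counit := by
    refine Rep.ext _ _ ?_
    simp only [hP.out, middle, MonoidalCategory.tensorHom_def]
    have h : Rel (𝟙 A) (𝟙 A) 2 [d 0, d 2, b 2, m 1, e 1, d 0, s 1, b 0, d 1, d 3, b 3, m 2, e 2,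
      e 0]
      [d 0, d 2, b 2, m 1, e 1] :=
      (comul_source_middle_right ∷ middle_middle ∷ comul_source_counit ∷ .nil).derive
        [fw 0 0 21111110001100, fw 1 0 22221111111111, fw 2 0 111100000]
    exact h.transport
  right_coassoc := by
    refine Rep.ext _ _ ?_
    simp only [hP.out, middle, MonoidalCategory.tensorHom_def]
    have h : Rel (𝟙 A) (𝟙 A) 2 [d 0, d 2, b 2, m 1, e 1, d 1, t 2, d 0, d 2, b 2, m 1, e 1, d 1,
      t 2,
      d 0, d 2, b 2, m 1, e 1] [d 0, d 2, b 2, m 1, e 1, d 1, t 2, d 0, d 2, b 2, m 1, e 1, d 2,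
        t 2,
      t 3] :=
      (comul_target_middle_left ∷ middle_middle ∷ comul_target_coassoc ∷ .nil).derive
        [fw 0 0 2221110002222111100, fw 0 0 1110000001111000000, fw 0 0 1110000002211110000,
        fw 1 0 2221111112222221111, fw 1 0 11111122221111, fw 2 2 222111100, bw 1 0 1112222211,
        bw 0 0 111000222111100]
    exact h.transport
  right_counit := by
    refine Rep.ext _ _ ?_
    simp only [hP.out, middle, MonoidalCategory.tensorHom_def]
    have h : Rel (𝟙 A) (𝟙 A) 2 [d 0, d 2, b 2, m 1, e 1, d 1, t 2, d 0, d 2, b 2, m 1, e 1,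
      e 2] [d 0,
      d 2, b 2, m 1, e 1] :=
      (comul_target_middle_left ∷ middle_middle ∷ comul_target_counit ∷ .nil).derive
        [fw 0 0 1110001121100, fw 1 0 1111112221111, fw 2 2 22211100]
    exact h.transport
  comm := by
    refine Rep.ext _ _ ?_
    simp only [hP.out, middle, MonoidalCategory.tensorHom_def]
    have h : Rel (𝟙 A) (𝟙 A) 2 [d 0, d 2, b 2, m 1, e 1, d 0, s 1, b 0, d 1, d 3, b 3, m 2, e 2,
      d 2,
      t 3, d 1, d 3, b 3, m 2, e 2] [d 0, d 2, b 2, m 1, e 1, d 1, t 2, d 0, d 2, b 2, m 1, e 1,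
        d 0,
      s 1, b 0, d 1, d 3, b 3, m 2, e 2] :=
      (comul_source_middle_right ∷ comul_target_middle_left ∷ .nil).derive
        [fw 0 0 22211111100022221100, fw 0 0 11111100000011000000, bw 1 0 22222211100022111100,
        bw 0 0 11111100000011000000]
    exact h.transport

instance rep_pairs_left :
    Rep (pairs C P).left ((Δ[A] ≫ A ◁ source A ≫ (β_ A A).inv) ▷ A ≫ (α_ A A A).hom) := by
  change Rep (incl (X := P) ≫ (arrows C).left ▷ A ≫ (α_ C A A).hom ≫ C ◁ proj (X := P)) _
  refine Rep.of_idem _ ?_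
  simp only [hP.out, middle, MonoidalCategory.tensorHom_def]
  have h : Rel (𝟙 A) (𝟙 A) 2 [d 0, d 2, b 2, m 1, e 1, d 0, s 1, b 0, d 1, d 3, b 3, m 2, e 2] [d 0,
    d 2, b 2, m 1, e 1, d 0, s 1, b 0] :=
    (comul_source_middle_right ∷ middle_middle ∷ .nil).derive [fw 0 0 1111110001100,
      fw 1 0 2221111111111]
  exact h.transport

instance rep_pairs_right :
    Rep (pairs C P).right (A ◁ (Δ[A] ≫ A ◁ target A) ≫ (α_ A A A).inv) := by
  change Rep (incl (X := P) ≫ A ◁ (arrows C).right ≫ (α_ A A C).inv ≫ proj (X := P) ▷ C) _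
  refine Rep.of_idem _ ?_
  simp only [hP.out, middle, MonoidalCategory.tensorHom_def]
  have h : Rel (𝟙 A) (𝟙 A) 2 [d 0, d 2, b 2, m 1, e 1, d 1, t 2, d 0, d 2, b 2, m 1, e 1] [d 0, d 2,
    b 2, m 1, e 1, d 1, t 2] :=
    (comul_target_middle_left ∷ middle_middle ∷ .nil).derive [fw 0 0 111000111100,
      fw 1 0 111111221111]
  exact h.transport

/-- The morphism `(1 ⊗ ε μ ⊗ 1)(1 ⊗ 1 ⊗ c⁻¹ δ)`. -/
def contract : A ⊗ (C ⊗ A) ⟶ A ⊗ A :=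
  A ◁ (incl (X := C) ▷ A ≫ A ◁ (Δ[A] ≫ (β_ A A).inv) ≫ (α_ A A A).inv ≫
    (μ[A] ≫ ε[A]) ▷ A ≫ (λ_ A).hom)

instance rep_contract : Rep (contract (A := A) C)
    (A ◁ (A ◁ (Δ[A] ≫ (β_ A A).inv) ≫ (α_ A A A).inv ≫ (μ[A] ≫ ε[A]) ▷ A ≫ (λ_ A).hom)) := by
  change Rep (A ◁ (incl (X := C) ▷ A ≫ A ◁ (Δ[A] ≫ (β_ A A).inv) ≫ (α_ A A A).inv ≫
    (μ[A] ≫ ε[A]) ▷ A ≫ (λ_ A).hom)) _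
  refine Rep.of_idem _ ?_
  simp only [idem_tensor, idem_refl, hC.out, comp_whiskerRight, MonoidalCategory.whiskerLeft_comp,
    id_whiskerRight, MonoidalCategory.whiskerLeft_id, Category.assoc, Category.id_comp,
    Category.comp_id]

/-- The object of composable pairs as a tensor product. -/
def composable : TensorOver (arrows C) (arrows C) :=
  TensorOver.ofSplit (arrows C) (arrows C) (incl (X := P))
    (by
      refine Rep.ext _ _ ?_
      simp only [hP.out, middle, MonoidalCategory.tensorHom_def]
      have h : Rel (𝟙 A) (𝟙 A) 2 [d 0, d 2, b 2, m 1, e 1, d 0, t 1] [d 0, d 2, b 2, m 1, e 1, d 1,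
        s 2,
        b 1] :=
        (middle_target_eq_source ∷ .nil).derive [fw 0 0 1111111]
      exact h.transport )
    (proj (X := P)) incl_proj (contract C)
    (by
      refine Rep.ext _ _ ?_
      simp only [idem_tensor, idem_refl]
      have h : Rel (𝟙 A) (𝟙 A) 2 [d 1, s 2, b 1, d 2, b 2, m 1, e 1] [] :=
        (source_brInv_middle ∷ .nil).derive [fw 0 0 1111111]
      exact h.transport )
    (by
      refine Rep.ext _ _ ?_
      simp only [idem_tensor, idem_refl, hP.out, middle, MonoidalCategory.tensorHom_def]
      have h : Rel (𝟙 A) (𝟙 A) 2 [d 0, t 1, d 2, b 2, m 1, e 1] [d 0, d 2, b 2, m 1, e 1] :=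
        (middle_eq_target ∷ .nil).derive [fw 0 0 111111]
      exact h.transport )
    (pairs C P)
    (by
      refine Rep.ext _ _ ?_
      simp only [hP.out, middle, MonoidalCategory.tensorHom_def, comp_whiskerRight,
        MonoidalCategory.whiskerLeft_comp, MonoidalCategory.whiskerLeft_id, Category.assoc,
        Category.id_comp, Category.comp_id])
    (by
      refine Rep.ext _ _ ?_
      simp only [hP.out, middle, MonoidalCategory.tensorHom_def, comp_whiskerRight,
        MonoidalCategory.whiskerLeft_comp, id_whiskerRight, Category.assoc, Category.id_comp,
        Category.comp_id])

/-! ### Composable triples. -/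

section

variable (T : 𝒱) [Cut T ((A ⊗ A) ⊗ A)]
  [hT : Fact (idem T = middle A ▷ A ≫ (α_ A A A).hom ≫ A ◁ middle A ≫ (α_ A A A).inv)]

/-- The object of composable triples as a bicomodule. -/
def triples : Bicomodule C T where
  left := incl (X := T) ≫ ((arrows C).left ▷ A ≫ (α_ C A A).hom) ▷ A ≫
    (α_ C (A ⊗ A) A).hom ≫ C ◁ proj (X := T)
  right := incl (X := T) ≫ (A ⊗ A) ◁ (arrows C).right ≫ (α_ (A ⊗ A) A C).inv ≫
    proj (X := T) ▷ C
  left_coassoc := by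
    refine Rep.ext _ _ ?_
    simp only [hT.out, middle, MonoidalCategory.tensorHom_def]
    have h : Rel (𝟙 A) (𝟙 A) 3 [d 0, d 2, b 2, m 1, e 1, d 1, d 3, b 3, m 2, e 2, d 0, s 1, b 0,
      d 1,
      d 3, b 3, m 2, e 2, d 2, d 4, b 4, m 3, e 3, d 1, s 2, b 1, d 2, d 4, b 4, m 3, e 3, d 3, d 5,
      b 5, m 4, e 4] [d 0, d 2, b 2, m 1, e 1, d 1, d 3, b 3, m 2, e 2, d 0, s 1, b 0, d 1, d 3,
        b 3,
      m 2, e 2, d 2, d 4, b 4, m 3, e 3, d 0, t 0, t 1] :=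
      (comul_source_middle_right ∷ middle_comm ∷ middle_middle ∷ comul_source_coassoc ∷ .nil).derive
        [fw 0 0 222222111111000222222221100000000000, fw 0 1 111111000000000222110000000000000000,
        fw 0 0 222111111000000222110000000000000000, bw 1 0 222222222111000222222221111100222211,
        fw 2 3 222222222222222222221111110000221111, fw 2 0 2222222221111112222222211110000,
        bw 1 0 22222211100022211111002211, fw 2 3 22222222222211111100001111,
        fw 2 0 222222111111222111100, fw 3 0 1111110000000000, bw 2 0 2222221112221100,
        bw 2 3 222222222222111000011, fw 1 0 22222211100022211111002211,
        bw 0 0 22211111100022211000000000]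
    dsimp only at h
    set_option synthInstance.maxSize 1024 in
    exact h.transport
  left_counit := by
    refine Rep.ext _ _ ?_
    simp only [hT.out, middle, MonoidalCategory.tensorHom_def]
    have h : Rel (𝟙 A) (𝟙 A) 3 [d 0, d 2, b 2, m 1, e 1, d 1, d 3, b 3, m 2, e 2, d 0, s 1, b 0,
      d 1,
      d 3, b 3, m 2, e 2, d 2, d 4, b 4, m 3, e 3, e 0] [d 0, d 2, b 2, m 1, e 1, d 1, d 3, b 3,
        m 2,
      e 2] :=
      (comul_source_middle_right ∷ middle_comm ∷ middle_middle ∷ comul_source_counit ∷ .nil).derive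
        [fw 0 0 211111100022211000000000, bw 1 0 222211100022211111002211,
        fw 2 3 222222222211111100001111, fw 2 0 2222111111222111100, fw 3 0 11110000000000]
    exact h.transport
  right_coassoc := by
    refine Rep.ext _ _ ?_
    simp only [hT.out, middle, MonoidalCategory.tensorHom_def]
    have h : Rel (𝟙 A) (𝟙 A) 3 [d 0, d 2, b 2, m 1, e 1, d 1, d 3, b 3, m 2, e 2, d 2, t 3, d 0,
      d 2,
      b 2, m 1, e 1, d 1, d 3, b 3, m 2, e 2, d 2, t 3, d 0, d 2, b 2, m 1, e 1, d 1, d 3, b 3, m 2,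
      e 2] [d 0, d 2, b 2, m 1, e 1, d 1, d 3, b 3, m 2, e 2, d 2, t 3, d 0, d 2, b 2, m 1, e 1,
        d 1,
      d 3, b 3, m 2, e 2, d 3, t 3, t 4] :=
      (comul_target_middle_left ∷ middle_comm ∷ middle_middle ∷ comul_target_coassoc ∷ .nil).derive
        [fw 0 3 2222222222222211100000002222111100, fw 0 4 2222222221110000000000001111000000,
        fw 0 4 2222222221110000000000002211110000, bw 1 0 2221110002222222211111002222222211,
        fw 2 3 2222222222222211111100002222221111, fw 2 0 22211111122222222111100000000,
        bw 1 0 111000222111110022222211, fw 2 3 222222111111000022221111,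
        fw 2 0 1111112221111000000, fw 3 3 22222222111100, bw 2 0 111222110000000,
        bw 2 3 22222211100002222211, fw 1 0 1110002221111100222222211,
        bw 0 3 2222221110000000222111100]
    dsimp only at h
    set_option synthInstance.maxSize 1024 in
    exact h.transport
  right_counit := by
    refine Rep.ext _ _ ?_
    simp only [hT.out, middle, MonoidalCategory.tensorHom_def]
    have h : Rel (𝟙 A) (𝟙 A) 3 [d 0, d 2, b 2, m 1, e 1, d 1, d 3, b 3, m 2, e 2, d 2, t 3, d 0,
      d 2,
      b 2, m 1, e 1, d 1, d 3, b 3, m 2, e 2, e 3] [d 0, d 2, b 2, m 1, e 1, d 1, d 3, b 3, m 2,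
        e 2] :=
      (comul_target_middle_left ∷ middle_comm ∷ middle_middle ∷ comul_target_counit ∷ .nil).derive
        [fw 0 3 22222211100000001121100, bw 1 0 11100022211111002222211,
        fw 2 3 22222211111100002221111, fw 2 0 111111222111100000, fw 3 3 2222222211100]
    exact h.transport
  comm := by
    refine Rep.ext _ _ ?_
    simp only [hT.out, middle, MonoidalCategory.tensorHom_def]
    have h : Rel (𝟙 A) (𝟙 A) 3 [d 0, d 2, b 2, m 1, e 1, d 1, d 3, b 3, m 2, e 2, d 0, s 1, b 0,
      d 1,
      d 3, b 3, m 2, e 2, d 2, d 4, b 4, m 3, e 3, d 3, t 4, d 1, d 3, b 3, m 2, e 2, d 2, d 4, b 4,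
      m 3, e 3] [d 0, d 2, b 2, m 1, e 1, d 1, d 3, b 3, m 2, e 2, d 2, t 3, d 0, d 2, b 2, m 1,
        e 1,
      d 1, d 3, b 3, m 2, e 2, d 0, s 1, b 0, d 1, d 3, b 3, m 2, e 2, d 2, d 4, b 4, m 3, e 3] :=
      (comul_source_middle_right ∷ comul_target_middle_left ∷ .nil).derive
        [fw 0 0 22211111100022222222110000000000000, fw 0 0 11111100000022211000000000000000000,
        bw 1 3 22222222222222222111000000022111100, bw 0 0 11111100000022211000000000000000000]
    dsimp only at h
    set_option synthInstance.maxSize 1024 in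
    exact h.transport

instance rep_triples_left : Rep (triples C T).left
    (((Δ[A] ≫ A ◁ source A ≫ (β_ A A).inv) ▷ A ≫ (α_ A A A).hom) ▷ A ≫
      (α_ A (A ⊗ A) A).hom) := by
  change Rep (incl (X := T) ≫ ((arrows C).left ▷ A ≫ (α_ C A A).hom) ▷ A ≫
    (α_ C (A ⊗ A) A).hom ≫ C ◁ proj (X := T)) _
  refine Rep.of_idem _ ?_
  simp only [hT.out, middle, MonoidalCategory.tensorHom_def]
  have h : Rel (𝟙 A) (𝟙 A) 3 [d 0, d 2, b 2, m 1, e 1, d 1, d 3, b 3, m 2, e 2, d 0, s 1, b 0, d 1,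
    d 3, b 3, m 2, e 2, d 2, d 4, b 4, m 3, e 3] [d 0, d 2, b 2, m 1, e 1, d 1, d 3, b 3, m 2, e 2,
    d 0, s 1, b 0] :=
    (comul_source_middle_right ∷ middle_comm ∷ middle_middle ∷ .nil).derive
      [fw 0 0 11111100022211000000000, bw 1 0 22211100022211111002211,
      fw 2 3 22222222211111100001111, fw 2 0 222111111222111100]
  exact h.transport

instance rep_triples_right : Rep (triples C T).right
    ((A ⊗ A) ◁ (Δ[A] ≫ A ◁ target A) ≫ (α_ (A ⊗ A) A A).inv) := by
  change Rep (incl (X := T) ≫ (A ⊗ A) ◁ (arrows C).right ≫ (α_ (A ⊗ A) A C).inv ≫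
    proj (X := T) ▷ C) _
  refine Rep.of_idem _ ?_
  simp only [hT.out, middle, MonoidalCategory.tensorHom_def]
  have h : Rel (𝟙 A) (𝟙 A) 3 [d 0, d 2, b 2, m 1, e 1, d 1, d 3, b 3, m 2, e 2, d 2, t 3, d 0, d 2,
    b 2, m 1, e 1, d 1, d 3, b 3, m 2, e 2] [d 0, d 2, b 2, m 1, e 1, d 1, d 3, b 3, m 2, e 2, d 2,
    t 3] :=
    (comul_target_middle_left ∷ middle_comm ∷ middle_middle ∷ .nil).derive
      [fw 0 3 2222221110000000111100, bw 1 0 1110002221111100222211,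
      fw 2 3 2222221111110000221111, fw 2 0 11111122211110000]
  exact h.transport

/-- The object of composable triples as a tensor product of pairs and arrows. -/
def triplesLeft : TensorOver (pairs C P) (arrows C) :=
  TensorOver.ofSplit (pairs C P) (arrows C) (incl (X := T) ≫ proj (X := P) ▷ A)
    (by
      refine Rep.ext _ _ ?_
      simp only [hP.out, hT.out, middle, MonoidalCategory.tensorHom_def]
      have h : Rel (𝟙 A) (𝟙 A) 3 [d 0, d 2, b 2, m 1, e 1, d 1, d 3, b 3, m 2, e 2, d 0, d 2, b 2,
        m 1,
        e 1, d 1, t 2] [d 0, d 2, b 2, m 1, e 1, d 1, d 3, b 3, m 2, e 2, d 0, d 2, b 2, m 1, e 1,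
          d 2,
        s 3, b 2] :=
        (middle_comm ∷ middle_middle ∷ middle_target_eq_source ∷ .nil).derive
          [bw 0 0 11100022111110011, fw 1 0 11111122222111100, fw 2 2 222111110011,
          bw 1 0 1112221100000, fw 0 0 111000111110022211]
      exact h.transport )
    (incl (X := P) ▷ A ≫ proj (X := T))
    (by
      refine Rep.ext _ _ ?_
      simp only [hP.out, hT.out, middle, MonoidalCategory.tensorHom_def]
      have h : Rel (𝟙 A) (𝟙 A) 3 [d 0, d 2, b 2, m 1, e 1, d 1, d 3, b 3, m 2, e 2, d 0, d 2, b 2,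
        m 1,
        e 1, d 0, d 2, b 2, m 1, e 1, d 1, d 3, b 3, m 2, e 2] [d 0, d 2, b 2, m 1, e 1, d 1, d 3,
          b 3,
        m 2, e 2] :=
        (middle_middle ∷ middle_comm ∷ .nil).derive [fw 0 0 1111110002221111000000000,
          bw 1 0 11100022211111002211, fw 0 3 22222211111100001111, fw 0 0 111111222111100]
      exact h.transport )
    -- The contraction for pairs of arrows is applied to the last three factors; the idempotent on
    -- the first two commutes with the coaction being contracted.
    (incl (X := P) ▷ (C ⊗ A) ≫ (α_ A A (C ⊗ A)).hom ≫ A ◁ contract C ≫ (α_ A A A).inv ≫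
      proj (X := P) ▷ A)
    (by
      refine Rep.ext _ _ ?_
      simp only [idem_tensor, idem_refl, hP.out, middle, MonoidalCategory.tensorHom_def]
      have h : Rel (𝟙 A) (𝟙 A) 3 [d 0, d 2, b 2, m 1, e 1, d 2, s 3, b 2, d 3, b 3, m 2, e 2, d 0,
        d 2,
        b 2, m 1, e 1] [d 0, d 2, b 2, m 1, e 1] :=
        (middle_middle ∷ source_brInv_middle ∷ .nil).derive [fw 0 0 11111111110000000,
          fw 1 1 222221111111]
      exact h.transport )
    (by
      refine Rep.ext _ _ ?_
      simp only [idem_tensor, idem_refl, hP.out, hT.out, middle, MonoidalCategory.tensorHom_def]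
      have h : Rel (𝟙 A) (𝟙 A) 3 [d 0, d 2, b 2, m 1, e 1, d 1, t 2, d 3, b 3, m 2, e 2, d 0, d 2,
        b 2,
        m 1, e 1] [d 0, d 2, b 2, m 1, e 1, d 0, d 2, b 2, m 1, e 1, d 1, d 3, b 3, m 2, e 2, d 0,
          d 2,
        b 2, m 1, e 1] :=
        (comul_target_middle_left ∷ middle_middle ∷ middle_eq_target ∷ middle_comm ∷ .nil).derive
          [fw 0 0 1110001122110000, fw 1 0 1111112222111100, fw 2 2 22211110011, bw 1 0 1112221100,
          fw 3 0 111000111110011, bw 1 0 222111222221100]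
      exact h.transport )
    (triples C T)
    (by
      refine Rep.ext _ _ ?_
      simp only [hP.out, hT.out, middle, MonoidalCategory.tensorHom_def]
      have h : Rel (𝟙 A) (𝟙 A) 3 [d 0, d 2, b 2, m 1, e 1, d 1, d 3, b 3, m 2, e 2, d 0, s 1, b 0,
        d 1,
        d 3, b 3, m 2, e 2] [d 0, d 2, b 2, m 1, e 1, d 1, d 3, b 3, m 2, e 2, d 0, d 2, b 2, m 1,
          e 1,
        d 0, s 1, b 0] :=
        (comul_source_middle_right ∷ .nil).derive [fw 0 0 111111000110000000]
      exact h.transport )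
    (by
      refine Rep.ext _ _ ?_
      simp only [hP.out, hT.out, middle, MonoidalCategory.tensorHom_def]
      have h : Rel (𝟙 A) (𝟙 A) 3 [d 0, d 2, b 2, m 1, e 1, d 1, d 3, b 3, m 2, e 2, d 2, t 3, d 0,
        d 2,
        b 2, m 1, e 1] [d 0, d 2, b 2, m 1, e 1, d 1, d 3, b 3, m 2, e 2, d 0, d 2, b 2, m 1, e 1,
          d 2,
        t 3] :=
        Known.nil.derive []
      exact h.transport )

/-- The object of composable triples as a tensor product of arrows and pairs. -/
def triplesRight : TensorOver (arrows C) (pairs C P) :=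
  TensorOver.ofSplit (arrows C) (pairs C P)
    (incl (X := T) ≫ (α_ A A A).hom ≫ A ◁ proj (X := P))
    (by
      refine Rep.ext _ _ ?_
      simp only [hP.out, hT.out, middle, MonoidalCategory.tensorHom_def]
      have h : Rel (𝟙 A) (𝟙 A) 3 [d 0, d 2, b 2, m 1, e 1, d 1, d 3, b 3, m 2, e 2, d 1, d 3, b 3,
        m 2,
        e 2, d 0, t 1] [d 0, d 2, b 2, m 1, e 1, d 1, d 3, b 3, m 2, e 2, d 1, d 3, b 3, m 2, e 2,
          d 1,
        s 2, b 1] :=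
        (middle_middle ∷ middle_target_eq_source ∷ comul_source_middle_right ∷ .nil).derive
          [fw 0 2 22222111111001111, fw 1 0 111112221100, fw 2 2 2221111110011,
            bw 0 2 2222221110011]
      exact h.transport )
    (A ◁ incl (X := P) ≫ (α_ A A A).inv ≫ proj (X := T))
    (by
      refine Rep.ext _ _ ?_
      simp only [hP.out, hT.out, middle, MonoidalCategory.tensorHom_def]
      have h : Rel (𝟙 A) (𝟙 A) 3 [d 0, d 2, b 2, m 1, e 1, d 1, d 3, b 3, m 2, e 2, d 1, d 3, b 3,
        m 2,
        e 2, d 0, d 2, b 2, m 1, e 1, d 1, d 3, b 3, m 2, e 2] [d 0, d 2, b 2, m 1, e 1, d 1, d 3,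
          b 3,
        m 2, e 2] :=
        (middle_middle ∷ middle_comm ∷ .nil).derive [fw 0 2 2222222222211111100221111,
          bw 1 0 11100022211111002211, fw 0 3 22222211111100001111, fw 0 0 111111222111100]
      exact h.transport )
    (A ◁ C ◁ incl (X := P) ≫ A ◁ (α_ C A A).inv ≫ (α_ A (C ⊗ A) A).inv ≫ contract C ▷ A ≫
      (α_ A A A).hom ≫ A ◁ proj (X := P))
    (by
      refine Rep.ext _ _ ?_
      simp only [idem_tensor, idem_refl, hP.out, middle, MonoidalCategory.tensorHom_def]
      have h : Rel (𝟙 A) (𝟙 A) 3 [d 1, d 3, b 3, m 2, e 2, d 1, s 2, b 1, d 2, b 2, m 1, e 1, d 1,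
        d 3,
        b 3, m 2, e 2] [d 1, d 3, b 3, m 2, e 2] :=
        (source_brInv_middle ∷ middle_middle ∷ .nil).derive [fw 0 0 11222111110000000,
          fw 1 1 1111111111]
      exact h.transport )
    (by
      refine Rep.ext _ _ ?_
      simp only [idem_tensor, idem_refl, hP.out, hT.out, middle, MonoidalCategory.tensorHom_def]
      have h : Rel (𝟙 A) (𝟙 A) 3 [d 1, d 3, b 3, m 2, e 2, d 0, t 1, d 2, b 2, m 1, e 1, d 1, d 3,
        b 3,
        m 2, e 2] [d 1, d 3, b 3, m 2, e 2, d 0, d 2, b 2, m 1, e 1, d 1, d 3, b 3, m 2, e 2, d 1,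
          d 3,
        b 3, m 2, e 2] :=
        (middle_eq_target ∷ middle_middle ∷ .nil).derive [fw 0 0 1111222110000000,
          bw 1 2 222111000001100]
      exact h.transport )
    (triples C T)
    (by
      refine Rep.ext _ _ ?_
      simp only [hP.out, hT.out, middle, MonoidalCategory.tensorHom_def]
      have h : Rel (𝟙 A) (𝟙 A) 3 [d 0, d 2, b 2, m 1, e 1, d 1, d 3, b 3, m 2, e 2, d 0, s 1, b 0,
        d 2,
        d 4, b 4, m 3, e 3] [d 0, d 2, b 2, m 1, e 1, d 1, d 3, b 3, m 2, e 2, d 1, d 3, b 3, m 2,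
          e 2,
        d 0, s 1, b 0] :=
        Known.nil.derive []
      exact h.transport )
    (by
      refine Rep.ext _ _ ?_
      simp only [hP.out, hT.out, middle, MonoidalCategory.tensorHom_def]
      have h : Rel (𝟙 A) (𝟙 A) 3 [d 0, d 2, b 2, m 1, e 1, d 1, d 3, b 3, m 2, e 2, d 2, t 3, d 1,
        d 3,
        b 3, m 2, e 2] [d 0, d 2, b 2, m 1, e 1, d 1, d 3, b 3, m 2, e 2, d 1, d 3, b 3, m 2, e 2,
          d 2,
        t 3] :=
        (comul_target_middle_left ∷ .nil).derive [fw 0 2 22211100000111100]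
      exact h.transport )

end

/-! ### The monoid in bicomodules. -/

theorem isMonoidOver (T : 𝒱) [Cut T ((A ⊗ A) ⊗ A)]
    [hT : Fact (idem T = middle A ▷ A ≫ (α_ A A A).hom ≫ A ◁ middle A ≫ (α_ A A A).inv)] :
    IsMonoidOver (arrows C) (composable C P) (incl (X := P) ≫ μ[A]) (incl (X := C)) where
  mul_hom :=
    { left := by
        change (incl (X := P) ≫ μ[A]) ≫ (arrows C).left =
          (pairs C P).left ≫ C ◁ (incl (X := P) ≫ μ[A])
        refine Rep.ext _ _ ?_
        simp only [hP.out, middle, MonoidalCategory.tensorHom_def]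
        have h : Rel (𝟙 A) (𝟙 A) 2 [d 0, d 2, b 2, m 1, e 1, m 0, d 0, s 1, b 0] [d 0, d 2, b 2,
          m 1, e 1,
          d 0, s 1, b 0, m 1] :=
          (middle_mul_source ∷ .nil).derive [fw 0 0 111111111]
        exact h.transport
      right := by
        change (incl (X := P) ≫ μ[A]) ≫ (arrows C).right =
          (pairs C P).right ≫ (incl (X := P) ≫ μ[A]) ▷ C
        refine Rep.ext _ _ ?_
        simp only [hP.out, middle, MonoidalCategory.tensorHom_def]
        have h : Rel (𝟙 A) (𝟙 A) 2 [d 0, d 2, b 2, m 1, e 1, m 0, d 0, t 1] [d 0, d 2, b 2, m 1,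
          e 1, d 1,
          t 2, m 0] :=
          (middle_mul_target ∷ .nil).derive [fw 0 0 11111111]
        exact h.transport }
  one_hom :=
    { left := by
        change incl (X := C) ≫ (arrows C).left = Δ[C] ≫ C ◁ incl (X := C)
        refine Rep.ext _ _ ?_
        simp only [hC.out]
        have h : Rel (𝟙 A) (𝟙 A) 1 [t 0, d 0, s 1, b 0] [t 0, d 0, t 0, t 1] :=
          (target_comul_eq_source ∷ .nil).derive [bw 0 0 1111]
        exact h.transport
      right := by
        change incl (X := C) ≫ (arrows C).right = Δ[C] ≫ incl (X := C) ▷ C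
        refine Rep.ext _ _ ?_
        simp only [hC.out]
        have h : Rel (𝟙 A) (𝟙 A) 1 [t 0, d 0, t 1] [t 0, d 0, t 0, t 1] :=
          (target_comul_eq_target ∷ .nil).derive [bw 0 0 111]
        exact h.transport }
  one_mul := by
    -- Inserting an identity already lands in composable pairs, by `comul_source_middle`, so the
    -- projection changes nothing.
    refine ⟨((arrows C).left ≫ incl (X := C) ▷ A) ≫ proj (X := P), ?_, ?_⟩
    · change (((arrows C).left ≫ incl (X := C) ▷ A) ≫ proj (X := P)) ≫ incl (X := P) = _
      refine Rep.ext _ _ ?_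
      simp only [idem_refl, hP.out, middle, MonoidalCategory.tensorHom_def]
      have h : Rel (𝟙 A) (𝟙 A) 1 [d 0, s 1, b 0, d 0, d 2, b 2, m 1, e 1] [d 0, s 1, b 0] :=
        (comul_source_middle ∷ .nil).derive [fw 0 0 11111111]
      exact h.transport
    · change (((arrows C).left ≫ incl (X := C) ▷ A) ≫ proj (X := P)) ≫ incl (X := P) ≫ μ[A] = _
      refine Rep.ext _ _ ?_
      simp only [idem_refl, hP.out, middle, MonoidalCategory.tensorHom_def]
      have h : Rel (𝟙 A) (𝟙 A) 1 [d 0, s 1, b 0, d 0, d 2, b 2, m 1, e 1, m 0] [] :=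
        (comul_source_middle ∷ comul_source_brInv_mul ∷ .nil).derive [fw 0 0 211111111, fw 1 0 1111]
      exact h.transport
  mul_one := by
    refine ⟨((arrows C).right ≫ A ◁ incl (X := C)) ≫ proj (X := P), ?_, ?_⟩
    · change (((arrows C).right ≫ A ◁ incl (X := C)) ≫ proj (X := P)) ≫ incl (X := P) = _
      refine Rep.ext _ _ ?_
      simp only [idem_refl, hP.out, middle, MonoidalCategory.tensorHom_def]
      have h : Rel (𝟙 A) (𝟙 A) 1 [d 0, t 1, d 0, d 2, b 2, m 1, e 1] [d 0, t 1] :=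
        (comul_target_middle ∷ .nil).derive [fw 0 0 1111111]
      exact h.transport
    · change (((arrows C).right ≫ A ◁ incl (X := C)) ≫ proj (X := P)) ≫ incl (X := P) ≫ μ[A] = _
      refine Rep.ext _ _ ?_
      simp only [idem_refl, hP.out, middle, MonoidalCategory.tensorHom_def]
      have h : Rel (𝟙 A) (𝟙 A) 1 [d 0, t 1, d 0, d 2, b 2, m 1, e 1, m 0] [] :=
        (comul_target_middle ∷ comul_target_mul ∷ .nil).derive [fw 0 0 21111111, fw 1 0 111]
      exact h.transport
  assoc := by
    -- Both iterated tensor products are carried by the same object `T`, so the associativity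
    -- isomorphism is the identity.
    refine ⟨triplesLeft C P T, triplesRight C P T, Iso.refl T,
      (incl (X := T) ≫ μ[A] ▷ A) ≫ proj (X := P),
      (incl (X := T) ≫ (α_ A A A).hom ≫ A ◁ μ[A]) ≫ proj (X := P), ?_, ?_, ?_, ?_⟩
    · change 𝟙 T ≫ (incl (X := T) ≫ (α_ A A A).hom ≫ A ◁ proj (X := P)) ≫ A ◁ incl (X := P) =
        (incl (X := T) ≫ proj (X := P) ▷ A) ≫ incl (X := P) ▷ A ≫ (α_ A A A).hom
      refine Rep.ext _ _ ?_
      simp only [hP.out, hT.out, middle, MonoidalCategory.tensorHom_def]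
      have h : Rel (𝟙 A) (𝟙 A) 3 [d 0, d 2, b 2, m 1, e 1, d 1, d 3, b 3, m 2, e 2, d 1, d 3, b 3,
        m 2,
        e 2] [d 0, d 2, b 2, m 1, e 1, d 1, d 3, b 3, m 2, e 2, d 0, d 2, b 2, m 1, e 1] :=
        (middle_middle ∷ middle_comm ∷ .nil).derive [fw 0 2 222111111001111, bw 0 0 1112221100,
          fw 1 0 111000111110011]
      exact h.transport
    · change ((incl (X := T) ≫ μ[A] ▷ A) ≫ proj (X := P)) ≫ incl (X := P) =
        (incl (X := T) ≫ proj (X := P) ▷ A) ≫ (incl (X := P) ≫ μ[A]) ▷ A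
      refine Rep.ext _ _ ?_
      simp only [hP.out, hT.out, middle, MonoidalCategory.tensorHom_def]
      have h : Rel (𝟙 A) (𝟙 A) 3 [d 0, d 2, b 2, m 1, e 1, d 1, d 3, b 3, m 2, e 2, m 0, d 0, d 2,
        b 2,
        m 1, e 1] [d 0, d 2, b 2, m 1, e 1, d 1, d 3, b 3, m 2, e 2, d 0, d 2, b 2, m 1, e 1,
          m 0] :=
        (mul_middle_left ∷ middle_middle ∷ middle_comm ∷ .nil).derive [bw 0 0 2221111111112211,
          fw 1 0 1111110000001111, fw 0 0 11111111111, bw 1 0 21112221100, fw 2 0 2111000111110011]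
      exact h.transport
    · change ((incl (X := T) ≫ (α_ A A A).hom ≫ A ◁ μ[A]) ≫ proj (X := P)) ≫ incl (X := P) =
        (incl (X := T) ≫ (α_ A A A).hom ≫ A ◁ proj (X := P)) ≫ A ◁ (incl (X := P) ≫ μ[A])
      refine Rep.ext _ _ ?_
      simp only [hP.out, hT.out, middle, MonoidalCategory.tensorHom_def]
      have h : Rel (𝟙 A) (𝟙 A) 3 [d 0, d 2, b 2, m 1, e 1, d 1, d 3, b 3, m 2, e 2, m 1, d 0, d 2,
        b 2,
        m 1, e 1] [d 0, d 2, b 2, m 1, e 1, d 1, d 3, b 3, m 2, e 2, d 1, d 3, b 3, m 2, e 2,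
          m 1] :=
        (mul_middle_right ∷ middle_comm ∷ middle_middle ∷ .nil).derive [fw 0 0 1110001111110011,
          bw 1 0 1110002111110011, fw 2 0 1111112222111100, bw 2 2 22221110011]
      exact h.transport
    · change ((incl (X := T) ≫ μ[A] ▷ A) ≫ proj (X := P)) ≫ incl (X := P) ≫ μ[A] =
        𝟙 T ≫ ((incl (X := T) ≫ (α_ A A A).hom ≫ A ◁ μ[A]) ≫ proj (X := P)) ≫
          incl (X := P) ≫ μ[A]
      refine Rep.ext _ _ ?_
      simp only [hP.out, hT.out, middle, MonoidalCategory.tensorHom_def]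
      have h : Rel (𝟙 A) (𝟙 A) 3 [d 0, d 2, b 2, m 1, e 1, d 1, d 3, b 3, m 2, e 2, m 0, d 0, d 2,
        b 2,
        m 1, e 1, m 0] [d 0, d 2, b 2, m 1, e 1, d 1, d 3, b 3, m 2, e 2, m 1, d 0, d 2, b 2, m 1,
          e 1,
        m 0] :=
        (middle_mul ∷ mul_assoc ∷ .nil).derive [fw 0 0 11110000000001100, fw 1 0 110000000000,
          fw 0 2 222211110011, bw 0 0 1000000, bw 0 2 222222222100]
      exact h.transport

/-- The left coaction of `A ⊗ A` on composable pairs. -/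
def leftCoaction : P ⟶ (A ⊗ A) ⊗ P :=
  incl (X := P) ≫ (Δ[A] ⊗ₘ Δ[A]) ≫ tensorμ A A A A ≫ (A ⊗ A) ◁ proj (X := P)

instance rep_leftCoaction :
    Rep (leftCoaction P) ((Δ[A] ⊗ₘ Δ[A]) ≫ tensorμ A A A A) := by
  rw [tensorμ]
  change Rep (incl (X := P) ≫ (Δ[A] ⊗ₘ Δ[A]) ≫ tensorμ A A A A ≫ (A ⊗ A) ◁ proj (X := P)) _
  rw [tensorμ]
  refine Rep.of_idem _ ?_
  simp only [hP.out, middle, MonoidalCategory.tensorHom_def]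
  have h : Rel (𝟙 A) (𝟙 A) 2 [d 0, d 2, b 2, m 1, e 1, d 0, d 2, c 1, d 2, d 4, b 4, m 3, e 3] [d 0,
    d 2, b 2, m 1, e 1, d 0, d 2, c 1] :=
    (comul_comul_middle ∷ middle_middle ∷ .nil).derive [fw 0 0 1111100011100,
      fw 1 0 2211111121111]
  exact h.transport

/-- The right coaction of `A` on composable pairs. -/
def rightCoaction : P ⟶ P ⊗ A :=
  (leftCoaction P ≫ (A ⊗ A) ◁ (incl (X := P) ≫ μ[A])) ≫ proj (X := P) ▷ A

instance rep_rightCoaction :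
    Rep (rightCoaction P) ((Δ[A] ⊗ₘ Δ[A]) ≫ tensorμ A A A A ≫ (A ⊗ A) ◁ μ[A]) := by
  rw [tensorμ]
  change Rep ((leftCoaction P ≫ (A ⊗ A) ◁ (incl (X := P) ≫ μ[A])) ≫ proj (X := P) ▷ A) _
  refine Rep.of_idem _ ?_
  simp only [hP.out, middle, tensorμ, MonoidalCategory.tensorHom_def]
  have h : Rel (𝟙 A) (𝟙 A) 2 [d 0, d 2, b 2, m 1, e 1, d 0, d 2, c 1, m 2, d 0, d 2, b 2, m 1, e 1]
    [d 0, d 2, b 2, m 1, e 1, d 0, d 2, c 1, m 2] :=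
    (comul_comul_mul_middle ∷ .nil).derive [fw 0 0 11111111000100]
  exact h.transport

/-! ### The quantum category and its groupoid structure. -/

variable (T : 𝒱) [Cut T ((A ⊗ A) ⊗ A)]
  [hT : Fact (idem T = middle A ▷ A ≫ (α_ A A A).hom ≫ A ◁ middle A ≫ (α_ A A A).inv)]

/-- The quantum category of a weak bimonoid. -/
def quantumCategory : QuantumCategory A C where
  s := source A ≫ proj (X := C)
  t := proj (X := C)
  s_hom := source_isComonHom C
  t_hom := target_isComonHom C
  source_target := comul_source_target C
  bicomodule := arrows C
  bicomodule_left := rfl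
  bicomodule_right := rfl
  P := composable C P
  δl := leftCoaction P
  δl_incl := by
    change leftCoaction P ≫ (A ⊗ A) ◁ incl (X := P) =
      incl (X := P) ≫ (Δ[A] ⊗ₘ Δ[A]) ≫ tensorμ A A A A
    rw [tensorμ]
    refine Rep.ext _ _ ?_
    simp only [hP.out, middle, tensorμ, MonoidalCategory.tensorHom_def, comp_whiskerRight,
      MonoidalCategory.whiskerLeft_comp, MonoidalCategory.whiskerLeft_id, Category.assoc,
      Category.id_comp, Category.comp_id]
  comp := incl (X := P) ≫ μ[A]
  id := incl (X := C)
  monoid := isMonoidOver C P T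
  comp_source_target := by
    change leftCoaction P ≫ ((proj (X := C) ⊗ₘ ε[A]) ≫ (ρ_ C).hom) ▷ P ≫
        C ◁ (incl (X := P) ≫ μ[A]) =
      leftCoaction P ≫ ((ε[A] ⊗ₘ (source A ≫ proj (X := C))) ≫ (λ_ C).hom) ▷ P ≫
        C ◁ (incl (X := P) ≫ μ[A])
    refine Rep.ext _ _ ?_
    simp only [hC.out, hP.out, middle, tensorμ, MonoidalCategory.tensorHom_def]
    have h : Rel (𝟙 A) (𝟙 A) 2 [d 0, d 2, b 2, m 1, e 1, d 0, d 2, c 1, t 0, e 1, m 1] [d 0, d 2,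
      b 2,
      m 1, e 1, d 0, d 2, c 1, e 0, s 0, t 0, m 1] :=
      -- Once the counits are cancelled, this is `t a₁ ⊗ a₂ b = s b₁ ⊗ a b₂`.
      (comul_assoc ∷ counit_right_br ∷ counit_comul ∷ comul_target_mul_right ∷
        (endo_right_br .source) ∷ source_target ∷ (endo_right_br .target) ∷ .nil).derive
        [fw 0 0 22221221000, bw 1 1 21210000000, fw 2 2 2222221100, bw 0 0 22221100,
        fw 3 0 11100000, bw 4 0 121000000, bw 5 2 222221000, fw 6 0 2100010000, fw 4 0 2210001000,
        bw 2 0 2222000000]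
    exact h.transport
  δr := rightCoaction P
  δr_incl := by
    change rightCoaction P ≫ incl (X := P) ▷ A =
      leftCoaction P ≫ (A ⊗ A) ◁ (incl (X := P) ≫ μ[A])
    refine Rep.ext _ _ ?_
    simp only [hP.out, middle, tensorμ, MonoidalCategory.tensorHom_def, comp_whiskerRight,
      MonoidalCategory.whiskerLeft_comp, id_whiskerRight, Category.assoc, Category.id_comp,
      Category.comp_id]
  comp_comul := by
    change (incl (X := P) ≫ μ[A]) ≫ Δ[A] = rightCoaction P ≫ (incl (X := P) ≫ μ[A]) ▷ A
    refine Rep.ext _ _ ?_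
    simp only [hP.out, middle, tensorμ, MonoidalCategory.tensorHom_def]
    have h : Rel (𝟙 A) (𝟙 A) 2 [d 0, d 2, b 2, m 1, e 1, m 0, d 0] [d 0, d 2, b 2, m 1, e 1, d 0,
      d 2,
      c 1, m 2, m 0] :=
      (comul_comul_mul_mul ∷ .nil).derive [bw 0 0 1100000]
    exact h.transport
  comp_counit := by
    change (incl (X := P) ≫ μ[A]) ≫ ε[A] =
      incl (X := P) ≫ (ε[A] ⊗ₘ ε[A]) ≫ (λ_ (𝟙_ 𝒱)).hom
    refine Rep.ext _ _ ?_
    simp only [hP.out, middle, MonoidalCategory.tensorHom_def]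
    have h : Rel (𝟙 A) (𝟙 A) 2 [d 0, d 2, b 2, m 1, e 1, m 0, e 0] [d 0, d 2, b 2, m 1, e 1, e 0,
      e 0]
      :=
      (middle_mul ∷ counit_comul ∷ counit_left_brInv ∷ .nil).derive [fw 0 0 2111111, bw 1 1 22,
        fw 2 1 2210, bw 1 0 22000]
    exact h.transport
  id_counit := by
    refine Rep.ext _ _ ?_
    simp only [hC.out, Category.id_comp]
  id_comul_source := by
    refine Rep.ext _ _ ?_
    simp only [hC.out]
    have h : Rel (𝟙 A) (𝟙 A) 1 [t 0, d 0, s 0, t 0] [t 0, d 0] :=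
      (source_target ∷ target_comul_source ∷ .nil).derive [fw 0 0 1100, fw 1 0 111]
    exact h.transport
  id_comul_target := by
    refine Rep.ext _ _ ?_
    simp only [hC.out]
    have h : Rel (𝟙 A) (𝟙 A) 1 [t 0, d 0, t 0] [t 0, d 0] :=
      (target_comul_target ∷ .nil).derive [fw 0 0 111]
    exact h.transport

/-- The automorphism of the object of composable pairs induced by an invertible antipode. -/
def twistIso (ν : A ≅ A) (hν : IsAntipode ν.hom) : P ≅ P where
  hom := incl (X := P) ≫ twist ν.hom ≫ proj (X := P)
  -- The candidate inverse is `a ⊗ b ↦ ν⁻¹ (a₂ b) ⊗ a₁`. Both maps land in composable pairs, so the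
  -- projections inserted after them disappear in the two verifications.
  inv := incl (X := P) ≫ (Δ[A] ▷ A ≫ (α_ A A A).hom ≫ A ◁ (μ[A] ≫ ν.inv) ≫ (β_ A A).inv) ≫
    proj (X := P)
  hom_inv_id := by
    simp only [twist]
    refine Rep.ext _ _ ?_
    simp only [hP.out, middle, MonoidalCategory.tensorHom_def]
    have h : Rel ν.hom ν.inv 2 [d 0, d 2, b 2, m 1, e 1, d 1, c 0, m 1, n 1, d 0, d 2, b 2, m 1,
      e 1,
      d 0, m 1, i 1, b 0, d 0, d 2, b 2, m 1, e 1] [d 0, d 2, b 2, m 1, e 1] :=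
      ((twist_middle hν) ∷ (twistInv_middle hν ν.hom_inv_id ν.inv_hom_id)
        ∷ (middle_twist_twistInv hν ν.hom_inv_id ν.inv_hom_id) ∷
        .nil).derive [fw 0 0 22222222211111111000100, fw 1 0 111111111000000000,
        fw 2 0 1111111111111]
    exact h.transport
  inv_hom_id := by
    simp only [twist]
    refine Rep.ext _ _ ?_
    simp only [hP.out, middle, MonoidalCategory.tensorHom_def]
    have h : Rel ν.hom ν.inv 2 [d 0, d 2, b 2, m 1, e 1, d 0, m 1, i 1, b 0, d 0, d 2, b 2, m 1,
      e 1,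
      d 1, c 0, m 1, n 1, d 0, d 2, b 2, m 1, e 1] [d 0, d 2, b 2, m 1, e 1] :=
      ((twist_middle hν) ∷ (twistInv_middle hν ν.hom_inv_id ν.inv_hom_id)
        ∷ (middle_twistInv_twist hν ν.inv_hom_id) ∷ .nil).derive
        [fw 0 0 11111111000100000000000, fw 1 0 222111211111100000, fw 2 0 1111111111111]
    exact h.transport

/-- The groupoid structure given by an invertible antipode. -/
def groupoidStructure (ν : A ≅ A) (hν : IsAntipode ν.hom) :
    (quantumCategory C P T).GroupoidStructure where
  υ :=
    { hom := incl (X := C) ≫ ν.hom ≫ ν.hom ≫ proj (X := C)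
      inv := incl (X := C) ≫ ν.inv ≫ ν.inv ≫ proj (X := C)
      hom_inv_id := by
        refine Rep.ext _ _ ?_
        simp only [hC.out]
        have h : Rel ν.hom ν.inv 1 [t 0, n 0, n 0, t 0, i 0, i 0, t 0] [t 0] :=
          (target_target ∷ (object_object_inv hν ν.hom_inv_id) ∷ .nil).derive [bw 0 0 2221000,
            fw 1 0 11111111]
        exact h.transport
      inv_hom_id := by
        refine Rep.ext _ _ ?_
        simp only [hC.out]
        have h : Rel ν.hom ν.inv 1 [t 0, i 0, i 0, t 0, n 0, n 0, t 0] [t 0] :=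
          (target_target ∷ (object_inv_object hν ν.hom_inv_id ν.inv_hom_id) ∷ .nil).derive
            [bw 0 0 2221000, fw 1 0 11111111]
        exact h.transport }
  υ_hom :=
    { hom_counit := by
        change (incl (X := C) ≫ ν.hom ≫ ν.hom ≫ proj (X := C)) ≫ ε[C] = ε[C]
        refine Rep.ext _ _ ?_
        simp only [hC.out]
        have h : Rel ν.hom ν.inv 1 [t 0, n 0, n 0, t 0, e 0] [t 0, e 0] :=
          (target_counit ∷ (antipode_counit hν) ∷ .nil).derive [fw 0 0 11000, fw 1 0 1100,
            fw 1 0 110]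
        exact h.transport
      hom_comul := by
        change (incl (X := C) ≫ ν.hom ≫ ν.hom ≫ proj (X := C)) ≫ Δ[C] =
          ((Δ[C] ≫ (β_ C C).hom) ≫ (β_ C C).hom) ≫
            ((incl (X := C) ≫ ν.hom ≫ ν.hom ≫ proj (X := C)) ⊗ₘ
              (incl (X := C) ≫ ν.hom ≫ ν.hom ≫ proj (X := C)))
        refine Rep.ext _ _ ?_
        simp only [hC.out]
        have h : Rel ν.hom ν.inv 1 [t 0, n 0, n 0, t 0, d 0, t 0, t 1] [t 0, d 0, t 0, t 1, c 0,
          c 0, n 0,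
          n 0, t 0, n 1, n 1, t 1] :=
          ((object_comul hν) ∷ (endo_left_br .target) ∷ (endo_right_br .target) ∷ target_target ∷
            .nil).derive [fw 0 0 1111111, fw 1 0 22222222211000, fw 2 0 22222222110000,
            fw 3 0 22211000000000, fw 2 0 2222222221100, fw 1 0 2222222211000, fw 3 1 2222222110000,
            bw 2 0 222122221000, bw 1 0 222222110000, bw 2 0 222222212100, bw 1 0 222222211000]
        exact h.transport }
  ν := ν
  ν_hom :=
    { hom_counit := by
        change ν.hom ≫ ε[A] = ε[A]
        refine Rep.ext _ _ ?_
        simp only [idem_refl]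
        have h : Rel ν.hom ν.inv 1 [n 0, e 0] [e 0] :=
          ((antipode_counit hν) ∷ .nil).derive [fw 0 0 11]
        exact h.transport
      hom_comul := by
        change ν.hom ≫ Δ[A] = (Δ[A] ≫ (β_ A A).hom) ≫ (ν.hom ⊗ₘ ν.hom)
        refine Rep.ext _ _ ?_
        simp only [idem_refl]
        have h : Rel ν.hom ν.inv 1 [n 0, d 0] [d 0, c 0, n 0, n 1] :=
          ((antipode_comul hν) ∷ (endo_right_br .antipode) ∷ (endo_left_br .antipode) ∷ .nil).derive
            [fw 0 0 11, fw 1 0 1010, fw 2 0 2110]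
        exact h.transport }
  θ := twistIso P ν hν
  θ_hom := by
    change ((rightCoaction P ≫ leftCoaction P ▷ A ≫ (α_ (A ⊗ A) P A).hom) ≫
        (A ⊗ A) ◁ (P ◁ ν.hom ≫ (β_ P A).hom) ≫ (α_ (A ⊗ A) A P).inv) ≫
        ((A ⊗ A) ⊗ A) ◁ (incl (X := P) ≫ twist ν.hom ≫ proj (X := P)) =
      (incl (X := P) ≫ twist ν.hom ≫ proj (X := P)) ≫
        (rightCoaction P ≫ leftCoaction P ▷ A ≫ (α_ (A ⊗ A) P A).hom) ≫
        (α_ (A ⊗ A) P A).inv ≫ ((A ⊗ A) ⊗ P) ◁ ν.inv ≫ (β_ A ((A ⊗ A) ⊗ P)).inv ≫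
        (α_ A (A ⊗ A) P).inv ≫ (α_ A A A).inv ▷ P
    simp only [twist]
    refine Rep.ext _ _ ?_
    simp only [hP.out, middle, tensorμ, MonoidalCategory.tensorHom_def,
      BraidedCategory.braiding_tensor_left_hom, BraidedCategory.braiding_tensor_right_inv]
    have h : Rel ν.hom ν.inv 2 [d 0, d 2, b 2, m 1, e 1, d 0, d 2, c 1, m 2, d 0, d 2, c 1, n 4,
      c 3,
      c 2, d 4, c 3, m 4, n 4, d 3, d 5, b 5, m 4, e 4] [d 0, d 2, b 2, m 1, e 1, d 1, c 0, m 1,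
        n 1,
      d 0, d 2, b 2, m 1, e 1, d 0, d 2, c 1, m 2, d 0, d 2, c 1, i 4, b 3, b 2, b 1, b 0] :=
      -- The idempotents following the two occurrences of `twist` are absorbed or restored by
      -- `twist_middle`; the equation between them already holds on all of `A ⊗ A`.
      ((twist_middle hν) ∷ (twist_coaction_eq hν ν.hom_inv_id ν.inv_hom_id) ∷ .nil).derive
        [fw 0 3 111111110001000000000000, fw 1 0 1111111111111000100, bw 0 0 222222222222111000100]
    exact h.transport
  source_ν := by
    change ν.hom ≫ source A ≫ proj (X := C) = proj (X := C)
    refine Rep.ext _ _ ?_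
    simp only [idem_refl, hC.out]
    have h : Rel ν.hom ν.inv 1 [n 0, s 0, t 0] [t 0] :=
      ((antipode_source hν) ∷ target_target ∷ .nil).derive [fw 0 0 211, fw 1 0 11]
    exact h.transport
  target_ν := by
    change ν.hom ≫ proj (X := C) =
      (source A ≫ proj (X := C)) ≫ incl (X := C) ≫ ν.hom ≫ ν.hom ≫ proj (X := C)
    refine Rep.ext _ _ ?_
    simp only [idem_refl, hC.out]
    have h : Rel ν.hom ν.inv 1 [n 0, t 0] [s 0, t 0, n 0, n 0, t 0] :=
      ((antipode_target_eq hν) ∷ .nil).derive [fw 0 0 11]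
    exact h.transport
  θ_ς := by
    change (incl (X := P) ≫ twist ν.hom ≫ proj (X := P)) ≫ incl (X := P) ≫ (arrows C).right ▷ A ≫
        (((source A ≫ proj (X := C)) ▷ C) ⊗ₘ proj (X := C)) ≫ (α_ C C C).hom =
      (incl (X := P) ≫ (arrows C).right ▷ A ≫
        (((source A ≫ proj (X := C)) ▷ C) ⊗ₘ proj (X := C)) ≫ (α_ C C C).hom) ≫
        (β_ C (C ⊗ C)).hom ≫ (α_ C C C).hom ≫
        C ◁ (C ◁ (incl (X := C) ≫ ν.hom ≫ ν.hom ≫ proj (X := C)))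
    simp only [twist]
    refine Rep.ext _ _ ?_
    simp only [hC.out, hP.out, middle, MonoidalCategory.tensorHom_def,
      BraidedCategory.braiding_tensor_right_hom]
    have h : Rel ν.hom ν.inv 2 [d 0, d 2, b 2, m 1, e 1, d 1, c 0, m 1, n 1, d 0, d 2, b 2, m 1,
      e 1,
      d 0, t 1, s 0, t 0, t 2] [d 0, d 2, b 2, m 1, e 1, d 0, t 1, s 0, t 0, t 2, c 0, c 1, n 2,
        n 2,
      t 2] :=
      ((twist_middle hν) ∷ source_target ∷ (middle_twist_span hν) ∷ (endo_left_br .target) ∷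
        .nil).derive [fw 0 0 2222111211111000100, fw 1 0 11000000000000, fw 2 0 1111111111111,
        bw 3 1 222110000000000, bw 3 0 222211000000000]
    exact h.transport

end

end WeakBimonoid

/-! ### Splitting the idempotents in the Cauchy completion. -/

namespace WeakBimonoid

open Diagram Diagram.Cut

section

variable {𝒱 : Type u} [Category.{v} 𝒱] [MonoidalCategory 𝒱] [BraidedCategory 𝒱] (A : 𝒱) [MonObj A]
  [ComonObj A] [WeakBimonoid A]

theorem target_comp_target : target A ≫ target A = target A := by
  have h : Rel (𝟙 A) (𝟙 A) 1 [t 0, t 0] [t 0] := target_target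
  exact h.transport

theorem source_comp_target : source A ≫ target A = source A := by
  have h : Rel (𝟙 A) (𝟙 A) 1 [s 0, t 0] [s 0] := source_target
  exact h.transport

theorem one_comp_target : η[A] ≫ target A = η[A] := by
  have h : Rel (𝟙 A) (𝟙 A) 0 [u 0, t 0] [u 0] := one_target
  exact h.transport

theorem target_comp_counit : target A ≫ ε[A] = ε[A] := by
  have h : Rel (𝟙 A) (𝟙 A) 1 [t 0, e 0] [e 0] := target_counit
  exact h.transport

theorem tensor_target_mul_target :
    (target A ⊗ₘ target A) ≫ μ[A] ≫ target A = (target A ⊗ₘ target A) ≫ μ[A] := by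
  rw [MonoidalCategory.tensorHom_def]
  have h : Rel (𝟙 A) (𝟙 A) 2 [t 0, t 1, m 0, t 0] [t 0, t 1, m 0] := target_target_mul_target
  exact h.transport

theorem target_comul_tensor_target :
    target A ≫ Δ[A] ≫ (target A ⊗ₘ target A) = Δ[A] ≫ (target A ⊗ₘ target A) := by
  rw [MonoidalCategory.tensorHom_def]
  have h : Rel (𝟙 A) (𝟙 A) 1 [d 0, t 0, t 1] [t 0, d 0, t 0, t 1] := comul_target_target
  exact h.transport.symm

theorem middle_comp_middle : middle A ≫ middle A = middle A := by
  simp only [middle, MonoidalCategory.tensorHom_def]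
  have h : Rel (𝟙 A) (𝟙 A) 2 [d 0, d 2, b 2, m 1, e 1, d 0, d 2, b 2, m 1, e 1]
      [d 0, d 2, b 2, m 1, e 1] := middle_middle
  exact h.transport

theorem middle_whisker_comm :
    (α_ A A A).hom ≫ A ◁ middle A ≫ (α_ A A A).inv ≫ middle A ▷ A =
      middle A ▷ A ≫ (α_ A A A).hom ≫ A ◁ middle A ≫ (α_ A A A).inv := by
  simp only [middle, MonoidalCategory.tensorHom_def]
  have h : Rel (𝟙 A) (𝟙 A) 3 [d 0, d 2, b 2, m 1, e 1, d 1, d 3, b 3, m 2, e 2]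
      [d 1, d 3, b 3, m 2, e 2, d 0, d 2, b 2, m 1, e 1] := middle_comm
  exact h.transport.symm

/-- The idempotent of `A ⊗ A ⊗ A` split by the object of composable triples. -/
theorem middle_whisker_comp_self :
    (middle A ▷ A ≫ (α_ A A A).hom ≫ A ◁ middle A ≫ (α_ A A A).inv) ≫
      (middle A ▷ A ≫ (α_ A A A).hom ≫ A ◁ middle A ≫ (α_ A A A).inv) =
    middle A ▷ A ≫ (α_ A A A).hom ≫ A ◁ middle A ≫ (α_ A A A).inv := by
  simp only [Category.assoc]
  rw [reassoc_of% (middle_whisker_comm A), ← comp_whiskerRight_assoc, middle_comp_middle,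
    Iso.inv_hom_id_assoc, ← MonoidalCategory.whiskerLeft_comp_assoc, middle_comp_middle]

variable {A}

theorem twist_comp_middle {ν : A ⟶ A} (hν : IsAntipode ν) : twist ν ≫ middle A = twist ν := by
  simp only [twist, middle, MonoidalCategory.tensorHom_def]
  have h : Rel ν (𝟙 A) 2 [d 1, c 0, m 1, n 1, d 0, d 2, b 2, m 1, e 1] [d 1, c 0, m 1, n 1] :=
    twist_middle hν
  exact h.transport

end

section

variable {V : Type u} [Category.{v} V] (P : Karoubi V) (e : P ⟶ P) (he : e ≫ e = e)

/-- The object split by an idempotent is a retract. -/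
@[reducible]
def splittingCut : Cut (splitting P e he) P where
  incl := ⟨e.f, by
    have : e.f ≫ e.f = e.f := congrArg Karoubi.Hom.f he
    simp [splitting, this]⟩
  proj := ⟨e.f, by
    have : e.f ≫ e.f = e.f := congrArg Karoubi.Hom.f he
    simp [splitting, this]⟩
  incl_proj := Karoubi.hom_ext _ _ (show e.f ≫ e.f = e.f from congrArg Karoubi.Hom.f he)

theorem idem_splitting : letI := splittingCut P e he; idem (splitting P e he) = e :=
  Karoubi.hom_ext _ _ (congrArg Karoubi.Hom.f he)

end

end WeakBimonoid

open WeakBimonoid in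
theorem mainTheorem1 {V : Type u} [Category.{v} V] [MonoidalCategory V] [BraidedCategory V]
    (A : Karoubi V) [MonObj A] [ComonObj A] [WeakBimonoid A] :
    ∃ (ht : target A ≫ target A = target A)
      (mC : MonObj (splitting A (target A) ht)) (cC : ComonObj (splitting A (target A) ht)),
      mC.mul.f = ((target A).f ⊗ₘ (target A).f) ≫ μ[A].f ∧
      mC.one.f = η[A].f ∧
      cC.comul.f = Δ[A].f ≫ ((target A).f ⊗ₘ (target A).f) ∧
      cC.counit.f = ε[A].f ∧
      IsSeparableFrobenius (splitting A (target A) ht) ∧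
      ∃ Q : QuantumCategory A (splitting A (target A) ht),
        Q.s.f = (source A).f ∧
        Q.t.f = (target A).f ∧
        Q.id.f = (target A).f ∧
        Q.comp = Q.P.incl ≫ μ[A] ∧
        (∃ p : A ⊗ A ⟶ Q.P.obj, Q.P.incl ≫ p = 𝟙 Q.P.obj ∧ p ≫ Q.P.incl = middle A) ∧
        ∀ (ν : A ⟶ A) [IsIso ν], IsAntipode ν →
          ∃ G : Q.GroupoidStructure,
            G.ν.hom = ν ∧
            G.υ.hom.f = (target A).f ≫ ν.f ≫ ν.f ≫ (target A).f ∧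
            G.θ.hom ≫ Q.P.incl = Q.P.incl ≫ twist ν := by
  have ht := target_comp_target A
  let C := splitting A (target A) ht
  let P := splitting (A ⊗ A) (middle A) (middle_comp_middle A)
  let T := splitting ((A ⊗ A) ⊗ A) _ (middle_whisker_comp_self A)
  let _ : Diagram.Cut C A := splittingCut _ _ _
  let _ : Diagram.Cut P (A ⊗ A) := splittingCut _ _ _
  let _ : Diagram.Cut T ((A ⊗ A) ⊗ A) := splittingCut _ _ _
  have : Fact (Diagram.Cut.idem C = target A) := ⟨idem_splitting _ _ _⟩
  have : Fact (Diagram.Cut.idem P = middle A) := ⟨idem_splitting _ _ _⟩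
  have : Fact (Diagram.Cut.idem T = middle A ▷ A ≫ (α_ A A A).hom ≫ A ◁ middle A ≫
    (α_ A A A).inv) := ⟨idem_splitting _ _ _⟩
  refine ⟨ht, objectMon C, objectComon C, ?_, ?_, ?_, ?_, isSeparableFrobenius_object C,
    quantumCategory C P T, ?_, ?_, ?_, rfl,
    ⟨Diagram.Cut.proj (X := P), Diagram.Cut.incl_proj (X := P), idem_splitting _ _ _⟩, ?_⟩
  -- The constructed multiplication ends with a projection by `t`. It has no effect because the
  -- image of `t` is closed under multiplication.
  · exact congrArg Karoubi.Hom.f (tensor_target_mul_target A)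
  · exact congrArg Karoubi.Hom.f (one_comp_target A)
  · exact congrArg Karoubi.Hom.f (target_comul_tensor_target A)
  · exact congrArg Karoubi.Hom.f (target_comp_counit A)
  · exact congrArg Karoubi.Hom.f (source_comp_target A)
  · rfl
  · rfl
  · intro ν _ hν
    refine ⟨groupoidStructure C P T (asIso ν) hν, rfl, rfl, ?_⟩
    change (Diagram.Cut.incl (X := P) ≫ twist ν ≫ Diagram.Cut.proj (X := P)) ≫
      Diagram.Cut.incl (X := P) = Diagram.Cut.incl (X := P) ≫ twist ν
    have h : Diagram.Cut.proj (X := P) ≫ Diagram.Cut.incl (X := P) = middle A :=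
      idem_splitting _ _ _
    -- Projecting to `P` and including again is the idempotent, which `twist` absorbs since its
    -- values are composable pairs.
    rw [Category.assoc, Category.assoc, h, twist_comp_middle hν]
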